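/- Conventions. Manifolds and maps are smooth ($C^\infty$). Let $(M,\pi)$ be a Poisson manifold of dimension $n$ and rank $2r$, the rank of $\pi$ being the maximum of its pointwise ranks. A completely integrable system on $(M,\pi)$ is a regular foliation $\mathcal F$ of dimension $r$ which is locally given by the common level sets of $n-r$ functions with independent differentials and with vanishing pairwise Poisson brackets. An isomorphism of completely integrable systems is a diffeomorphism preserving the Poisson structure and the foliation; the direct product of two systems carries the product Poisson structure and the product foliation. Let $\iota:\mathcal S\hookrightarrow M$ be a symplectic leaf of dimension $2r'$, with its induced Poisson (symplectic) structure; $\mathcal S$ is $\mathcal F$-regular if $\dim(T_s\mathcal F\cap T_s\mathcal S)=r'$ for all $s\in\mathcal S$. A transversal through $s\in\mathcal S$ is a submanifold $\mathcal T\ni s$ of $M$ with $T_sM=T_s\mathcal T\oplus T_s\mathcal S$; it is $\mathcal F$-compatible if, on a neighbourhood of $s$ in $\mathcal T$, $\mathcal F$ restricts to a regular foliation $\mathcal F_{\mathcal T}$ of dimension $r-r'$ (with tangent spaces $T\mathcal F\cap T\mathcal T$). A Poisson structure $\pi_{\mathcal T}$ on an open subset of $\mathcal T$ is induced by $\pi$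 (Poisson-Dirac) if each covector $\beta$ of $\mathcal T$ is the restriction of a covector $\alpha$ of $M$ with $\pi^\sharp\alpha=\pi_{\mathcal T}^\sharp\beta$ (in particular tangent to $\mathcal T$); there is at most one such structure. The system is split at $s\in\mathcal S$ if there are an open neighbourhood $U$ of $s$ in $M$, an open neighbourhood $V\subset U$ of $s$ in $\mathcal S$ (for the leaf topology), and a completely integrable system $(\pi_B,\mathcal F_B)$ on an open ball $B\subset\mathbb R^{n-2r'}$, with foliation of dimension $r-r'$ and rank $2(r-r')$, such that $U$ is isomorphic, as a completely integrable system, to the direct product of the system induced on $V$ and the system on $B$. Any such system on $B$, pointed at the component $b\in B$ of $s$, is called a transverse completely integrable system at $s$. The system is split at $\mathcal S$ if it is split at every point of $\mathcal S$. Two pointed systems are locally isomorphic if some open neighbourhoods of their base points are isomorphic as systems, by an isomorphism carrying base point to base point. Proposition. Let $(M,\pi)$ be a Hausdorff Poisson manifold of dimension $n$ and rank $2r$, $\mathcal F$ a completely integrable system on it, and $\mathcal S$ an $\mathcal F$-regular symplectic leaf of dimension $2r'$. Assume that every point of $\mathcal S$ is in the closure of the set of points where $\pi$ has rank $2r$.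 (1) Suppose the system is split at the point $s\in\mathcal S$. For every $\mathcal F$-compatible transversal $\mathcal T$ through $s$, some open neighbourhood $W$ of $s$ in $\mathcal T$ carries an induced Poisson structure $\pi_{\mathcal T}$, and $(W,\pi_{\mathcal T},\mathcal F_{\mathcal T})$ is a completely integrable system (of rank $2(r-r')$). This induced system, pointed at $s$, is locally isomorphic to every transverse completely integrable system at $s$. Any two transverse completely integrable systems at $s$ are locally isomorphic. (2) Suppose the system is split at $\mathcal S$. Then, for all $s,s'\in\mathcal S$, the system induced on any $\mathcal F$-compatible transversal through $s$ (pointed at $s$) is locally isomorphic to every transverse completely integrable system at $s'$, and any transverse completely integrable systems at $s$ and at $s'$ are locally isomorphic. In this sense the transverse completely integrable system of a split system is well defined. -/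

import Mathlib

open scoped Manifold ContDiff Topology

noncomputable section

namespace SplitSystem

section Poisson

variable {E : Type*} [NormedAddCommGroup E] [NormedSpace ℝ E]
  {H : Type*} [TopologicalSpace H] (I : ModelWithCorners ℝ E H)
  {M : Type*} [TopologicalSpace M] [ChartedSpace H M]

/-- The differential of a real function at a point, as a covector. -/
def diff (f : M → ℝ) (x : M) : TangentSpace I x →L[ℝ] ℝ := mfderiv I 𝓘(ℝ, ℝ) f x

variable (M) in
/-- A field of linear maps `T*ₓM → TₓM`, `α ↦ α♯`. A bivector field `π` is encoded by the map
`♯` with `β (α♯) = π (α, β)`; skew-symmetry and smoothness are part of `IsPoissonOn`. -/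
abbrev SharpField := ∀ x : M, (TangentSpace I x →L[ℝ] ℝ) →ₗ[ℝ] TangentSpace I x

variable (M) in
/-- A field of tangent subspaces. -/
abbrev Distribution := ∀ x : M, Submodule ℝ (TangentSpace I x)

variable {I}

/-- The Hamiltonian vector field of `f`. -/
def hamVF (π : SharpField I M) (f : M → ℝ) (x : M) : TangentSpace I x := π x (diff I f x)

/-- The bracket `{f, g} = π (df, dg)`. -/
def bracket (π : SharpField I M) (f g : M → ℝ) (x : M) : ℝ := diff I g x (hamVF π f x)

/-- `π` is a smooth Poisson bivector field on the open set `U`. -/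
structure IsPoissonOn (π : SharpField I M) (U : Set M) : Prop where
  skew : ∀ x ∈ U, ∀ α β : TangentSpace I x →L[ℝ] ℝ, β (π x α) = -α (π x β)
  smooth : ∀ V : Set M, IsOpen V → V ⊆ U → ∀ f g : M → ℝ,
    ContMDiffOn I 𝓘(ℝ, ℝ) ∞ f V → ContMDiffOn I 𝓘(ℝ, ℝ) ∞ g V →
      ContMDiffOn I 𝓘(ℝ, ℝ) ∞ (bracket π f g) V
  jacobi : ∀ V : Set M, IsOpen V → V ⊆ U → ∀ f g h : M → ℝ,
    ContMDiffOn I 𝓘(ℝ, ℝ) ∞ f V → ContMDiffOn I 𝓘(ℝ, ℝ) ∞ g V →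
    ContMDiffOn I 𝓘(ℝ, ℝ) ∞ h V → ∀ x ∈ V,
      bracket π f (bracket π g h) x + bracket π g (bracket π h f) x
        + bracket π h (bracket π f g) x = 0

/-- The characteristic subspace `π♯(T*ₓM)`: the tangent space at `x` of the symplectic leaf
through `x`. -/
def charSpace (π : SharpField I M) (x : M) : Submodule ℝ (TangentSpace I x) :=
  LinearMap.range (π x)

/-- The rank of the bivector at `x`. -/
def rankAt (π : SharpField I M) (x : M) : ℕ := Module.finrank ℝ (charSpace π x)

/-- The rank of `π` on `U`, the maximum of the ranks at the points of `U`, equals `k`. -/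
def HasRankOn (π : SharpField I M) (U : Set M) (k : ℕ) : Prop :=
  (∀ x ∈ U, rankAt π x ≤ k) ∧ ∃ x ∈ U, rankAt π x = k

/-- On `V` the functions `f₁, …, f_m` are smooth and independent, and `D` is the tangent
distribution of the foliation by their common level sets. -/
structure DefinesOn {m : ℕ} (f : Fin m → M → ℝ) (D : Distribution I M) (V : Set M) : Prop where
  smooth : ∀ i, ContMDiffOn I 𝓘(ℝ, ℝ) ∞ (f i) V
  independent : ∀ x ∈ V, LinearIndependent ℝ (fun i => diff I (f i) x)
  tangent : ∀ x ∈ V, ∀ v : TangentSpace I x, v ∈ D x ↔ ∀ i, diff I (f i) x v = 0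

/-- `D` is on `U` the tangent distribution of a regular foliation with leaves of dimension `r`:
locally the leaves are the level sets of `dim M - r` independent functions. -/
def IsFoliationOn (D : Distribution I M) (U : Set M) (r : ℕ) : Prop :=
  ∀ x ∈ U, ∃ V : Set M, IsOpen V ∧ x ∈ V ∧ V ⊆ U ∧ ∃ (m : ℕ) (f : Fin m → M → ℝ),
    r + m = Module.finrank ℝ E ∧ DefinesOn f D V

/-- `(π, D)` is a completely integrable system on the open set `U`: `π` is Poisson of rank `2r`
on `U`, and `D` is the tangent distribution of a regular foliation of dimension `r` that is
locally defined by `dim M - r` independent functions in involution. -/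
structure IsIntegrableOn (π : SharpField I M) (D : Distribution I M) (U : Set M) (r : ℕ) :
    Prop where
  poisson : IsPoissonOn π U
  rank : HasRankOn π U (2 * r)
  foliation : ∀ x ∈ U, ∃ V : Set M, IsOpen V ∧ x ∈ V ∧ V ⊆ U ∧
    ∃ (m : ℕ) (f : Fin m → M → ℝ), r + m = Module.finrank ℝ E ∧ DefinesOn f D V ∧
      ∀ i j, ∀ y ∈ V, bracket π (f i) (f j) y = 0

/-- `y` is reached from `x` along an integral curve, on `[0, 1]`, of a Hamiltonian vector
field. -/
def HamStep (π : SharpField I M) (x y : M) : Prop :=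
  ∃ f : M → ℝ, ContMDiff I 𝓘(ℝ, ℝ) ∞ f ∧ ∃ γ : ℝ → M,
    IsMIntegralCurveOn (I := I) γ (hamVF π f) (Set.Icc 0 1) ∧ γ 0 = x ∧ γ 1 = y

end Poisson

section Maps

variable {E : Type*} [NormedAddCommGroup E] [NormedSpace ℝ E]
  {H : Type*} [TopologicalSpace H] {I : ModelWithCorners ℝ E H}
  {M : Type*} [TopologicalSpace M] [ChartedSpace H M]
  {F : Type*} [NormedAddCommGroup F] [NormedSpace ℝ F]
  {G : Type*} [TopologicalSpace G] {J : ModelWithCorners ℝ F G}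
  {N : Type*} [TopologicalSpace N] [ChartedSpace G N]

variable (I J) in
/-- `i : N → M` is an injective immersion, i.e. it presents `N` as a submanifold of `M`. -/
structure IsSubmanifold (i : N → M) : Prop where
  smooth : ContMDiff J I ∞ i
  injective : Function.Injective i
  immersion : ∀ x, Function.Injective (mfderiv J I i x)

variable (J) in
/-- The tangent distribution `TN ∩ D` of the foliation induced on a submanifold. -/
def inducedDistribution (D : Distribution I M) (i : N → M) : Distribution J N :=
  fun x => (D (i x)).comap (mfderiv J I i x).toLinearMap

/-- On `W`, `πN` is the bivector field that `π` induces on the Poisson-Dirac submanifold `N`: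
every covector `β` of `N` extends to a covector `α` of `M` whose `♯` is tangent to `N`, and
`β♯` is that tangent vector. There is at most one such `πN`. -/
def IsInducedOn (π : SharpField I M) (i : N → M) (πN : SharpField J N) (W : Set N) : Prop :=
  ∀ x ∈ W, ∀ β : TangentSpace J x →L[ℝ] ℝ, ∃ α : TangentSpace I (i x) →L[ℝ] ℝ,
    α.comp (mfderiv J I i x) = β ∧ mfderiv J I i x (πN x β) = π (i x) α

/-- `Φ` is an isomorphism of (open parts of) completely integrable systems: a diffeomorphism
from its source onto its target that carries the bivector to the bivector and the foliation to
the foliation. -/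
def IsSystemIso (Φ : PartialDiffeomorph I J M N ∞) (πM : SharpField I M) (DM : Distribution I M)
    (πN : SharpField J N) (DN : Distribution J N) : Prop :=
  ∀ x ∈ Φ.source,
    (∀ β : TangentSpace J (Φ x) →L[ℝ] ℝ,
      mfderiv I J Φ x (πM x (β.comp (mfderiv I J Φ x))) = πN (Φ x) β) ∧
    (DM x).map (mfderiv I J Φ x).toLinearMap = DN (Φ x)

/-- The pointed systems `(U, x)` and `(V, y)` are isomorphic near their base points. -/
def LocallyIsomorphic (πM : SharpField I M) (DM : Distribution I M) (U : Set M) (x : M)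
    (πN : SharpField J N) (DN : Distribution J N) (V : Set N) (y : N) : Prop :=
  ∃ Φ : PartialDiffeomorph I J M N ∞, x ∈ Φ.source ∧ Φ.source ⊆ U ∧ Φ.target ⊆ V ∧ Φ x = y ∧
    IsSystemIso Φ πM DM πN DN

/-- The inclusion `v ↦ (v, 0)` of the first factor in the tangent space of a product. -/
def inlT (p : M × N) : TangentSpace I p.1 →L[ℝ] TangentSpace (I.prod J) p :=
  ContinuousLinearMap.inl ℝ E F

/-- The inclusion `w ↦ (0, w)` of the second factor in the tangent space of a product. -/
def inrT (p : M × N) : TangentSpace J p.2 →L[ℝ] TangentSpace (I.prod J) p :=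
  ContinuousLinearMap.inr ℝ E F

/-- The product bivector field on `M × N`. -/
def prodSharp (πM : SharpField I M) (πN : SharpField J N) : SharpField (I.prod J) (M × N) :=
  fun p =>
    { toFun := fun α =>
        inlT p (πM p.1 (α.comp (inlT p))) + inrT p (πN p.2 (α.comp (inrT p)))
      map_add' := fun α β => by
        simp only [ContinuousLinearMap.add_comp, map_add]
        abel
      map_smul' := fun c α => by
        simp only [ContinuousLinearMap.smul_comp, map_smul, smul_add, RingHom.id_apply] }

/-- The tangent distribution of the product foliation on `M × N`. -/
def prodDistribution (DM : Distribution I M) (DN : Distribution J N) :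
    Distribution (I.prod J) (M × N) :=
  fun p => (DM p.1).map (inlT p).toLinearMap ⊔ (DN p.2).map (inrT p).toLinearMap

variable (J) in
/-- `ι : S → M` is a symplectic leaf of `π`: a connected immersed submanifold tangent to the
characteristic subspaces, whose points form one class of points of `M` that can be joined by
Hamiltonian paths. -/
structure IsSymplecticLeaf (π : SharpField I M) (ι : N → M) : Prop where
  connected : ConnectedSpace N
  submanifold : IsSubmanifold I J ι
  tangent : ∀ σ, LinearMap.range (mfderiv J I ι σ).toLinearMap = charSpace π (ι σ)
  orbit : ∀ σ, Set.range ι = {y | Relation.ReflTransGen (HamStep π) (ι σ) y}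

variable (J) in
/-- The leaf `ι : S → M`, of dimension `2r'`, is regular for the foliation tangent to `D`:
`dim (TₛF ∩ TₛS) = r'` at each of its points. -/
def IsRegularLeaf (D : Distribution I M) (ι : N → M) (r' : ℕ) : Prop :=
  ∀ σ, Module.finrank ℝ
    ↥(D (ι σ) ⊓ LinearMap.range (mfderiv J I ι σ).toLinearMap) = r'

variable (J) in
/-- `i : T → M` is a transversal through the point `i t` to the symplectic leaf of that point:
`TₓM` is the direct sum of the tangent spaces of `T` and of the leaf at `x = i t`. -/
structure IsTransversal (π : SharpField I M) (i : N → M) (t : N) : Prop where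
  submanifold : IsSubmanifold I J i
  transverse : IsCompl (LinearMap.range (mfderiv J I i t).toLinearMap) (charSpace π (i t))

variable (J) in
/-- A transversal is compatible with a foliation when, near the base point, the foliation
restricts to a regular foliation of dimension `k` on it. -/
structure IsCompatibleTransversal (π : SharpField I M) (D : Distribution I M) (i : N → M) (t : N)
    (k : ℕ) : Prop where
  transversal : IsTransversal J π i t
  compatible : ∃ W : Set N, IsOpen W ∧ t ∈ W ∧ IsFoliationOn (inducedDistribution J D i) W k

end Maps

section Split

variable {n d : ℕ}
  {M : Type*} [TopologicalSpace M] [ChartedSpace (EuclideanSpace ℝ (Fin n)) M]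

/-- A bivector field and a field of tangent subspaces on an open ball of dimension `d`, with a
base point. Only the restrictions of the two fields to the ball matter. -/
structure BallSystem (d : ℕ) where
  centre : EuclideanSpace ℝ (Fin d)
  radius : ℝ
  base : EuclideanSpace ℝ (Fin d)
  sharp : SharpField (𝓡 d) (EuclideanSpace ℝ (Fin d))
  distribution : Distribution (𝓡 d) (EuclideanSpace ℝ (Fin d))

/-- The open ball of a `BallSystem`. -/
def BallSystem.ball (B : BallSystem d) : Set (EuclideanSpace ℝ (Fin d)) :=
  Metric.ball B.centre B.radius

/-- `B` is a transverse completely integrable system of `(π, D)` at the point `s = ι σ` of the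
leaf `ι : S → M` of dimension `2r'`: it is a completely integrable system on its ball, of
dimension `n - 2r'` and with a foliation of dimension `r - r'`, and an open neighbourhood `U` of
`s` is isomorphic to the direct product of the induced system on `V` and `B`, where `V` is an open
neighbourhood of `σ` in the leaf that lies in `U`; the base point of `B` is the component of `s`
in the ball. -/
def IsTransverseSystem (π : SharpField (𝓡 n) M) (D : Distribution (𝓡 n) M) (r r' : ℕ)
    {S : Type*} [TopologicalSpace S] [ChartedSpace (EuclideanSpace ℝ (Fin (2 * r'))) S]
    (ι : S → M) (σ : S) (B : BallSystem (n - 2 * r')) : Prop :=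
  IsIntegrableOn B.sharp B.distribution B.ball (r - r') ∧
  ∃ (V : Set S) (πS : SharpField (𝓡 (2 * r')) S)
    (Φ : PartialDiffeomorph (𝓡 n) ((𝓡 (2 * r')).prod (𝓡 (n - 2 * r')))
      M (S × EuclideanSpace ℝ (Fin (n - 2 * r'))) ∞),
    IsOpen V ∧ σ ∈ V ∧ V ⊆ ι ⁻¹' Φ.source ∧ IsInducedOn π ι πS V ∧
    Φ.target = V ×ˢ B.ball ∧ ι σ ∈ Φ.source ∧ (Φ (ι σ)).2 = B.base ∧
    IsSystemIso Φ π D (prodSharp πS B.sharp)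
      (prodDistribution (inducedDistribution (𝓡 (2 * r')) D ι) B.distribution)

/-- The system `(π, D)` is split at the point `ι σ` of the leaf: it has a transverse completely
integrable system there. -/
def IsSplitAt (π : SharpField (𝓡 n) M) (D : Distribution (𝓡 n) M) (r r' : ℕ)
    {S : Type*} [TopologicalSpace S] [ChartedSpace (EuclideanSpace ℝ (Fin (2 * r'))) S]
    (ι : S → M) (σ : S) : Prop :=
  ∃ B : BallSystem (n - 2 * r'), IsTransverseSystem π D r r' ι σ B

end Split

end SplitSystem

end

/-! Near a point s of the leaf a split system is a product of a symplectic factor E₁, foliated by a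
maximal family p of functions in involution, and a Poisson factor E₂. The rank of π at s is already
dim E₁, so the bivector of E₂ vanishes at the base point b, and the leaf is tangent to E₁ × 0 at s.
A transversal through s is therefore, locally, the graph of a map κ : E₂ → E₁.

Compatibility enters through a dimension count: the foliation induced on the transversal has the
same dimension as that of E₂, so it projects isomorphically onto it. Consequently h = p ∘ κ is
constant along the foliation of E₂. If g denotes functions in involution defining that foliation, dh
factors through dg, so h is in involution with itself and with g.

The graph is then straightened by a Poisson diffeomorphism. Let q be conjugate to p, that is {p_i,
q_j} = δ_ij; no relation among the q_j is needed. The Hamiltonian G = ⟨q, h - h(b)⟩ has an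
equilibrium at the base point, and its time-one flow Θ replaces p by p - (h - h(b)) while preserving
g (`exists_straightening`). Hence Θ carries the graph into the product of a Lagrangian fibre of p
with E₂, where the covectors of the first factor that matter vanish and only the bivector of E₂
survives. The E₂-component ψ of Θ on the graph thus identifies the induced bivector with that of E₂
and respects the foliations (`exists_graph_induced`, then `IsSplitChart.exists_induced_iso` on the
manifold).

Two transverse systems at one point are compared by applying this to the slice {v} × E₂ of one split
chart, a transversal on which the induced structure is visibly the Poisson factor, and to the other
split chart (`IsSplitChart.locallyIsomorphic`). To move along the leaf, observe that the component
of a leaf point in the ball is locally constant, so a transverse system at a point is one at all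
nearby points of the leaf; connectedness finishes (`locallyIsomorphic_of_isSplitAt`).

Two analytic ingredients are built on the way. Smooth dependence of flows comes from inverting γ ↦ γ
- ∫ f ∘ γ on the Banach space C([0,1], E). Conjugate functions come from the commutation of the
Hamiltonian fields of p and a Poincaré lemma with parameters. -/

open scoped Manifold ContDiff Topology

noncomputable section

namespace SplitSystem

open Set Filter

/-! ### Composition operators on spaces of continuous maps -/

section Nemytskii

universe u

variable {K : Type*} [TopologicalSpace K] [CompactSpace K]
  {E F : Type u} [NormedAddCommGroup E] [NormedSpace ℝ E] [NormedAddCommGroup F] [NormedSpace ℝ F]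

/-- Pointwise application of a continuous family of operators to a continuous map. -/
def pointwiseApply : C(K, E →L[ℝ] F) →L[ℝ] C(K, E) →L[ℝ] C(K, F) :=
  LinearMap.mkContinuous₂
    (LinearMap.mk₂ ℝ (fun (A : C(K, E →L[ℝ] F)) (u : C(K, E)) =>
      (⟨fun t => A t (u t), by fun_prop⟩ : C(K, F)))
      (fun _ _ _ => by ext; simp) (fun _ _ _ => by ext; simp)
      (fun _ _ _ => by ext; simp) (fun _ _ _ => by ext; simp)) 1 fun A u => by
    refine (ContinuousMap.norm_le _ (by positivity)).2 fun t => ?_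
    rw [one_mul]
    exact (A t).le_of_opNorm_le_of_le (A.norm_coe_le_norm t) (u.norm_coe_le_norm t)

@[simp]
lemma pointwiseApply_apply (A : C(K, E →L[ℝ] F)) (u : C(K, E)) (t : K) :
    pointwiseApply A u t = A t (u t) := rfl

/-- Compactness of K makes the derivative uniformly continuous along γ: currying turns this into
continuity at 0 of a map into C(K, E →L[ℝ] F). The mean value inequality then applies at each t with
the same ε and δ. -/
lemma hasFDerivAt_continuousMap_comp (f : C(E, F)) (f' : C(E, E →L[ℝ] F))
    (hf : ∀ x, HasFDerivAt f (f' x) x) (γ : C(K, E)) :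
    HasFDerivAt (fun γ : C(K, E) => f.comp γ) (pointwiseApply (f'.comp γ)) γ := by
  rw [hasFDerivAt_iff_isLittleO_nhds_zero, Asymptotics.isLittleO_iff]
  intro ε hε
  let g : C(E, C(K, E →L[ℝ] F)) := ContinuousMap.curry ⟨fun q : E × K => f' (γ q.2 + q.1), by fun_prop⟩
  have hg₀ : ContinuousAt g 0 := g.continuous.continuousAt
  obtain ⟨δ, hδ, hg⟩ := (Metric.continuousAt_iff (β := C(K, E →L[ℝ] F))).1 hg₀ ε hε
  filter_upwards [Metric.ball_mem_nhds (0 : C(K, E)) hδ] with h hh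
  rw [mem_ball_zero_iff] at hh
  refine (ContinuousMap.norm_le _ (by positivity)).2 fun t => ?_
  have hb : ∀ x ∈ Metric.ball (γ t) δ, ‖f' x - f' (γ t)‖ ≤ ε := fun x hx => by
    have h1 : dist (x - γ t) 0 < δ := by rwa [dist_zero_right, ← dist_eq_norm]
    have h2 := (hg h1).le
    have h3 := (ContinuousMap.dist_apply_le_dist (f := g (x - γ t)) (g := g 0) t).trans h2
    rw [dist_eq_norm] at h3
    simpa [g] using h3
  have hm : γ t + h t ∈ Metric.ball (γ t) δ := by
    simpa using (h.norm_coe_le_norm t).trans_lt hh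
  have := Convex.norm_image_sub_le_of_norm_hasFDerivWithin_le' (𝕜 := ℝ)
    (fun x _ => (hf x).hasFDerivWithinAt) hb (convex_ball _ _) (Metric.mem_ball_self hδ) hm
  refine le_trans (by simpa using this) ?_
  gcongr
  exact h.norm_coe_le_norm t

/-- The derivative at γ is pointwise multiplication by f' ∘ γ, again a composition operator, so
induction on n applies. The target F varies in the induction because f' takes values in E →L[ℝ] F;
for the same reason E and F share a universe. -/
lemma contDiff_continuousMap_comp_nat (n : ℕ) : ∀ {F : Type u} [NormedAddCommGroup F]
    [NormedSpace ℝ F] (f : C(E, F)), ContDiff ℝ n f →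
      ContDiff ℝ n (fun γ : C(K, E) => f.comp γ) := by
  induction n with
  | zero =>
    intro F _ _ f _
    exact contDiff_zero.2 (ContinuousMap.continuous_postcomp f)
  | succ n ih =>
    intro F _ _ f hf
    push_cast at hf ⊢
    obtain ⟨f', hf'n, hf'⟩ := contDiff_succ_iff_hasFDerivAt.1 hf
    rw [contDiff_succ_iff_hasFDerivAt]
    let g : C(E, E →L[ℝ] F) := ⟨f', hf'n.continuous⟩
    have h1 : ContDiff ℝ n fun A : C(K, E →L[ℝ] F) => pointwiseApply A := by fun_prop
    exact ⟨fun γ => pointwiseApply (g.comp γ), h1.comp (ih g hf'n),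
      hasFDerivAt_continuousMap_comp f g hf'⟩

lemma contDiff_continuousMap_comp (f : C(E, F)) (hf : ContDiff ℝ ∞ f) :
    ContDiff ℝ ∞ (fun γ : C(K, E) => f.comp γ) :=
  contDiff_infty.2 fun n => contDiff_continuousMap_comp_nat n f (contDiff_infty.1 hf n)

end Nemytskii

/-! ### Primitives and parametric integrals -/

section Primitive

lemma continuous_comp_projIcc {X : Type*} [TopologicalSpace X] (g : C(Icc (0 : ℝ) 1, X)) :
    Continuous fun s => g (projIcc 0 1 zero_le_one s) :=
  g.continuous.comp continuous_projIcc

variable {E : Type*} [NormedAddCommGroup E] [NormedSpace ℝ E]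

lemma norm_integral_projIcc_le (g : C(Icc (0 : ℝ) 1, E)) (t : Icc (0 : ℝ) 1) :
    ‖∫ s in (0 : ℝ)..t, g (projIcc 0 1 zero_le_one s)‖ ≤ ‖g‖ := by
  refine (intervalIntegral.norm_integral_le_of_norm_le_const
    fun s _ => g.norm_coe_le_norm _).trans ?_
  rw [sub_zero, abs_of_nonneg t.2.1]
  exact mul_le_of_le_one_right (norm_nonneg g) t.2.2

variable (E) in
/-- The primitive, vanishing at `0`, of a continuous map on `[0, 1]`. -/
def primitive : C(Icc (0 : ℝ) 1, E) →L[ℝ] C(Icc (0 : ℝ) 1, E) :=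
  LinearMap.mkContinuous
    { toFun := fun g => ⟨fun t => ∫ s in (0 : ℝ)..t, g (projIcc 0 1 zero_le_one s),
        (intervalIntegral.continuous_primitive
          (fun _ _ => (continuous_comp_projIcc g).intervalIntegrable _ _) 0).comp
          continuous_subtype_val⟩
      map_add' := fun g h => by
        ext t
        exact intervalIntegral.integral_add ((continuous_comp_projIcc g).intervalIntegrable _ _)
          ((continuous_comp_projIcc h).intervalIntegrable _ _)
      map_smul' := fun c g => by
        ext t
        exact intervalIntegral.integral_smul c _ } 1 fun g => by
    rw [one_mul]
    exact (ContinuousMap.norm_le _ (norm_nonneg g)).2 fun t => norm_integral_projIcc_le g t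

lemma primitive_apply (g : C(Icc (0 : ℝ) 1, E)) (t : Icc (0 : ℝ) 1) :
    primitive E g t = ∫ s in (0 : ℝ)..t, g (projIcc 0 1 zero_le_one s) := rfl

lemma norm_primitive_le (g : C(Icc (0 : ℝ) 1, E)) : ‖primitive E g‖ ≤ ‖g‖ :=
  (ContinuousMap.norm_le _ (norm_nonneg g)).2 fun t => norm_integral_projIcc_le g t

lemma hasDerivWithinAt_primitive [CompleteSpace E] (g : C(Icc (0 : ℝ) 1, E)) {t : ℝ}
    (ht : t ∈ Icc (0 : ℝ) 1) :
    HasDerivWithinAt (fun s => primitive E g (projIcc 0 1 zero_le_one s)) (g ⟨t, ht⟩)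
      (Icc 0 1) t := by
  have h := ((continuous_comp_projIcc g).integral_hasStrictDerivAt 0 t).hasDerivAt.hasDerivWithinAt
    (s := Icc (0 : ℝ) 1)
  rw [projIcc_of_mem _ ht] at h
  refine h.congr (fun s hs => ?_) ?_ <;>
  simp only [primitive_apply, projIcc_of_mem _, *]

end Primitive

section ParametricIntegral

universe u

variable {Z F : Type u} [NormedAddCommGroup Z] [NormedSpace ℝ Z]
  [NormedAddCommGroup F] [NormedSpace ℝ F]

/-- Instead of differentiating under the integral sign, the integral is written as a composite of
smooth maps: the affine map sending z to the path t ↦ (t, z), composition with f, the primitive, and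
evaluation at 1. -/
lemma contDiff_integral_zero_one {f : ℝ × Z → F} (hf : ContDiff ℝ ∞ f) :
    ContDiff ℝ ∞ fun z => ∫ t in (0 : ℝ)..1, f (t, z) := by
  -- The lift places the time variable in the universe common to Z and F, as the composition
  -- operator requires.
  let f₁ : C(ULift.{u} ℝ × Z, F) := ⟨fun q => f (q.1.down, q.2), by
    have := hf.continuous; fun_prop⟩
  have hf₁ : ContDiff ℝ ∞ f₁ :=
    hf.comp ((ContinuousLinearEquiv.ulift (R₁ := ℝ) (M₁ := ℝ)).contDiff.prodMap contDiff_id)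
  let c : Z →L[ℝ] C(Icc (0 : ℝ) 1, ULift.{u} ℝ × Z) :=
    LinearMap.mkContinuous
      { toFun := fun z => ContinuousMap.const _ (0, z)
        map_add' := fun _ _ => by ext <;> simp
        map_smul' := fun _ _ => by ext <;> simp } 1 fun z => by
      refine (ContinuousMap.norm_le _ (by positivity)).2 fun t => ?_
      simp [Prod.norm_def]
  let τ : C(Icc (0 : ℝ) 1, ULift.{u} ℝ × Z) := ⟨fun t => (⟨t⟩, 0), by fun_prop⟩
  let ev : C(Icc (0 : ℝ) 1, F) →L[ℝ] F := ContinuousMap.evalCLM ℝ ⟨1, by simp⟩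
  have h := (ev.comp (primitive F)).contDiff.comp ((contDiff_continuousMap_comp f₁ hf₁).comp
    (contDiff_const.add c.contDiff : ContDiff ℝ ∞ fun z => τ + c z))
  convert! h using 1
  ext z
  refine intervalIntegral.integral_congr fun t ht => ?_
  rw [uIcc_of_le zero_le_one] at ht
  simp [f₁, τ, c, projIcc_of_mem _ ht]

end ParametricIntegral

/-! ### The flow of a vector field with small Lipschitz constant -/

section Flow

universe u

variable {E : Type u} [NormedAddCommGroup E] [NormedSpace ℝ E] [CompleteSpace E]

/-- A smooth vector field with derivative bounded by `1/4` has a flow up to time one, which depends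
smoothly on the initial point. The derivatives of the flow solve the linearised equation. -/
lemma exists_smooth_flow {f : E → E} (hf : ContDiff ℝ ∞ f) (hf4 : ∀ x, ‖fderiv ℝ f x‖ ≤ 1 / 4) :
    ∃ Γ : E → C(Icc (0 : ℝ) 1, E), ContDiff ℝ ∞ Γ ∧
      (∀ x t, Γ x t = x + ∫ s in (0 : ℝ)..t, f (Γ x (projIcc 0 1 zero_le_one s))) ∧
      (∀ x w t, fderiv ℝ Γ x w t = w + ∫ s in (0 : ℝ)..t,
        fderiv ℝ f (Γ x (projIcc 0 1 zero_le_one s))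
          (fderiv ℝ Γ x w (projIcc 0 1 zero_le_one s))) ∧
      (∀ x, f x = 0 → ∀ t, Γ x t = x) := by
  let fc : C(E, E) := ⟨f, hf.continuous⟩
  let f' : C(E, E →L[ℝ] E) := ⟨fderiv ℝ f, hf.continuous_fderiv (by simp)⟩
  let N : C(Icc (0 : ℝ) 1, E) → C(Icc (0 : ℝ) 1, E) := fun γ => fc.comp γ
  have hN : ContDiff ℝ ∞ N := contDiff_continuousMap_comp fc hf
  -- A curve γ is the trajectory from x exactly when T γ is the constant curve x. The derivative of
  -- T is the identity minus an operator of norm at most 1/4, hence invertible by the Neumann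
  -- series.
  let T : C(Icc (0 : ℝ) 1, E) → C(Icc (0 : ℝ) 1, E) := fun γ => γ - primitive E (N γ)
  have hT : ContDiff ℝ ∞ T := contDiff_id.sub ((primitive E).contDiff.comp hN)
  let L : C(Icc (0 : ℝ) 1, E) → (C(Icc (0 : ℝ) 1, E) →L[ℝ] C(Icc (0 : ℝ) 1, E)) :=
    fun γ => (primitive E).comp (pointwiseApply (f'.comp γ))
  have hL : ∀ γ, HasFDerivAt (fun γ => primitive E (N γ)) (L γ) γ := fun γ =>
    (primitive E).hasFDerivAt.comp γ (hasFDerivAt_continuousMap_comp fc f'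
      (fun x => (hf.differentiable (by simp) x).hasFDerivAt) γ)
  have hLn : ∀ γ u, ‖L γ u‖ ≤ 1 / 4 * ‖u‖ := fun γ u => by
    refine (norm_primitive_le _).trans ((ContinuousMap.norm_le _ (by positivity)).2 fun t => ?_)
    exact (fderiv ℝ f (γ t)).le_of_opNorm_le_of_le (hf4 _) (u.norm_coe_le_norm t)
  have hLn' : ∀ γ, ‖L γ‖ ≤ 1 / 4 := fun γ =>
    ContinuousLinearMap.opNorm_le_bound _ (by norm_num) (hLn γ)
  have hTL : ∀ γ, HasFDerivAt T (ContinuousLinearMap.id ℝ _ - L γ) γ := fun γ =>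
    (hasFDerivAt_id γ).sub (hL γ)
  let e : C(Icc (0 : ℝ) 1, E) → (C(Icc (0 : ℝ) 1, E) ≃L[ℝ] C(Icc (0 : ℝ) 1, E)) := fun γ =>
    ContinuousLinearEquiv.ofUnit (Units.oneSub (L γ) ((hLn' γ).trans_lt (by norm_num)))
  have hTe : ∀ γ, HasFDerivAt T (e γ : C(Icc (0 : ℝ) 1, E) →L[ℝ] C(Icc (0 : ℝ) 1, E)) γ := hTL
  -- T differs from the identity by a 1/4-Lipschitz map on the whole space, so it is a global
  -- homeomorphism; its inverse on constant curves is the flow.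
  have happ : ApproximatesLinearOn T
      (ContinuousLinearEquiv.refl ℝ C(Icc (0 : ℝ) 1, E) :
        C(Icc (0 : ℝ) 1, E) →L[ℝ] C(Icc (0 : ℝ) 1, E)) univ (1 / 4) := by
    intro γ _ δ _
    have := Convex.norm_image_sub_le_of_norm_hasFDerivWithin_le (𝕜 := ℝ)
      (fun x _ => (hL x).hasFDerivWithinAt) (fun x _ => hLn' x) convex_univ
      (mem_univ δ) (mem_univ γ)
    refine le_trans (le_of_eq ?_) this
    rw [← norm_neg]
    congr 1
    simp only [T, ContinuousLinearEquiv.coe_refl, ContinuousLinearMap.id_apply]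
    abel
  have hc : Subsingleton C(Icc (0 : ℝ) 1, E) ∨ (1 / 4 : NNReal) <
      ‖((ContinuousLinearEquiv.refl ℝ C(Icc (0 : ℝ) 1, E)).symm :
        C(Icc (0 : ℝ) 1, E) →L[ℝ] C(Icc (0 : ℝ) 1, E))‖₊⁻¹ := by
    rcases subsingleton_or_nontrivial C(Icc (0 : ℝ) 1, E) with h | h
    · exact Or.inl h
    · right
      have : ‖((ContinuousLinearEquiv.refl ℝ C(Icc (0 : ℝ) 1, E)).symm :
        C(Icc (0 : ℝ) 1, E) →L[ℝ] C(Icc (0 : ℝ) 1, E))‖₊ = 1 :=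
        ContinuousLinearMap.nnnorm_id
      rw [this, inv_one, ← NNReal.coe_lt_coe]
      norm_num
  let H := happ.toHomeomorph T hc
  have hH : ∀ γ, H γ = T γ := fun _ => rfl
  have hHs : ContDiff ℝ ∞ H.symm := H.contDiff_symm hTe hT
  let c : E →L[ℝ] C(Icc (0 : ℝ) 1, E) := ContinuousLinearMap.const ℝ (Icc (0 : ℝ) 1)
  have hc' : ∀ x t, c x t = x := fun _ _ => rfl
  have hΓ : ContDiff ℝ ∞ fun x => H.symm (c x) := hHs.comp c.contDiff
  have hTΓ : ∀ x, T (H.symm (c x)) = c x := fun x => H.apply_symm_apply (c x)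
  refine ⟨fun x => H.symm (c x), hΓ, fun x t => ?_, fun x w t => ?_, fun x hx t => ?_⟩
  · have := DFunLike.congr_fun (hTΓ x) t
    rw [hc'] at this
    exact eq_add_of_sub_eq this
  · have h1 : HasFDerivAt (fun x => T (H.symm (c x)))
        ((ContinuousLinearMap.id ℝ _ - L (H.symm (c x))).comp
          (fderiv ℝ (fun x => H.symm (c x)) x)) x :=
      (hTL _).comp x (hΓ.differentiable (by simp) x).hasFDerivAt
    have h2 : HasFDerivAt (fun x => T (H.symm (c x))) c x := by
      simpa only [hTΓ] using c.hasFDerivAt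
    have h3 := DFunLike.congr_fun (DFunLike.congr_fun (h1.unique h2) w) t
    exact eq_add_of_sub_eq (h3.trans (hc' w t))
  · have : H.symm (c x) = c x := by
      rw [Homeomorph.symm_apply_eq, hH]
      ext t
      simp [T, primitive_apply, N, fc, hc', hx]
    exact (DFunLike.congr_fun this t).trans (hc' x t)

end Flow

end SplitSystem

end

open scoped Manifold ContDiff Topology

noncomputable section

namespace SplitSystem

open Set Filter

/-! ### Smooth germs -/

section Germs

variable {E F : Type*} [NormedAddCommGroup E] [NormedSpace ℝ E]
  [NormedAddCommGroup F] [NormedSpace ℝ F]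

/-- `f` is smooth on a neighbourhood of `z₀`. -/
def SmoothNear (f : E → F) (z₀ : E) : Prop := ∀ᶠ z in 𝓝 z₀, ContDiffAt ℝ ∞ f z

lemma SmoothNear.contDiffAt {f : E → F} {z₀ : E} (hf : SmoothNear f z₀) : ContDiffAt ℝ ∞ f z₀ :=
  hf.self_of_nhds

lemma SmoothNear.differentiableAt {f : E → F} {z₀ : E} (hf : SmoothNear f z₀) :
    ∀ᶠ z in 𝓝 z₀, DifferentiableAt ℝ f z :=
  hf.mono fun _ h => h.differentiableAt (by simp)

lemma SmoothNear.eventually {f : E → F} {z₀ : E} (hf : SmoothNear f z₀) :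
    ∀ᶠ z in 𝓝 z₀, SmoothNear f z :=
  eventually_eventually_nhds.2 hf

lemma SmoothNear.fderiv {f : E → F} {z₀ : E} (hf : SmoothNear f z₀) :
    SmoothNear (fderiv ℝ f) z₀ :=
  hf.mono fun _ h => h.fderiv_right (by simp)

lemma SmoothNear.comp {G : Type*} [NormedAddCommGroup G] [NormedSpace ℝ G] {f : E → F} {g : F → G}
    {z₀ : E} (hg : SmoothNear g (f z₀)) (hf : SmoothNear f z₀) :
    SmoothNear (fun z => g (f z)) z₀ := by
  filter_upwards [hf, hf.contDiffAt.continuousAt.eventually hg] with z h₁ h₂ using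
    ContDiffAt.comp z h₂ h₁

lemma fderiv_fderiv_symm {f : E → F} {z : E} (hf : ContDiffAt ℝ ∞ f z) (u w : E) :
    fderiv ℝ (fderiv ℝ f) z u w = fderiv ℝ (fderiv ℝ f) z w u :=
  hf.isSymmSndFDerivAt (by
    rw [minSmoothness_of_isRCLikeNormedField]
    exact WithTop.coe_le_coe.2 (le_top : (2 : ℕ∞) ≤ ⊤)) u w

/-- Multiplication by a bump function makes the germ global; compact support bounds the derivative,
and this bound is what the construction of the flow needs. -/
lemma exists_contDiff_eventuallyEq [FiniteDimensional ℝ E] {f : E → F} {z₀ : E}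
    (hf : SmoothNear f z₀) :
    ∃ g : E → F, ContDiff ℝ ∞ g ∧ g =ᶠ[𝓝 z₀] f ∧ ∃ C, ∀ x, ‖fderiv ℝ g x‖ ≤ C := by
  obtain ⟨ε, hε, hfε⟩ := Metric.eventually_nhds_iff_ball.1 hf
  let χ : ContDiffBump z₀ := ⟨ε / 3, ε / 2, by positivity, by linarith⟩
  have hg : ContDiff ℝ ∞ fun x => χ x • f x := by
    refine contDiff_iff_contDiffAt.2 fun x => ?_
    by_cases hx : x ∈ Metric.ball z₀ ε
    · exact χ.contDiffAt.smul (hfε x hx)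
    · have : x ∉ tsupport χ := by
        rw [χ.tsupport_eq]
        intro h
        refine hx (Metric.closedBall_subset_ball ?_ h)
        simp only [χ]
        linarith
      refine ContDiffAt.congr_of_eventuallyEq (f := fun _ => 0) contDiffAt_const ?_
      filter_upwards [(isClosed_tsupport χ).isOpen_compl.mem_nhds this] with y hy
      rw [image_eq_zero_of_notMem_tsupport hy, zero_smul]
  refine ⟨_, hg, ?_, ?_⟩
  · filter_upwards [χ.eventuallyEq_one] with y hy
    rw [hy, Pi.one_apply, one_smul]
  · have hc : HasCompactSupport fun x => χ x • f x := χ.hasCompactSupport.smul_right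
    exact (hc.fderiv ℝ).exists_bound_of_continuous (hg.continuous_fderiv (by simp))

/-- In finite dimension a curve of operators is differentiable if it is so pointwise. -/
lemma hasDerivWithinAt_clm_of_apply [FiniteDimensional ℝ E] {A : ℝ → E →L[ℝ] F}
    {A' : E →L[ℝ] F} {s : Set ℝ} {t : ℝ}
    (h : ∀ w, HasDerivWithinAt (fun τ => A τ w) (A' w) s t) : HasDerivWithinAt A A' s t := by
  let b := Module.finBasis ℝ E
  let c := fun i => LinearMap.toContinuousLinearMap (b.coord i)
  have hA : ∀ B : E →L[ℝ] F, B = ∑ i, (c i).smulRight (B (b i)) := fun B => by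
    ext w
    have h := congrArg B (b.sum_repr w)
    simp only [map_sum, map_smul] at h
    rw [← h]
    simp [c]
  rw [funext fun τ => hA (A τ), hA A']
  refine HasDerivWithinAt.fun_sum fun i _ => ?_
  exact ((ContinuousLinearMap.smulRightL ℝ E F (c i)).hasFDerivAt).comp_hasDerivWithinAt t (h (b i))

end Germs

/-! ### Germs of Poisson structures on vector spaces -/

section PoissonGerm

variable {E : Type*} [NormedAddCommGroup E] [NormedSpace ℝ E]

/-- `P` is a smooth Poisson bivector field near the point `z₀` of a vector space. -/
structure IsPoissonGerm (P : E → (E →L[ℝ] ℝ) →L[ℝ] E) (z₀ : E) : Prop where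
  smooth : SmoothNear P z₀
  skew : ∀ᶠ z in 𝓝 z₀, ∀ α β : E →L[ℝ] ℝ, β (P z α) = -α (P z β)
  jacobi : ∀ᶠ z in 𝓝 z₀, ∀ α β γ : E →L[ℝ] ℝ, γ (fderiv ℝ P z (P z α) β)
    + α (fderiv ℝ P z (P z β) γ) + β (fderiv ℝ P z (P z γ) α) = 0

variable {P : E → (E →L[ℝ] ℝ) →L[ℝ] E} {z₀ : E}

lemma IsPoissonGerm.eventually (hP : IsPoissonGerm P z₀) : ∀ᶠ z in 𝓝 z₀, IsPoissonGerm P z := by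
  filter_upwards [hP.smooth.eventually, hP.skew.eventually_nhds, hP.jacobi.eventually_nhds]
    with z h₁ h₂ h₃ using ⟨h₁, h₂, h₃⟩

lemma IsPoissonGerm.skew_fderiv (hP : IsPoissonGerm P z₀) (u : E) (α β : E →L[ℝ] ℝ) :
    β (fderiv ℝ P z₀ u α) = -α (fderiv ℝ P z₀ u β) := by
  have hd := (hP.smooth.contDiffAt.differentiableAt (by simp)).hasFDerivAt
  have h : ∀ α β : E →L[ℝ] ℝ, HasFDerivAt (fun z => β (P z α))
      (β.comp ((fderiv ℝ P z₀).flip α)) z₀ := fun α β => by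
    have := β.hasFDerivAt.comp z₀ (hd.clm_apply (hasFDerivAt_const α z₀))
    convert! this using 1
    simp
  have h₁ := (h α β).congr_of_eventuallyEq (f₁ := fun z => -α (P z β))
    (hP.skew.mono fun z hz => (hz α β).symm)
  have := DFunLike.congr_fun (h₁.unique (h β α).neg) u
  simpa using this

lemma hasFDerivAt_hamiltonian {G : E → ℝ} (hP : DifferentiableAt ℝ P z₀)
    (hG : ContDiffAt ℝ ∞ G z₀) :
    HasFDerivAt (fun z => P z (fderiv ℝ G z))
      ((P z₀).comp (fderiv ℝ (fderiv ℝ G) z₀) + (fderiv ℝ P z₀).flip (fderiv ℝ G z₀)) z₀ :=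
  hP.hasFDerivAt.clm_apply
    ((hG.fderiv_right (m := ∞) (by simp)).differentiableAt (by simp)).hasFDerivAt

/-- Hamiltonian vector fields are infinitesimal automorphisms of the Poisson structure. -/
lemma IsPoissonGerm.lieDerivative_hamiltonian (hP : IsPoissonGerm P z₀) {G : E → ℝ}
    (hG : ContDiffAt ℝ ∞ G z₀) (β : E →L[ℝ] ℝ) :
    fderiv ℝ P z₀ (P z₀ (fderiv ℝ G z₀)) β
      = fderiv ℝ (fun z => P z (fderiv ℝ G z)) z₀ (P z₀ β)
        + P z₀ (β.comp (fderiv ℝ (fun z => P z (fderiv ℝ G z)) z₀)) := by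
  rw [(hasFDerivAt_hamiltonian (hP.smooth.contDiffAt.differentiableAt (by simp)) hG).fderiv]
  -- Paired with γ, the identity is Jacobi for (dG, β, γ): the two terms with the Hessian of G
  -- cancel by its symmetry and the skewness of P, and the remaining terms are matched by skewness
  -- of P and of its derivative.
  refine (SeparatingDual.eq_iff_forall_dual_eq (R := ℝ)).2 fun γ => ?_
  have hs := hP.skew.self_of_nhds
  have hj := hP.jacobi.self_of_nhds (fderiv ℝ G z₀) β γ
  have hsymm := fderiv_fderiv_symm hG (P z₀ β) (P z₀ γ)
  have h₁ := hs (fderiv ℝ (fderiv ℝ G) z₀ (P z₀ β)) γ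
  have h₂ := hs (fderiv ℝ (fderiv ℝ G) z₀ (P z₀ γ)) β
  have h₃ := hs (β.comp ((P z₀).comp (fderiv ℝ (fderiv ℝ G) z₀)
    + (fderiv ℝ P z₀).flip (fderiv ℝ G z₀))) γ
  have h₄ := hP.skew_fderiv (P z₀ β) (fderiv ℝ G z₀) γ
  simp only [add_apply, ContinuousLinearMap.comp_apply,
    ContinuousLinearMap.flip_apply, map_add] at h₃ ⊢
  linarith

/-- The Hamiltonian vector fields of functions in involution commute. -/
lemma IsPoissonGerm.hamiltonian_commute (hP : IsPoissonGerm P z₀) {F G : E → ℝ}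
    (hF : ContDiffAt ℝ ∞ F z₀) (hG : ContDiffAt ℝ ∞ G z₀)
    (h : ∀ᶠ z in 𝓝 z₀, fderiv ℝ G z (P z (fderiv ℝ F z)) = 0) :
    fderiv ℝ (fun z => P z (fderiv ℝ G z)) z₀ (P z₀ (fderiv ℝ F z₀))
      = fderiv ℝ (fun z => P z (fderiv ℝ F z)) z₀ (P z₀ (fderiv ℝ G z₀)) := by
  have hd := hP.smooth.contDiffAt.differentiableAt (n := ∞) (by simp)
  have h₁ := hP.lieDerivative_hamiltonian hF (fderiv ℝ G z₀)
  have hXF := hasFDerivAt_hamiltonian hd hF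
  have h₂ := ((hG.fderiv_right (m := ∞) (by simp)).differentiableAt (by simp)).hasFDerivAt.clm_apply
    hXF.differentiableAt.hasFDerivAt
  have h₃ := h₂.unique ((hasFDerivAt_const (0 : ℝ) z₀).congr_of_eventuallyEq h)
  -- This is the differential of the identity {F, G} = 0 near z₀, with the Hessian of G transposed.
  have h₄ : (fderiv ℝ G z₀).comp (fderiv ℝ (fun z => P z (fderiv ℝ F z)) z₀)
      = -fderiv ℝ (fderiv ℝ G) z₀ (P z₀ (fderiv ℝ F z₀)) := by
    rw [eq_neg_iff_add_eq_zero, ← h₃]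
    congr 1
    ext u
    exact fderiv_fderiv_symm hG _ _
  rw [h₄, map_neg] at h₁
  rw [(hasFDerivAt_hamiltonian hd hG).fderiv]
  simp only [add_apply, ContinuousLinearMap.comp_apply,
    ContinuousLinearMap.flip_apply, h₁]
  abel

end PoissonGerm

end SplitSystem

end

open scoped Manifold ContDiff Topology

noncomputable section

namespace SplitSystem

open Set Filter

/-! ### The flow of a Hamiltonian vector field near an equilibrium -/

section FlowGerm

universe u

variable {E : Type u} [NormedAddCommGroup E] [NormedSpace ℝ E]

/-- `Θ` is, near the equilibrium `z₀` of `X`, a Poisson diffeomorphism behaving like the flow of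
`X` at time `c`: functions `u` whose derivative `e` along `X` is constant along `X` evolve as
`u + c e`. -/
structure IsPoissonFlowGerm (P : E → (E →L[ℝ] ℝ) →L[ℝ] E) (X : E → E) (z₀ : E) (c : ℝ)
    (Θ : E → E) : Prop where
  smooth : SmoothNear Θ z₀
  fix : Θ z₀ = z₀
  injective : Function.Injective (fderiv ℝ Θ z₀)
  poisson : ∀ᶠ z in 𝓝 z₀, ∀ β : E →L[ℝ] ℝ,
    fderiv ℝ Θ z (P z (β.comp (fderiv ℝ Θ z))) = P (Θ z) β
  evolve : ∀ {W : Type} [NormedAddCommGroup W] [NormedSpace ℝ W] (u e : E → W),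
    (∀ᶠ z in 𝓝 z₀, DifferentiableAt ℝ u z) → (∀ᶠ z in 𝓝 z₀, DifferentiableAt ℝ e z) →
    (∀ᶠ z in 𝓝 z₀, fderiv ℝ u z (X z) = e z) → (∀ᶠ z in 𝓝 z₀, fderiv ℝ e z (X z) = 0) →
    ∀ᶠ z in 𝓝 z₀, u (Θ z) = u z + c • e z

variable {P : E → (E →L[ℝ] ℝ) →L[ℝ] E} {X : E → E} {z₀ : E}

lemma IsPoissonFlowGerm.tendsto {c : ℝ} {Θ : E → E} (h : IsPoissonFlowGerm P X z₀ c Θ) :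
    Tendsto Θ (𝓝 z₀) (𝓝 z₀) := by
  simpa [ContinuousAt, h.fix] using h.smooth.contDiffAt.continuousAt

lemma IsPoissonFlowGerm.id : IsPoissonFlowGerm P X z₀ 0 id where
  smooth := .of_forall fun _ => contDiffAt_id
  fix := rfl
  injective := by simpa using Function.injective_id
  poisson := .of_forall fun z β => by simp
  evolve u e _ _ _ _ := .of_forall fun z => by simp

lemma IsPoissonFlowGerm.comp {c c' : ℝ} {Θ Θ' : E → E} (h : IsPoissonFlowGerm P X z₀ c Θ)
    (h' : IsPoissonFlowGerm P X z₀ c' Θ') : IsPoissonFlowGerm P X z₀ (c + c') (Θ ∘ Θ') := by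
  have hd : ∀ᶠ z in 𝓝 z₀, fderiv ℝ (Θ ∘ Θ') z = (fderiv ℝ Θ (Θ' z)).comp (fderiv ℝ Θ' z) := by
    filter_upwards [h'.smooth.differentiableAt, h'.tendsto h.smooth.differentiableAt] with z h₁ h₂
      using fderiv_comp z h₂ h₁
  refine ⟨?_, by simp [h.fix, h'.fix], ?_, ?_, fun u e hu he hue heX => ?_⟩
  · exact SmoothNear.comp (g := Θ) (f := Θ') (by rw [h'.fix]; exact h.smooth) h'.smooth
  · rw [hd.self_of_nhds, h'.fix]
    exact h.injective.comp h'.injective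
  · filter_upwards [hd, h'.poisson, h'.tendsto h.poisson] with z h₁ h₂ h₃ β
    rw [h₁, Function.comp_apply, ← h₃, ← h₂]
    rfl
  · filter_upwards [h'.evolve u e hu he hue heX, h'.tendsto (h.evolve u e hu he hue heX),
      -- Applied to the pair (e, 0), the evolution law says that e is itself invariant under Θ';
      -- this makes the times add up.
      h'.evolve e 0 he (.of_forall fun _ => differentiableAt_const _) heX
        (.of_forall fun _ => by simp)] with z h₁ h₂ h₃
    simp only [Function.comp_apply, Pi.zero_apply, smul_zero, add_zero, add_smul] at *
    rw [h₂, h₁, h₃]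
    abel

lemma IsPoissonFlowGerm.iterate {c : ℝ} {Θ : E → E} (h : IsPoissonFlowGerm P X z₀ c Θ) (N : ℕ) :
    IsPoissonFlowGerm P X z₀ (N * c) Θ^[N] := by
  induction N with
  | zero => simpa using IsPoissonFlowGerm.id
  | succ N ih =>
    rw [Function.iterate_succ]
    convert ih.comp h using 1
    push_cast
    ring

/-- Along curves of derivatives of a flow, the bivector field pulls back to itself. -/
lemma bivector_transport [FiniteDimensional ℝ E] {γ : ℝ → E} {A : ℝ → E →L[ℝ] E} {f : E → E}
    {P₀ : (E →L[ℝ] ℝ) →L[ℝ] E} {C : ℝ} (hC : ∀ x, ‖fderiv ℝ f x‖ ≤ C)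
    (hγ : ∀ t ∈ Icc (0 : ℝ) 1, HasDerivWithinAt γ (f (γ t)) (Icc 0 1) t)
    (hA : ∀ t ∈ Icc (0 : ℝ) 1, HasDerivWithinAt A ((fderiv ℝ f (γ t)).comp (A t)) (Icc 0 1) t)
    (hP : ∀ t ∈ Icc (0 : ℝ) 1, DifferentiableAt ℝ P (γ t))
    (hlie : ∀ t ∈ Icc (0 : ℝ) 1, ∀ β : E →L[ℝ] ℝ, fderiv ℝ P (γ t) (f (γ t)) β
      = fderiv ℝ f (γ t) (P (γ t) β) + P (γ t) (β.comp (fderiv ℝ f (γ t))))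
    (hA0 : A 0 = ContinuousLinearMap.id ℝ E) (hP0 : P (γ 0) = P₀) (β : E →L[ℝ] ℝ) :
    A 1 (P₀ (β.comp (A 1))) = P (γ 1) β := by
  let ad : (E →L[ℝ] E) →L[ℝ] (E →L[ℝ] ℝ) →L[ℝ] (E →L[ℝ] ℝ) :=
    (ContinuousLinearMap.compL ℝ E E ℝ).flip
  have had : ∀ (B : E →L[ℝ] E) (β : E →L[ℝ] ℝ), ad B β = β.comp B := fun _ _ => rfl
  have hadn : ∀ (B : E →L[ℝ] E) (β : E →L[ℝ] ℝ), ‖ad B β‖ ≤ ‖B‖ * ‖β‖ := fun B β => by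
    rw [had, mul_comm]
    exact ContinuousLinearMap.opNorm_comp_le _ _
  -- R is the defect of invariance. It vanishes at time 0 and solves the homogeneous linear equation
  -- R' = Df ∘ R + R ∘ Df*, so Grönwall's inequality with constant 2C forces R = 0.
  let R : ℝ → (E →L[ℝ] ℝ) →L[ℝ] E := fun t => P (γ t) - (A t).comp (P₀.comp (ad (A t)))
  let R' : ℝ → (E →L[ℝ] ℝ) →L[ℝ] E := fun t =>
    (fderiv ℝ f (γ t)).comp (R t) + (R t).comp (ad (fderiv ℝ f (γ t)))
  have hR : ∀ t ∈ Icc (0 : ℝ) 1, HasDerivWithinAt R (R' t) (Icc 0 1) t := fun t ht => by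
    have h₁ : HasDerivWithinAt (fun t => P (γ t)) (fderiv ℝ P (γ t) (f (γ t))) (Icc 0 1) t :=
      HasFDerivAt.comp_hasDerivWithinAt (E := (E →L[ℝ] ℝ) →L[ℝ] E) t (hP t ht).hasFDerivAt (hγ t ht)
    have h₂ := HasFDerivAt.comp_hasDerivWithinAt (E := (E →L[ℝ] ℝ) →L[ℝ] (E →L[ℝ] ℝ)) (l := ad)
      (l' := ad) t (ContinuousLinearMap.hasFDerivAt _) (hA t ht)
    have h₃ := (hA t ht).clm_comp ((hasDerivWithinAt_const t _ P₀).clm_comp h₂)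
    convert! h₁.sub h₃ using 1
    refine ContinuousLinearMap.ext fun β => ?_
    simp only [R', R, add_apply, sub_apply, ContinuousLinearMap.comp_apply, hlie t ht, had,
      map_sub, ContinuousLinearMap.zero_comp, zero_add, Function.comp_apply,
      ContinuousLinearMap.comp_assoc]
    abel
  have hz := eq_zero_of_abs_deriv_le_mul_abs_self_of_eq_zero_right (f := R) (f' := R')
    (K := 2 * C) (a := 0) (b := 1) (fun t ht => (hR t ht).continuousWithinAt)
    (fun t ht => (hR t ⟨ht.1, ht.2.le⟩).mono_of_mem_nhdsWithin
      (Icc_mem_nhdsGE_of_mem ht))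
    (by
      refine ContinuousLinearMap.ext fun β => ?_
      simp [R, hA0, hP0, had]) (fun t ht => by
      refine ContinuousLinearMap.opNorm_le_bound _ (by
        have := (norm_nonneg _).trans (hC 0); positivity) fun β => ?_
      refine (norm_add_le _ _).trans ?_
      have h₁ : ‖fderiv ℝ f (γ t) (R t β)‖ ≤ C * (‖R t‖ * ‖β‖) :=
        (fderiv ℝ f (γ t)).le_of_opNorm_le_of_le (hC _) ((R t).le_opNorm β)
      have h₂ : ‖R t (ad (fderiv ℝ f (γ t)) β)‖ ≤ ‖R t‖ * (C * ‖β‖) :=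
        (R t).le_opNorm_of_le ((hadn _ _).trans (by gcongr; exact hC _))
      refine (add_le_add h₁ h₂).trans (le_of_eq (by ring))) 1 (by simp)
  have := DFunLike.congr_fun hz β
  simp only [R, sub_apply, ContinuousLinearMap.comp_apply, had, zero_apply] at this
  exact (sub_eq_zero.1 this).symm

/-- Existence of the flow for a short time `1 / N`. -/
lemma exists_poissonFlowGerm_short [FiniteDimensional ℝ E] (hP : IsPoissonGerm P z₀) {G : E → ℝ}
    (hG : SmoothNear G z₀) (h0 : P z₀ (fderiv ℝ G z₀) = 0) :
    ∃ (N : ℕ) (Θ : E → E), 0 < N ∧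
      IsPoissonFlowGerm P (fun z => P z (fderiv ℝ G z)) z₀ (1 / N) Θ := by
  have : CompleteSpace E := FiniteDimensional.complete ℝ E
  let X : E → E := fun z => P z (fderiv ℝ G z)
  have hX : SmoothNear X z₀ := by
    filter_upwards [hP.smooth, hG.fderiv] with z h₁ h₂ using h₁.clm_apply h₂
  obtain ⟨Y, hY, hYX, C, hC⟩ := exists_contDiff_eventuallyEq hX
  -- Scaling the field by c = 1/(N+1) brings its derivative below 1/4. The flow of c • Y up to time
  -- one agrees near z₀ with the flow of X up to time c.
  obtain ⟨N, hN⟩ := exists_nat_ge (4 * C)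
  set c : ℝ := 1 / ((N + 1 : ℕ) : ℝ) with hc
  have hc0 : 0 < c := by positivity
  let f : E → E := fun z => c • Y z
  have hf : ContDiff ℝ ∞ f := hY.const_smul c
  have hf' : ∀ z, fderiv ℝ f z = c • fderiv ℝ Y z := fun z =>
    fderiv_const_smul (hY.differentiable (by simp) z) c
  have hf4 : ∀ z, ‖fderiv ℝ f z‖ ≤ 1 / 4 := fun z => by
    rw [hf', norm_smul, Real.norm_of_nonneg hc0.le, hc, one_div, inv_mul_le_iff₀ (by positivity)]
    push_cast
    linarith [hC z]
  obtain ⟨Γ, hΓ, hΓi, hΓl, hΓ0⟩ := exists_smooth_flow hf hf4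
  have hfz₀ : f z₀ = 0 := by
    have : Y z₀ = P z₀ (fderiv ℝ G z₀) := hYX.self_of_nhds
    simp only [f, this, h0, smul_zero]
  let one : Icc (0 : ℝ) 1 := ⟨1, by simp⟩
  let ev : Icc (0 : ℝ) 1 → C(Icc (0 : ℝ) 1, E) →L[ℝ] E := fun t => ContinuousMap.evalCLM ℝ t
  let Θ : E → E := fun z => Γ z one
  have hΘ : ContDiff ℝ ∞ Θ := (ev one).contDiff.comp hΓ
  have hΓd : ∀ z, HasFDerivAt Γ (fderiv ℝ Γ z) z := fun z =>
    (hΓ.differentiable (by simp) z).hasFDerivAt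
  have hΘ' : ∀ z, fderiv ℝ Θ z = (ev one).comp (fderiv ℝ Γ z) := fun z =>
    ((ev one).hasFDerivAt.comp z (hΓd z)).fderiv
  let γ : E → ℝ → E := fun z s => Γ z (projIcc 0 1 zero_le_one s)
  have hγ0 : ∀ z, γ z 0 = z := fun z => by
    refine (hΓi z _).trans ?_
    simp
  have hγ1 : ∀ z, γ z 1 = Θ z := fun z => by simp [γ, Θ, one]
  have hγ : ∀ z, ∀ t ∈ Icc (0 : ℝ) 1, HasDerivWithinAt (γ z) (f (γ z t)) (Icc 0 1) t :=
    fun z t ht => by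
      let fγ : C(Icc (0 : ℝ) 1, E) := ⟨fun s => f (Γ z s), hf.continuous.comp (Γ z).continuous⟩
      have h := (hasDerivWithinAt_primitive fγ ht).const_add z
      have e : γ z = fun s => z + primitive E fγ (projIcc 0 1 zero_le_one s) := by
        ext s
        exact hΓi z _
      rw [e]
      convert h using 1
      rw [← e]
      simp [fγ, γ, projIcc_of_mem _ ht]
  -- The trajectory of the equilibrium is constant and Γ is continuous for the uniform norm, so
  -- whole trajectories of nearby points stay where a germ condition holds.
  have hnear : ∀ {p : E → Prop}, (∀ᶠ z in 𝓝 z₀, p z) → ∀ᶠ z in 𝓝 z₀, ∀ t, p (γ z t) := by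
    intro p hp
    obtain ⟨δ, hδ, hpδ⟩ := Metric.eventually_nhds_iff_ball.1 hp
    have hcont : Tendsto Γ (𝓝 z₀) (𝓝 (Γ z₀)) := hΓ.continuous.continuousAt
    filter_upwards [hcont (Metric.ball_mem_nhds _ hδ)] with z hz t
    refine hpδ _ ?_
    rw [Metric.mem_ball, ← hΓ0 z₀ hfz₀ (projIcc 0 1 zero_le_one t)]
    exact (ContinuousMap.dist_apply_le_dist _).trans_lt hz
  refine ⟨N + 1, Θ, by positivity, .of_forall fun z => hΘ.contDiffAt, hΓ0 z₀ hfz₀ _, ?_, ?_, ?_⟩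
  -- If w is killed at time one, the linearised equation gives ‖U‖ ≤ ‖w‖ + ‖U‖/4 and, at time one,
  -- ‖w‖ ≤ ‖U‖/4; together these force w = 0.
  · rw [injective_iff_map_eq_zero]
    intro w hw
    rw [hΘ'] at hw
    set U := fderiv ℝ Γ z₀ w with hU
    have hint : ∀ t : Icc (0 : ℝ) 1, ‖∫ s in (0 : ℝ)..t,
        fderiv ℝ f (Γ z₀ (projIcc 0 1 zero_le_one s)) (U (projIcc 0 1 zero_le_one s))‖
          ≤ 1 / 4 * ‖U‖ := fun t => by
      refine (intervalIntegral.norm_integral_le_of_norm_le_const fun s _ =>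
        (fderiv ℝ f _).le_of_opNorm_le_of_le (hf4 _) (U.norm_coe_le_norm _)).trans ?_
      rw [sub_zero, abs_of_nonneg t.2.1]
      exact mul_le_of_le_one_right (by positivity) t.2.2
    have h₁ : ‖U‖ ≤ ‖w‖ + 1 / 4 * ‖U‖ := by
      refine (ContinuousMap.norm_le _ (by positivity)).2 fun t => ?_
      rw [hU, hΓl]
      exact (norm_add_le _ _).trans (by gcongr; exact hint t)
    have h₂ : ‖w‖ ≤ 1 / 4 * ‖U‖ := by
      have h := hΓl z₀ w one
      have h' : U one = 0 := hw
      rw [← hU, h'] at h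
      rw [eq_neg_of_add_eq_zero_left h.symm, norm_neg]
      exact hint one
    exact norm_le_zero_iff.1 (by linarith [norm_nonneg w])
  · have hlie : ∀ᶠ z in 𝓝 z₀, ∀ β : E →L[ℝ] ℝ, fderiv ℝ P z (f z) β
        = fderiv ℝ f z (P z β) + P z (β.comp (fderiv ℝ f z)) := by
      filter_upwards [hP.eventually, hG, hYX.eventuallyEq_nhds] with z h₁ h₂ h₃ β
      have h := h₁.lieDerivative_hamiltonian h₂ β
      rw [hf', h₃.fderiv_eq]
      simp only [f, h₃.eq_of_nhds, map_smul, smul_apply, X, h, smul_add,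
        ContinuousLinearMap.comp_smul]
    filter_upwards [hnear hlie, hnear hP.smooth.differentiableAt] with z h₁ h₂ β
    let A : ℝ → E →L[ℝ] E := fun t => (ev (projIcc 0 1 zero_le_one t)).comp (fderiv ℝ Γ z)
    have hA1 : A 1 = fderiv ℝ Θ z := by simp [A, hΘ', one]
    rw [← hA1, ← hγ1]
    refine bivector_transport hf4 (hγ z) (fun t ht => ?_) (fun t _ => h₂ t) (fun t _ => h₁ t)
      ?_ (by rw [hγ0]) β
    · refine hasDerivWithinAt_clm_of_apply fun w => ?_
      let g : C(Icc (0 : ℝ) 1, E) := ⟨fun s => fderiv ℝ f (Γ z s) (fderiv ℝ Γ z w s),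
        ((hf.continuous_fderiv (by simp)).comp (Γ z).continuous).clm_apply
          (fderiv ℝ Γ z w).continuous⟩
      have h := (hasDerivWithinAt_primitive g ht).const_add w
      have e : (fun s => A s w) = fun s => w + primitive E g (projIcc 0 1 zero_le_one s) := by
        ext s
        exact hΓl z w _
      rw [e]
      convert h using 1
      simp [g, A, γ, projIcc_of_mem _ ht, ev]
    · ext w
      simp only [A, ContinuousLinearMap.comp_apply, ContinuousLinearMap.id_apply]
      refine (hΓl z w _).trans ?_
      simp
  · intro W _ _ u e hu he hue heX
    filter_upwards [hnear hu, hnear he, hnear hue, hnear heX, hnear hYX] with z h₁ h₂ h₃ h₄ h₅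
    have hf5 : ∀ t, f (γ z t) = c • X (γ z t) := fun t => by simp only [f, h₅]
    have hconst : ∀ v : ℝ → W, (∀ t ∈ Icc (0 : ℝ) 1, HasDerivWithinAt v 0 (Icc 0 1) t) →
        ∀ t ∈ Icc (0 : ℝ) 1, v t = v 0 := fun v hv =>
      constant_of_derivWithin_zero (fun t ht => (hv t ht).differentiableWithinAt) fun t ht =>
        (hv t ⟨ht.1, ht.2.le⟩).derivWithin (uniqueDiffOn_Icc zero_lt_one t ⟨ht.1, ht.2.le⟩)
    have he' : ∀ t ∈ Icc (0 : ℝ) 1, e (γ z t) = e z := fun t ht => by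
      have := hconst (fun t => e (γ z t)) (fun t ht => by
        have h := (h₂ t).hasFDerivAt.comp_hasDerivWithinAt t (hγ z t ht)
        rw [hf5, map_smul] at h
        convert! h using 1
        rw [h₄ t, smul_zero]) t ht
      simpa [hγ0] using this
    -- Along a trajectory u has the constant derivative c • e z, since e is constant there;
    -- subtracting the linear growth leaves a constant function.
    have := hconst (fun t => u (γ z t) - t • c • e z) (fun t ht => by
      have h := (h₁ t).hasFDerivAt.comp_hasDerivWithinAt t (hγ z t ht)
      have h' := (hasDerivWithinAt_id t (Icc (0 : ℝ) 1)).smul_const (c • e z)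
      have h'' := h.sub h'
      rw [hf5, map_smul] at h''
      convert! h'' using 1
      rw [h₃ t, he' t ht, one_smul, sub_self]) 1 (by simp)
    simp only [hγ0, hγ1, one_smul, zero_smul, sub_zero] at this
    exact eq_add_of_sub_eq this

/-- The time-one flow of a Hamiltonian vector field near an equilibrium. -/
lemma exists_poissonFlowGerm [FiniteDimensional ℝ E] (hP : IsPoissonGerm P z₀) {G : E → ℝ}
    (hG : SmoothNear G z₀) (h0 : P z₀ (fderiv ℝ G z₀) = 0) :
    ∃ Θ : E → E, IsPoissonFlowGerm P (fun z => P z (fderiv ℝ G z)) z₀ 1 Θ := by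
  obtain ⟨N, Θ, hN, h⟩ := exists_poissonFlowGerm_short hP hG h0
  refine ⟨Θ^[N], ?_⟩
  have := h.iterate N
  rwa [mul_one_div_cancel (by positivity)] at this

end FlowGerm

end SplitSystem

end

open scoped Manifold ContDiff Topology

noncomputable section

namespace SplitSystem

open Set Filter

/-! ### The inverse function theorem for germs -/

section Inverse

variable {E F : Type*} [NormedAddCommGroup E] [NormedSpace ℝ E] [FiniteDimensional ℝ E]
  [NormedAddCommGroup F] [NormedSpace ℝ F]

/-- The source is shrunk to points where f is smooth and its derivative invertible, so that
smoothness of the inverse holds on the whole target and not only at the image of z₀. -/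
lemma exists_openPartialHomeomorph {f : E → F} {z₀ : E} (hf : SmoothNear f z₀)
    (hf' : Function.Bijective (fderiv ℝ f z₀)) :
    ∃ e : OpenPartialHomeomorph E F, z₀ ∈ e.source ∧ (e : E → F) = f ∧
      ContDiffOn ℝ ∞ e e.source ∧ ContDiffOn ℝ ∞ e.symm e.target := by
  have : CompleteSpace E := FiniteDimensional.complete ℝ E
  let L : E ≃L[ℝ] F := (LinearEquiv.ofBijective (fderiv ℝ f z₀).toLinearMap hf').toContinuousLinearEquiv
  have hL : HasFDerivAt f (L : E →L[ℝ] F) z₀ :=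
    (hf.contDiffAt.differentiableAt (by simp)).hasFDerivAt
  let e₀ := hf.contDiffAt.toOpenPartialHomeomorph f hL (by simp)
  have hinv : ∀ᶠ z in 𝓝 z₀, fderiv ℝ f z ∈ range ((↑) : (E ≃L[ℝ] F) → E →L[ℝ] F) := by
    have hc : ContinuousAt (fderiv ℝ f) z₀ := hf.fderiv.contDiffAt.continuousAt
    refine hc.eventually_mem ?_
    rw [hL.fderiv]
    exact ContinuousLinearEquiv.nhds L
  obtain ⟨s, hs, hso, hzs⟩ := eventually_nhds_iff.1 (hf.and hinv)
  let e := e₀.restrOpen s hso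
  have hes : e.source = e₀.source ∩ s := e₀.restrOpen_source s hso
  have hec : (e : E → F) = f := rfl
  refine ⟨e, ?_, hec, fun z hz => ?_, fun y hy => ?_⟩
  · rw [hes]
    exact ⟨hf.contDiffAt.mem_toOpenPartialHomeomorph_source hL (by simp), hzs⟩
  · rw [hes] at hz
    exact (hs z hz.2).1.contDiffWithinAt
  · have hz := e.map_target hy
    rw [hes] at hz
    obtain ⟨h₁, L', hL'⟩ := hs _ hz.2
    have h₂ : HasFDerivAt e (L' : E →L[ℝ] F) (e.symm y) := by
      rw [hL']
      exact (h₁.differentiableAt (by simp)).hasFDerivAt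
    exact (e.contDiffAt_symm hy h₂ h₁).contDiffWithinAt

end Inverse

/-! ### A relative Poincaré lemma -/

section Poincare

universe u

variable {K W V : Type u} [NormedAddCommGroup K] [NormedSpace ℝ K] [FiniteDimensional ℝ K]
  [NormedAddCommGroup W] [NormedSpace ℝ W] [FiniteDimensional ℝ W]
  [NormedAddCommGroup V] [NormedSpace ℝ V] [CompleteSpace V]

/-- A smooth family of closed one-forms on `K`, parametrised by `W`, has a smooth primitive. -/
lemma exists_relative_primitive {θ : K × W → K →L[ℝ] V} {z₀ : K × W} (hθ : SmoothNear θ z₀)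
    (hcl : ∀ᶠ z in 𝓝 z₀, ∀ u u' : K, fderiv ℝ θ z (u, 0) u' = fderiv ℝ θ z (u', 0) u) :
    ∃ Q : K × W → V, ContDiff ℝ ∞ Q ∧ Q z₀ = 0 ∧
      ∀ᶠ z in 𝓝 z₀, ∀ u, fderiv ℝ Q z (u, 0) = θ z u := by
  obtain ⟨η, hη, hηθ, -⟩ := exists_contDiff_eventuallyEq hθ
  -- Integration along segments in K issuing from the base point, with the parameter in W frozen.
  -- Joint smoothness is that of a parametric integral; the derivative along K comes from the
  -- Poincaré lemma for each fixed parameter.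
  let Q : K × W → V := fun z => ∫ t in (0 : ℝ)..1,
    η (AffineMap.lineMap z₀.1 z.1 t, z.2) (z.1 - z₀.1)
  have hQ : ContDiff ℝ ∞ Q := by
    refine contDiff_integral_zero_one
      (f := fun q : ℝ × (K × W) => η (AffineMap.lineMap z₀.1 q.2.1 q.1, q.2.2) (q.2.1 - z₀.1)) ?_
    have h : ContDiff ℝ ∞ fun q : ℝ × (K × W) => AffineMap.lineMap z₀.1 q.2.1 q.1 := by
      simp only [AffineMap.lineMap_apply_module']
      fun_prop
    exact (hη.comp (h.prodMk (by fun_prop))).clm_apply (by fun_prop)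
  refine ⟨Q, hQ, by simp [Q], ?_⟩
  obtain ⟨δ, hδ, hb⟩ := Metric.eventually_nhds_iff_ball.1 (hcl.and hηθ.eventuallyEq_nhds)
  filter_upwards [Metric.ball_mem_nhds z₀ hδ] with z hz u
  obtain ⟨k, w⟩ := z
  have hball : ∀ k', k' ∈ Metric.ball z₀.1 δ → (k', w) ∈ Metric.ball z₀ δ := fun k' hk' => by
    rw [← ball_prod_same] at hz ⊢
    exact ⟨hk', hz.2⟩
  have hk : k ∈ Metric.ball z₀.1 δ := by
    rw [← ball_prod_same] at hz
    exact hz.1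
  have h₁ : HasFDerivWithinAt
      (fun b => curveIntegral (fun k' => η (k', w)) (Path.segment z₀.1 b)) (η (k, w))
      (Metric.ball z₀.1 δ) k :=
    Convex.hasFDerivWithinAt_curveIntegral_segment_of_hasFDerivWithinAt_symmetric
    (dω := fun k' => (fderiv ℝ η (k', w)).comp (ContinuousLinearMap.inl ℝ K W))
    (convex_ball z₀.1 δ)
    (fun k' _ => (HasFDerivAt.comp k' (hη.differentiable (by simp) (k', w)).hasFDerivAt
      (hasFDerivAt_prodMk_left k' w)).hasFDerivWithinAt)
    (fun k' hk' u _ u' _ => by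
      have := (hb _ (hball k' hk')).1 u u'
      rw [← (hb _ (hball k' hk')).2.fderiv_eq] at this
      simpa using this)
    (Metric.mem_ball_self hδ) hk
  have h₂ := h₁.hasFDerivAt (Metric.isOpen_ball.mem_nhds hk)
  have h₃ : HasFDerivAt (fun k' => Q (k', w))
      ((fderiv ℝ Q (k, w)).comp (ContinuousLinearMap.inl ℝ K W)) k :=
    HasFDerivAt.comp (g := Q) (f := fun k' => (k', w)) k
      (hQ.differentiable (by simp) (k, w)).hasFDerivAt (hasFDerivAt_prodMk_left k w)
  have h₄ : (fun b => curveIntegral (fun k' => η (k', w)) (Path.segment z₀.1 b))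
      = fun k' => Q (k', w) := by
    ext k'
    rw [curveIntegral_segment]
  rw [h₄] at h₂
  have := DFunLike.congr_fun (h₃.unique h₂) u
  rw [(hb _ hz).2.eq_of_nhds] at this
  simpa using this

end Poincare

/-! ### Conjugate functions -/

section Conjugate

universe u

variable {E W : Type u} [NormedAddCommGroup E] [NormedSpace ℝ E] [FiniteDimensional ℝ E]
  [NormedAddCommGroup W] [NormedSpace ℝ W]
  {P : E → (E →L[ℝ] ℝ) →L[ℝ] E} {z₀ : E}

lemma finrank_dual (W : Type*) [NormedAddCommGroup W] [NormedSpace ℝ W] [FiniteDimensional ℝ W] :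
    Module.finrank ℝ (W →L[ℝ] ℝ) = Module.finrank ℝ W := by
  rw [← (LinearMap.toContinuousLinearMap (𝕜 := ℝ) (E := W) (F' := ℝ)).finrank_eq]
  exact Subspace.dual_finrank_eq

/-- A maximal family of independent functions in involution on a symplectic vector space has,
locally, conjugate functions. -/
lemma exists_conjugate (hP : IsPoissonGerm P z₀) (hP' : Function.Injective (P z₀)) {p : E → W}
    (hp : SmoothNear p z₀) (hp' : Function.Surjective (fderiv ℝ p z₀))
    (hdim : Module.finrank ℝ E = 2 * Module.finrank ℝ W)
    (hinv : ∀ᶠ x in 𝓝 z₀, ∀ l : W →L[ℝ] ℝ, fderiv ℝ p x (P x (l.comp (fderiv ℝ p x))) = 0) :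
    ∃ q : E → W →L[ℝ] ℝ, SmoothNear q z₀ ∧ q z₀ = 0 ∧
      ∀ᶠ x in 𝓝 z₀, ∀ l : W →L[ℝ] ℝ, fderiv ℝ q x (P x (l.comp (fderiv ℝ p x))) = l := by
  have : CompleteSpace E := FiniteDimensional.complete ℝ E
  have : FiniteDimensional ℝ W :=
    Module.Finite.of_surjective (fderiv ℝ p z₀).toLinearMap hp'
  let K : Submodule ℝ E := (fderiv ℝ p z₀).ker
  have : CompleteSpace K := FiniteDimensional.complete ℝ K
  have hdimK : Module.finrank ℝ K = Module.finrank ℝ W := by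
    have h := (fderiv ℝ p z₀).toLinearMap.finrank_range_add_finrank_ker
    rw [LinearMap.range_eq_top.2 hp', finrank_top, hdim] at h
    have h' : Module.finrank ℝ K = Module.finrank ℝ (fderiv ℝ p z₀).toLinearMap.ker := rfl
    omega
  obtain ⟨ℓ, hℓ⟩ := Submodule.ClosedComplemented.of_finiteDimensional (𝕜 := ℝ) K
  -- X · l is the Hamiltonian field of l ∘ p. By involution these fields are tangent to the fibres
  -- of p.
  let X : E → (W →L[ℝ] ℝ) →L[ℝ] E := fun x =>
    (P x).comp ((ContinuousLinearMap.compL ℝ E W ℝ).flip (fderiv ℝ p x))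
  have hXa : ∀ x l, X x l = P x (l.comp (fderiv ℝ p x)) := fun _ _ => rfl
  have hX : SmoothNear X z₀ := by
    filter_upwards [hP.smooth, hp.fderiv] with x h₁ h₂
    exact h₁.clm_comp (ContDiffAt.comp x (ContinuousLinearMap.contDiff _).contDiffAt h₂)
  -- straightening coordinates
  let c : E → K × W := fun x => (ℓ x, p x)
  have hc : SmoothNear c z₀ := hp.mono fun x h => ℓ.contDiff.contDiffAt.prodMk h
  have hc' : ∀ᶠ x in 𝓝 z₀, fderiv ℝ c x = ℓ.prod (fderiv ℝ p x) :=
    hp.differentiableAt.mono fun x h => (ℓ.hasFDerivAt.prodMk h.hasFDerivAt).fderiv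
  have hcb : Function.Bijective (fderiv ℝ c z₀) := by
    rw [hc'.self_of_nhds]
    constructor
    · rw [injective_iff_map_eq_zero]
      intro u hu
      obtain ⟨h₁, h₂⟩ := Prod.mk_eq_zero.1 hu
      have := hℓ ⟨u, h₂⟩
      rw [show ℓ u = 0 from h₁] at this
      exact (congrArg Subtype.val this).symm
    · rintro ⟨k, w⟩
      obtain ⟨e, he⟩ := hp' w
      refine ⟨e - ℓ e + k, Prod.ext ?_ ?_⟩
      · simp [hℓ]
      · have h₁ : fderiv ℝ p z₀ (ℓ e) = 0 := (ℓ e).2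
        have h₂ : fderiv ℝ p z₀ k = 0 := k.2
        simp [h₁, h₂, he]
  obtain ⟨e, hze, hec, -, hes⟩ := exists_openPartialHomeomorph hc hcb
  have hcs : e.symm (c z₀) = z₀ := by rw [← hec]; exact e.left_inv hze
  have hcz : c z₀ ∈ e.target := by rw [← hec]; exact e.map_source hze
  have hs : SmoothNear e.symm (c z₀) := by
    filter_upwards [e.open_target.mem_nhds hcz] with z hz using
      (hes z hz).contDiffAt (e.open_target.mem_nhds hz)
  have hst : Tendsto e.symm (𝓝 (c z₀)) (𝓝 z₀) := by
    have := hs.contDiffAt.continuousAt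
    rwa [ContinuousAt, hcs] at this
  have hct : Tendsto c (𝓝 z₀) (𝓝 (c z₀)) := hc.contDiffAt.continuousAt
  -- the coframe on the fibres
  let A : E → (W →L[ℝ] ℝ) →L[ℝ] K := fun x => ℓ.comp (X x)
  have hA : SmoothNear A z₀ := hX.mono fun x h => contDiffAt_const.clm_comp h
  -- The fields X · l are independent because P is injective and dp surjective; their number is dim
  -- W = dim K, so they frame the fibre.
  have hA0 : (A z₀).IsInvertible := by
    have hi : Function.Injective (A z₀).toLinearMap := by
      rw [injective_iff_map_eq_zero]
      intro l hl
      have h₁ := hℓ ⟨X z₀ l, hinv.self_of_nhds l⟩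
      have h₂ : X z₀ l = 0 := by
        have : ℓ (X z₀ l) = 0 := hl
        rw [this] at h₁
        exact (congrArg Subtype.val h₁).symm
      have h₃ : l.comp (fderiv ℝ p z₀) = 0 := hP' (h₂.trans (map_zero _).symm)
      ext w
      obtain ⟨u, rfl⟩ := hp' w
      exact DFunLike.congr_fun h₃ u
    exact ⟨(LinearEquiv.ofBijective (A z₀).toLinearMap ⟨hi,
      (LinearMap.injective_iff_surjective_of_finrank_eq_finrank
        ((finrank_dual W).trans hdimK.symm)).1 hi⟩).toContinuousLinearEquiv, rfl⟩
  have hAi : ∀ᶠ x in 𝓝 z₀, (A x).IsInvertible := by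
    obtain ⟨L, hL⟩ := hA0
    have : ∀ᶠ x in 𝓝 z₀, A x ∈ range ((↑) : ((W →L[ℝ] ℝ) ≃L[ℝ] K) → (W →L[ℝ] ℝ) →L[ℝ] K) := by
      refine hA.contDiffAt.continuousAt.eventually_mem ?_
      rw [← hL]
      exact ContinuousLinearEquiv.nhds L
    exact this
  -- The condition dq (X l) = l prescribes dq along the fibres of p: it must be the coframe θ dual
  -- to the frame B. Thus q is a fibrewise primitive of θ, and only closedness along K has to be
  -- checked.
  let B : K × W → (W →L[ℝ] ℝ) →L[ℝ] K := fun z => A (e.symm z)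
  let θ : K × W → K →L[ℝ] (W →L[ℝ] ℝ) := fun z => (B z).inverse
  have hB : SmoothNear B (c z₀) := SmoothNear.comp (g := A) (by rwa [hcs]) hs
  have hBi : ∀ᶠ z in 𝓝 (c z₀), (B z).IsInvertible := hst hAi
  have hθ : SmoothNear θ (c z₀) := by
    filter_upwards [hB, hBi] with z h₁ h₂
    exact ContDiffAt.comp z h₂.contDiffAt_map_inverse h₁
  have hcX : ∀ᶠ x in 𝓝 z₀, ∀ l, fderiv ℝ c x (X x l) = (A x l, 0) := by
    filter_upwards [hc', hinv] with x h₁ h₂ l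
    rw [h₁]
    exact Prod.ext rfl (h₂ l)
  have hsX : ∀ᶠ z in 𝓝 (c z₀), ∀ l, fderiv ℝ e.symm z (B z l, 0) = X (e.symm z) l := by
    filter_upwards [hst hcX, e.open_target.mem_nhds hcz, hs.differentiableAt,
      hst hc.differentiableAt] with z h₁ h₂ h₃ h₄ l
    have h₅ : e.symm ∘ c =ᶠ[𝓝 (e.symm z)] id := by
      filter_upwards [e.open_source.mem_nhds (e.map_target h₂)] with x hx
      simp only [Function.comp_apply, id]
      rw [← hec]
      exact e.left_inv hx
    have h₆ : c (e.symm z) = z := by rw [← hec]; exact e.right_inv h₂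
    have h₇ := h₅.fderiv_eq (𝕜 := ℝ)
    rw [fderiv_comp _ (by rwa [h₆]) h₄, fderiv_id, h₆] at h₇
    rw [← h₁ l]
    exact DFunLike.congr_fun h₇ _
  -- Since ℓ is a constant linear map, this is the image under ℓ of the commutation of the
  -- Hamiltonian fields of l ∘ p and m ∘ p.
  have hcomm : ∀ᶠ x in 𝓝 z₀, ∀ l m, fderiv ℝ A x (X x l) m = fderiv ℝ A x (X x m) l := by
    filter_upwards [hP.eventually, hp, hp.eventually, hinv.eventually_nhds, hX.differentiableAt]
      with x h₁ h₂ h₃ h₄ h₅ l m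
    have hd : ∀ l : W →L[ℝ] ℝ, ∀ᶠ y in 𝓝 x, fderiv ℝ (fun y => l (p y)) y = l.comp (fderiv ℝ p y) :=
      fun l => h₃.differentiableAt.mono fun y hy => (l.hasFDerivAt.comp y hy.hasFDerivAt).fderiv
    have hXe : ∀ l : W →L[ℝ] ℝ, (fun y => X y l) =ᶠ[𝓝 x]
        fun y => P y (fderiv ℝ (fun y => l (p y)) y) := fun l =>
      (hd l).mono fun y hy => by simp only [hXa, hy]
    have hsm : ∀ l : W →L[ℝ] ℝ, ContDiffAt ℝ ∞ (fun y => l (p y)) x := fun l =>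
      l.contDiff.contDiffAt.comp x h₂
    have h := h₁.hamiltonian_commute (hsm l) (hsm m) (by
      filter_upwards [hd l, hd m, h₄] with y h₆ h₇ h₈
      rw [h₆, h₇, ContinuousLinearMap.comp_apply, h₈ l, map_zero])
    rw [← (hXe m).fderiv_eq, ← (hXe l).fderiv_eq, (hd l).self_of_nhds, (hd m).self_of_nhds,
      ← hXa, ← hXa] at h
    have hAd : ∀ u m, fderiv ℝ A x u m = ℓ (fderiv ℝ (fun y => X y m) x u) := fun u m => by
      have h₆ := (hasFDerivAt_const (𝕜 := ℝ) ℓ x).clm_comp h₅.hasFDerivAt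
      have h₇ := h₅.hasFDerivAt.clm_apply (hasFDerivAt_const (𝕜 := ℝ) m x)
      rw [h₆.fderiv, h₇.fderiv]
      simp
    rw [hAd, hAd, h]
  have hcl : ∀ᶠ z in 𝓝 (c z₀), ∀ u u' : K, fderiv ℝ θ z (u, 0) u' = fderiv ℝ θ z (u', 0) u := by
    filter_upwards [hθ.differentiableAt, hB.differentiableAt, hBi.eventually_nhds, hsX, hst hcomm,
      hst hA.differentiableAt, hs.differentiableAt] with z h₁ h₂ h₃ h₄ h₅ h₆ h₇ u u'
    obtain ⟨l, rfl⟩ := h₃.self_of_nhds.surjective u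
    obtain ⟨m, rfl⟩ := h₃.self_of_nhds.surjective u'
    have hBd : fderiv ℝ B z = (fderiv ℝ A (e.symm z)).comp (fderiv ℝ e.symm z) :=
      fderiv_comp z h₆ h₇
    -- Differentiate the identity θ (B m) = m along the frame vector B l. The right-hand side
    -- becomes symmetric in l and m by commutation, which is closedness of θ.
    have key : ∀ l m, fderiv ℝ θ z (B z l, 0) (B z m)
        = -θ z (fderiv ℝ A (e.symm z) (X (e.symm z) l) m) := fun l m => by
      have h₈ := h₁.hasFDerivAt.clm_apply
        (h₂.hasFDerivAt.clm_apply (hasFDerivAt_const (𝕜 := ℝ) m z))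
      have h₉ : (fun z => θ z (B z m)) =ᶠ[𝓝 z] fun _ => m :=
        h₃.mono fun y hy => hy.inverse_apply_self m
      have := DFunLike.congr_fun
        (h₈.unique ((hasFDerivAt_const (𝕜 := ℝ) m z).congr_of_eventuallyEq h₉)) (B z l, 0)
      rw [hBd] at this
      simp only [add_apply, ContinuousLinearMap.comp_apply, ContinuousLinearMap.flip_apply,
        zero_apply, map_zero, zero_add, h₄] at this
      exact eq_neg_of_add_eq_zero_right this
    rw [key, key, h₅]
  obtain ⟨Q, hQ, hQ0, hQθ⟩ := exists_relative_primitive hθ hcl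
  refine ⟨fun x => Q (c x), hc.mono fun x h => hQ.contDiffAt.comp x h, hQ0, ?_⟩
  filter_upwards [hcX, hct hQθ, hc.differentiableAt, hAi, e.open_source.mem_nhds hze]
    with x h₁ h₂ h₃ h₄ h₅ l
  have h₆ : fderiv ℝ (fun x => Q (c x)) x = (fderiv ℝ Q (c x)).comp (fderiv ℝ c x) :=
    fderiv_comp x (hQ.differentiable (by simp) _) h₃
  have h₇ : e.symm (c x) = x := by rw [← hec]; exact e.left_inv h₅
  rw [h₆, ContinuousLinearMap.comp_apply, ← hXa, h₁, h₂]
  simp only [θ, B, h₇]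
  exact h₄.inverse_apply_self l

end Conjugate

end SplitSystem

end

open scoped Manifold ContDiff Topology

noncomputable section

namespace SplitSystem

open Set Filter

/-! ### Straightening in a product of a symplectic and a Poisson vector space -/

section Block

variable {E₁ E₂ : Type*} [NormedAddCommGroup E₁] [NormedSpace ℝ E₁]
  [NormedAddCommGroup E₂] [NormedSpace ℝ E₂]

/-- The product of two bivector fields on vector spaces. -/
def blockSharp (P₁ : E₁ → (E₁ →L[ℝ] ℝ) →L[ℝ] E₁) (P₂ : E₂ → (E₂ →L[ℝ] ℝ) →L[ℝ] E₂) (z : E₁ × E₂) :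
    (E₁ × E₂ →L[ℝ] ℝ) →L[ℝ] E₁ × E₂ :=
  ((P₁ z.1).comp ((ContinuousLinearMap.compL ℝ E₁ (E₁ × E₂) ℝ).flip
      (ContinuousLinearMap.inl ℝ E₁ E₂))).prod
    ((P₂ z.2).comp ((ContinuousLinearMap.compL ℝ E₂ (E₁ × E₂) ℝ).flip
      (ContinuousLinearMap.inr ℝ E₁ E₂)))

variable {P₁ : E₁ → (E₁ →L[ℝ] ℝ) →L[ℝ] E₁} {P₂ : E₂ → (E₂ →L[ℝ] ℝ) →L[ℝ] E₂} {v : E₁} {b : E₂}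

lemma blockSharp_apply (z : E₁ × E₂) (α : E₁ × E₂ →L[ℝ] ℝ) :
    blockSharp P₁ P₂ z α = (P₁ z.1 (α.comp (ContinuousLinearMap.inl ℝ E₁ E₂)),
      P₂ z.2 (α.comp (ContinuousLinearMap.inr ℝ E₁ E₂))) := rfl

lemma blockSharp_comp_fst (z : E₁ × E₂) (a : E₁ →L[ℝ] ℝ) :
    blockSharp P₁ P₂ z (a.comp (ContinuousLinearMap.fst ℝ E₁ E₂)) = (P₁ z.1 a, 0) := by
  rw [blockSharp_apply, ContinuousLinearMap.comp_assoc, ContinuousLinearMap.comp_assoc,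
    ContinuousLinearMap.fst_comp_inl, ContinuousLinearMap.fst_comp_inr,
    ContinuousLinearMap.comp_zero, map_zero, ContinuousLinearMap.comp_id]

/-- The first factor of a Poisson product is Poisson. -/
lemma IsPoissonGerm.fst (hP : IsPoissonGerm (blockSharp P₁ P₂) (v, b)) : IsPoissonGerm P₁ v := by
  have hi : Tendsto (fun x : E₁ => (x, b)) (𝓝 v) (𝓝 (v, b)) :=
    (Continuous.prodMk_left b).continuousAt
  let φ : (E₁ →L[ℝ] ℝ) →L[ℝ] (E₁ × E₂ →L[ℝ] ℝ) :=
    (ContinuousLinearMap.compL ℝ (E₁ × E₂) E₁ ℝ).flip (ContinuousLinearMap.fst ℝ E₁ E₂)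
  have hφ : ∀ a, φ a = a.comp (ContinuousLinearMap.fst ℝ E₁ E₂) := fun _ => rfl
  have hP₁ : P₁ = fun x => (ContinuousLinearMap.fst ℝ E₁ E₂).comp
      ((blockSharp P₁ P₂ (x, b)).comp φ) := by
    ext x a
    simp only [ContinuousLinearMap.comp_apply, hφ, blockSharp_comp_fst,
      ContinuousLinearMap.coe_fst']
  refine ⟨?_, ?_, ?_⟩
  · filter_upwards [hi.eventually hP.smooth] with x hx
    rw [hP₁]
    refine contDiffAt_const.clm_comp (ContDiffAt.clm_comp ?_ contDiffAt_const)
    exact ContDiffAt.comp (g := blockSharp P₁ P₂) (f := fun x => (x, b)) x hx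
      (contDiffAt_id.prodMk contDiffAt_const)
  · filter_upwards [hi.eventually hP.skew] with x hx α β
    have := hx (φ α) (φ β)
    simpa [hφ, blockSharp_comp_fst] using this
  · filter_upwards [hi.eventually hP.jacobi, hi.eventually hP.smooth.differentiableAt] with x hx hd α β γ
    have hder : ∀ u : E₁, ∀ a : E₁ →L[ℝ] ℝ, fderiv ℝ P₁ x u a
        = (fderiv ℝ (blockSharp P₁ P₂) (x, b) (u, 0) (φ a)).1 := fun u a => by
      have h₁ : HasFDerivAt (fun x => blockSharp P₁ P₂ (x, b)) _ x :=
        HasFDerivAt.comp (g := blockSharp P₁ P₂) (f := fun x => (x, b)) x hd.hasFDerivAt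
          (hasFDerivAt_prodMk_left x b)
      have h₂ := (hasFDerivAt_const (𝕜 := ℝ) (ContinuousLinearMap.fst ℝ E₁ E₂) x).clm_comp
        (h₁.clm_comp (hasFDerivAt_const (𝕜 := ℝ) φ x))
      rw [← hP₁] at h₂
      rw [h₂.fderiv]
      simp
    have := hx (φ α) (φ β) (φ γ)
    simp only [hφ, blockSharp_comp_fst, ContinuousLinearMap.comp_apply,
      ContinuousLinearMap.coe_fst'] at this
    rw [hder, hder, hder]
    exact this

end Block

/-! ### Moving involutive functions of the symplectic factor by a Hamiltonian flow. -/

section Straightening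

variable {E₁ E₂ W V : Type} [NormedAddCommGroup E₁] [NormedSpace ℝ E₁] [FiniteDimensional ℝ E₁]
  [NormedAddCommGroup E₂] [NormedSpace ℝ E₂] [FiniteDimensional ℝ E₂]
  [NormedAddCommGroup W] [NormedSpace ℝ W] [NormedAddCommGroup V] [NormedSpace ℝ V]
  {P₁ : E₁ → (E₁ →L[ℝ] ℝ) →L[ℝ] E₁} {P₂ : E₂ → (E₂ →L[ℝ] ℝ) →L[ℝ] E₂} {v : E₁} {b : E₂}

/-- A Poisson diffeomorphism moving the functions `p` in involution on the symplectic factor by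
functions `h` in involution on the second factor. -/
lemma exists_straightening (hP : IsPoissonGerm (blockSharp P₁ P₂) (v, b))
    (hP₁ : Function.Injective (P₁ v)) {p : E₁ → W} (hp : SmoothNear p v)
    (hp' : Function.Surjective (fderiv ℝ p v))
    (hdim : Module.finrank ℝ E₁ = 2 * Module.finrank ℝ W)
    (hinv : ∀ᶠ x in 𝓝 v, ∀ l : W →L[ℝ] ℝ, fderiv ℝ p x (P₁ x (l.comp (fderiv ℝ p x))) = 0)
    {h : E₂ → W} (hh : SmoothNear h b)
    (hhh : ∀ᶠ y in 𝓝 b, ∀ l : W →L[ℝ] ℝ, fderiv ℝ h y (P₂ y (l.comp (fderiv ℝ h y))) = 0)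
    {g : E₂ → V} (hg : SmoothNear g b)
    (hgh : ∀ᶠ y in 𝓝 b, ∀ l : W →L[ℝ] ℝ, fderiv ℝ g y (P₂ y (l.comp (fderiv ℝ h y))) = 0) :
    ∃ Θ : E₁ × E₂ → E₁ × E₂, SmoothNear Θ (v, b) ∧ Θ (v, b) = (v, b) ∧
      Function.Injective (fderiv ℝ Θ (v, b)) ∧
      (∀ᶠ z in 𝓝 (v, b), ∀ β : E₁ × E₂ →L[ℝ] ℝ,
        fderiv ℝ Θ z (blockSharp P₁ P₂ z (β.comp (fderiv ℝ Θ z))) = blockSharp P₁ P₂ (Θ z) β) ∧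
      (∀ᶠ z in 𝓝 (v, b), p (Θ z).1 = p z.1 - (h z.2 - h b)) ∧
      (∀ᶠ z in 𝓝 (v, b), g (Θ z).2 = g z.2) := by
  obtain ⟨q, hq, hq0, hqp⟩ := exists_conjugate hP.fst hP₁ hp hp' hdim hinv
  have h₁ : Tendsto (Prod.fst : E₁ × E₂ → E₁) (𝓝 (v, b)) (𝓝 v) := continuousAt_fst
  have h₂ : Tendsto (Prod.snd : E₁ × E₂ → E₂) (𝓝 (v, b)) (𝓝 b) := continuousAt_snd
  -- Both q and h - h(b) vanish at the base point, so G is critical there. Conjugacy makes p change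
  -- at the rate -(h - h(b)), while the E₂-component of the Hamiltonian field is a combination of
  -- Hamiltonian fields of h, which kill h and g.
  let G : E₁ × E₂ → ℝ := fun z => q z.1 (h z.2 - h b)
  have hG : SmoothNear G (v, b) := by
    filter_upwards [h₁.eventually hq, h₂.eventually hh] with z hz₁ hz₂
    exact (ContDiffAt.comp (g := q) z hz₁ contDiffAt_fst).clm_apply
      ((ContDiffAt.comp (g := h) z hz₂ contDiffAt_snd).sub contDiffAt_const)
  have hdfst : ∀ {U : Type} [NormedAddCommGroup U] [NormedSpace ℝ U] {f : E₁ → U} {z : E₁ × E₂},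
      DifferentiableAt ℝ f z.1 → HasFDerivAt (fun z : E₁ × E₂ => f z.1)
        ((fderiv ℝ f z.1).comp (ContinuousLinearMap.fst ℝ E₁ E₂)) z := fun hf =>
    hf.hasFDerivAt.comp _ hasFDerivAt_fst
  have hdsnd : ∀ {U : Type} [NormedAddCommGroup U] [NormedSpace ℝ U] {f : E₂ → U} {z : E₁ × E₂},
      DifferentiableAt ℝ f z.2 → HasFDerivAt (fun z : E₁ × E₂ => f z.2)
        ((fderiv ℝ f z.2).comp (ContinuousLinearMap.snd ℝ E₁ E₂)) z := fun hf =>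
    hf.hasFDerivAt.comp _ hasFDerivAt_snd
  have hGd : ∀ᶠ z in 𝓝 (v, b), ∀ u : E₁ × E₂, fderiv ℝ G z u
      = fderiv ℝ q z.1 u.1 (h z.2 - h b) + q z.1 (fderiv ℝ h z.2 u.2) := by
    filter_upwards [h₁.eventually hq.differentiableAt, h₂.eventually hh.differentiableAt] with z hz₁ hz₂ u
    rw [((hdfst hz₁).clm_apply ((hdsnd hz₂).sub_const (h b))).fderiv]
    simp [add_comm]
  have hG0 : fderiv ℝ G (v, b) = 0 := by
    ext u <;> simp [hGd.self_of_nhds, hq0]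
  have hX : ∀ᶠ z in 𝓝 (v, b), blockSharp P₁ P₂ z (fderiv ℝ G z)
      = (P₁ z.1 ((fderiv ℝ q z.1).flip (h z.2 - h b)), P₂ z.2 ((q z.1).comp (fderiv ℝ h z.2))) := by
    filter_upwards [hGd] with z hz
    rw [blockSharp_apply]
    congr 2 <;> ext u <;> simp [hz]
  obtain ⟨Θ, hΘ⟩ := exists_poissonFlowGerm hP hG (by rw [hG0, map_zero])
  refine ⟨Θ, hΘ.smooth, hΘ.fix, hΘ.injective, hΘ.poisson, ?_, ?_⟩
  · have := hΘ.evolve (fun z => p z.1) (fun z => -(h z.2 - h b))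
      ((h₁.eventually hp.differentiableAt).mono fun z hz => (hdfst hz).differentiableAt)
      ((h₂.eventually hh.differentiableAt).mono fun z hz =>
        ((hdsnd hz).sub_const (h b)).neg.differentiableAt) (by
        filter_upwards [hX, h₁.eventually hp.differentiableAt, h₁.eventually hqp,
          h₁.eventually hP.fst.skew] with z h₃ h₄ h₅ h₆
        rw [h₃, (hdfst h₄).fderiv]
        refine (SeparatingDual.eq_iff_forall_dual_eq (R := ℝ)).2 fun l => ?_
        have := h₆ ((fderiv ℝ q z.1).flip (h z.2 - h b)) (l.comp (fderiv ℝ p z.1))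
        rw [ContinuousLinearMap.flip_apply, h₅] at this
        simpa using this) (by
        filter_upwards [hX, h₂.eventually hh.differentiableAt, h₂.eventually hhh] with z h₃ h₄ h₅
        rw [h₃, ((hdsnd h₄).sub_const (h b)).fun_neg.fderiv]
        simp [h₅])
    filter_upwards [this] with z hz
    rw [hz, one_smul, ← sub_eq_add_neg]
  · have := hΘ.evolve (fun z => g z.2) (fun _ => 0)
      ((h₂.eventually hg.differentiableAt).mono fun z hz => (hdsnd hz).differentiableAt)
      (.of_forall fun z => differentiableAt_const _) (by
        filter_upwards [hX, h₂.eventually hg.differentiableAt, h₂.eventually hgh] with z h₃ h₄ h₅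
        rw [h₃, (hdsnd h₄).fderiv]
        simp [h₅]) (.of_forall fun z => by simp)
    filter_upwards [this] with z hz
    rw [hz, smul_zero, add_zero]

end Straightening

/-! ### Linear algebra of transversals -/

section LinearAlgebra

variable {E₁ E₂ W T : Type*} [NormedAddCommGroup E₁] [NormedSpace ℝ E₁]
  [NormedAddCommGroup E₂] [NormedSpace ℝ E₂]
  [NormedAddCommGroup W] [NormedSpace ℝ W] [NormedAddCommGroup T] [NormedSpace ℝ T]

/-- The common kernel of a maximal isotropic family of covectors is isotropic. -/
lemma apply_eq_zero_of_isotropic [FiniteDimensional ℝ E₁] {S : (E₁ →L[ℝ] ℝ) →L[ℝ] E₁}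
    (hS : Function.Injective S) {f : E₁ →L[ℝ] W} (hf : Function.Surjective f)
    (hdim : Module.finrank ℝ E₁ = 2 * Module.finrank ℝ W)
    (hinv : ∀ l : W →L[ℝ] ℝ, f (S (l.comp f)) = 0) {a : E₁ →L[ℝ] ℝ} (ha : f (S a) = 0) {u : E₁}
    (hu : f u = 0) : a u = 0 := by
  have : FiniteDimensional ℝ W := Module.Finite.of_surjective f.toLinearMap hf
  let K : Submodule ℝ E₁ := f.toLinearMap.ker
  have hdimK : Module.finrank ℝ K = Module.finrank ℝ W := by
    have h := f.toLinearMap.finrank_range_add_finrank_ker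
    rw [LinearMap.range_eq_top.2 hf, finrank_top, hdim] at h
    have h' : Module.finrank ℝ K = Module.finrank ℝ f.toLinearMap.ker := rfl
    omega
  -- Isotropy puts S (l ∘ f) in K = ker f, and equality of dimensions makes this an isomorphism W* ≃
  -- K. Hence S a ∈ K forces a = l ∘ f, which vanishes on K.
  let A : (W →L[ℝ] ℝ) →ₗ[ℝ] K := LinearMap.codRestrict K
    (S.toLinearMap ∘ₗ ((ContinuousLinearMap.compL ℝ E₁ W ℝ).flip f).toLinearMap) hinv
  have hA : Function.Injective A := by
    rw [injective_iff_map_eq_zero]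
    intro l hl
    have h₁ : S (l.comp f) = 0 := congrArg Subtype.val hl
    have h₂ : l.comp f = 0 := hS (h₁.trans (map_zero _).symm)
    ext w
    obtain ⟨u, rfl⟩ := hf w
    exact DFunLike.congr_fun h₂ u
  obtain ⟨l, hl⟩ := (LinearMap.injective_iff_surjective_of_finrank_eq_finrank
    ((finrank_dual W).trans hdimK.symm)).1 hA ⟨S a, ha⟩
  have h₁ : S (l.comp f) = S a := congrArg Subtype.val hl
  rw [← hS h₁, ContinuousLinearMap.comp_apply, hu, map_zero]

/-- A transversal mapped by an infinitesimal Poisson isomorphism `A` into the product of an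
isotropic space with the second factor carries the bivector of the second factor. -/
lemma exists_covector_of_isotropic {P : (E₁ × E₂ →L[ℝ] ℝ) →L[ℝ] E₁ × E₂}
    {P₁ : (E₁ →L[ℝ] ℝ) →L[ℝ] E₁} {P₂ : (E₂ →L[ℝ] ℝ) →L[ℝ] E₂} {A : E₁ × E₂ →L[ℝ] E₁ × E₂}
    (hA : Function.Injective A) (hAP : ∀ β : E₁ × E₂ →L[ℝ] ℝ, A (P (β.comp A))
      = (P₁ (β.comp (ContinuousLinearMap.inl ℝ E₁ E₂)),
        P₂ (β.comp (ContinuousLinearMap.inr ℝ E₁ E₂))))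
    (hP₁ : Function.Surjective P₁) {f : E₁ →L[ℝ] W}
    (hf : ∀ a u, f (P₁ a) = 0 → f u = 0 → a u = 0) {J : T →L[ℝ] E₁ × E₂}
    (hfJ : ∀ w, f (A (J w)).1 = 0) {β : T →L[ℝ] ℝ} {c : E₂ →L[ℝ] ℝ}
    (hc : ∀ w, c (A (J w)).2 = β w) {w : T} (hw : (A (J w)).2 = P₂ c) :
    ∃ α : E₁ × E₂ →L[ℝ] ℝ, α.comp J = β ∧ J w = P α := by
  -- The covector is A*(a, c) with a chosen so that the first components match. By isotropy a
  -- vanishes on the first components of A ∘ J, so only c contributes to the restriction.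
  obtain ⟨a, ha⟩ := hP₁ (A (J w)).1
  refine ⟨(a.coprod c).comp A, ?_, hA ?_⟩
  · ext u
    have : a (A (J u)).1 = 0 := hf a _ (by rw [ha]; exact hfJ w) (hfJ u)
    simp [this, hc]
  · rw [hAP]
    simp [ha, ← hw]

end LinearAlgebra

end SplitSystem

end

open scoped Manifold ContDiff Topology

noncomputable section

namespace SplitSystem

open Set Filter

/-! ### Partial diffeomorphisms -/

section PartialDiffeo

variable {E : Type*} [NormedAddCommGroup E] [NormedSpace ℝ E]
  {H : Type*} [TopologicalSpace H] {I : ModelWithCorners ℝ E H}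
  {M : Type*} [TopologicalSpace M] [ChartedSpace H M]
  {F : Type*} [NormedAddCommGroup F] [NormedSpace ℝ F]
  {G : Type*} [TopologicalSpace G] {J : ModelWithCorners ℝ F G}
  {N : Type*} [TopologicalSpace N] [ChartedSpace G N]

lemma symm_apply_apply (Φ : PartialDiffeomorph I J M N ∞) {x : M} (hx : x ∈ Φ.source) :
    Φ.symm (Φ x) = x := Φ.left_inv hx

lemma apply_symm_apply (Φ : PartialDiffeomorph I J M N ∞) {y : N} (hy : y ∈ Φ.target) :
    Φ (Φ.symm y) = y := Φ.right_inv hy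

lemma apply_mem_target (Φ : PartialDiffeomorph I J M N ∞) {x : M} (hx : x ∈ Φ.source) :
    Φ x ∈ Φ.target := Φ.map_source hx

lemma symm_mem_source (Φ : PartialDiffeomorph I J M N ∞) {y : N} (hy : y ∈ Φ.target) :
    Φ.symm y ∈ Φ.source := Φ.map_target hy

lemma mdifferentiableAt_of_mem (Φ : PartialDiffeomorph I J M N ∞) {x : M} (hx : x ∈ Φ.source) :
    MDifferentiableAt I J Φ x := Φ.mdifferentiableAt (by simp) hx

lemma mdifferentiableAt_symm_of_mem (Φ : PartialDiffeomorph I J M N ∞) {y : N}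
    (hy : y ∈ Φ.target) : MDifferentiableAt J I Φ.symm y :=
  Φ.symm.mdifferentiableAt (by simp) hy

lemma mfderiv_symm_comp_mfderiv (Φ : PartialDiffeomorph I J M N ∞) {x : M} (hx : x ∈ Φ.source) :
    (mfderiv J I Φ.symm (Φ x)).comp (mfderiv I J Φ x) = ContinuousLinearMap.id ℝ E := by
  have h := mfderiv_comp x (mdifferentiableAt_symm_of_mem Φ (apply_mem_target Φ hx))
    (mdifferentiableAt_of_mem Φ hx)
  have h' : (Φ.symm ∘ Φ : M → M) =ᶠ[𝓝 x] id := by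
    filter_upwards [Φ.open_source.mem_nhds hx] with y hy using symm_apply_apply Φ hy
  rw [← h, h'.mfderiv_eq, mfderiv_id]
  rfl

lemma mfderiv_comp_mfderiv_symm (Φ : PartialDiffeomorph I J M N ∞) {x : M} (hx : x ∈ Φ.source) :
    (mfderiv I J Φ x).comp (mfderiv J I Φ.symm (Φ x)) = ContinuousLinearMap.id ℝ F := by
  have hx' := apply_mem_target Φ hx
  have h := mfderiv_comp (Φ x) (mdifferentiableAt_of_mem Φ (symm_mem_source Φ hx'))
    (mdifferentiableAt_symm_of_mem Φ hx')
  have h' : (Φ ∘ Φ.symm : N → N) =ᶠ[𝓝 (Φ x)] id := by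
    filter_upwards [Φ.open_target.mem_nhds hx'] with y hy using apply_symm_apply Φ hy
  rw [h'.mfderiv_eq, mfderiv_id, symm_apply_apply Φ hx] at h
  exact h.symm

/-- The differential of a partial diffeomorphism as a linear equivalence. -/
def mfderivEquiv (Φ : PartialDiffeomorph I J M N ∞) {x : M} (hx : x ∈ Φ.source) :
    TangentSpace I x ≃L[ℝ] TangentSpace J (Φ x) :=
  ContinuousLinearEquiv.equivOfInverse (mfderiv I J Φ x) (mfderiv J I Φ.symm (Φ x))
    (fun u => DFunLike.congr_fun (mfderiv_symm_comp_mfderiv Φ hx) u)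
    (fun u => DFunLike.congr_fun (mfderiv_comp_mfderiv_symm Φ hx) u)

lemma injective_mfderiv (Φ : PartialDiffeomorph I J M N ∞) {x : M} (hx : x ∈ Φ.source) :
    Function.Injective (mfderiv I J Φ x) := (mfderivEquiv Φ hx).injective

/-- The restriction of a partial diffeomorphism to an open set. -/
def restrictOpen (Φ : PartialDiffeomorph I J M N ∞) {U : Set M} (hU : IsOpen U) :
    PartialDiffeomorph I J M N ∞ where
  toPartialEquiv := (Φ.toOpenPartialHomeomorph.restrOpen U hU).toPartialEquiv
  open_source := (Φ.toOpenPartialHomeomorph.restrOpen U hU).open_source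
  open_target := (Φ.toOpenPartialHomeomorph.restrOpen U hU).open_target
  contMDiffOn_toFun := Φ.contMDiffOn_toFun.mono inter_subset_left
  contMDiffOn_invFun := Φ.contMDiffOn_invFun.mono inter_subset_left

lemma restrictOpen_target_subset (Φ : PartialDiffeomorph I J M N ∞) {U : Set M} (hU : IsOpen U) :
    (restrictOpen Φ hU).target ⊆ Φ.target := fun _ hy => hy.1

end PartialDiffeo

lemma linearIndependent_comp_clm {κ E F : Type*} [NormedAddCommGroup E] [NormedSpace ℝ E]
    [NormedAddCommGroup F] [NormedSpace ℝ F] {l : κ → F →L[ℝ] ℝ} (hl : LinearIndependent ℝ l)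
    (A : E →L[ℝ] F) (hA : Function.Surjective A) :
    LinearIndependent ℝ fun i => (l i).comp A := by
  refine hl.map' ((ContinuousLinearMap.compL ℝ E F ℝ).flip A).toLinearMap ?_
  rw [LinearMap.ker_eq_bot, injective_iff_map_eq_zero]
  intro l hl
  ext u
  obtain ⟨w, rfl⟩ := hA u
  exact DFunLike.congr_fun hl w

/-! ### Transport of structures by isomorphisms -/

section Transport

variable {E : Type*} [NormedAddCommGroup E] [NormedSpace ℝ E]
  {H : Type*} [TopologicalSpace H] {I : ModelWithCorners ℝ E H}
  {M : Type*} [TopologicalSpace M] [ChartedSpace H M]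
  {F : Type*} [NormedAddCommGroup F] [NormedSpace ℝ F]
  {G : Type*} [TopologicalSpace G] {J : ModelWithCorners ℝ F G}
  {N : Type*} [TopologicalSpace N] [ChartedSpace G N]
  {Φ : PartialDiffeomorph I J M N ∞} {πM : SharpField I M} {DM : Distribution I M}
  {πN : SharpField J N} {DN : Distribution J N}

/-- Tangent spaces at equal points are different expressions that unfold to E; the ascription to E
makes the equation well typed. -/
lemma SharpField.congr_point (π : SharpField I M) {x y : M} (h : x = y) (β : E →L[ℝ] ℝ) :
    (π x β : E) = (π y β : E) := by
  subst h
  rfl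

lemma Distribution.congr_point (D : Distribution I M) {x y : M} (h : x = y) :
    (D x : Submodule ℝ E) = D y := by
  subst h
  rfl

lemma IsSystemIso.symm (h : IsSystemIso Φ πM DM πN DN) : IsSystemIso Φ.symm πN DN πM DM := by
  intro y hy
  obtain ⟨x, hx, rfl⟩ : ∃ x ∈ Φ.source, Φ x = y :=
    ⟨Φ.symm y, symm_mem_source Φ hy, apply_symm_apply Φ hy⟩
  obtain ⟨h₁, h₂⟩ := h x hx
  have hs := symm_apply_apply Φ hx
  constructor
  · intro β
    refine Eq.trans ?_ (SharpField.congr_point πM hs.symm β)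
    rw [← h₁]
    have e := mfderiv_symm_comp_mfderiv Φ hx
    refine (DFunLike.congr_fun e _).trans ?_
    refine congrArg (fun β : E →L[ℝ] ℝ => (πM x β : E)) ?_
    exact (ContinuousLinearMap.comp_assoc _ _ _).trans
      ((congrArg (ContinuousLinearMap.comp β) e).trans (ContinuousLinearMap.comp_id β))
  · rw [← h₂]
    have hD : (DM (Φ.symm (Φ x)) : Submodule ℝ E) = DM x := Distribution.congr_point DM hs
    refine Eq.trans ?_ hD.symm
    refine SetLike.ext fun (u : E) => ?_
    have e := mfderiv_symm_comp_mfderiv Φ hx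
    constructor
    · rintro ⟨_, ⟨w, hw, rfl⟩, rfl⟩
      have : mfderiv J I Φ.symm (Φ x) (mfderiv I J Φ x w) = w := DFunLike.congr_fun e w
      exact (Eq.symm this : _) ▸ hw
    · intro hu
      exact ⟨_, ⟨u, hu, rfl⟩, DFunLike.congr_fun e u⟩

lemma IsSystemIso.trans {E' : Type*} [NormedAddCommGroup E'] [NormedSpace ℝ E']
    {H' : Type*} [TopologicalSpace H'] {K : ModelWithCorners ℝ E' H'}
    {L : Type*} [TopologicalSpace L] [ChartedSpace H' L] {Ψ : PartialDiffeomorph J K N L ∞}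
    {πL : SharpField K L} {DL : Distribution K L}
    (h : IsSystemIso Φ πM DM πN DN) (h' : IsSystemIso Ψ πN DN πL DL) :
    IsSystemIso (Φ.trans Ψ) πM DM πL DL := by
  rintro x ⟨hx, hx'⟩
  obtain ⟨h₁, h₂⟩ := h x hx
  obtain ⟨h₃, h₄⟩ := h' (Φ x) hx'
  have e : mfderiv I K (Φ.trans Ψ) x = (mfderiv J K Ψ (Φ x)).comp (mfderiv I J Φ x) :=
    mfderiv_comp x (mdifferentiableAt_of_mem Ψ hx') (mdifferentiableAt_of_mem Φ hx)
  constructor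
  · intro β
    rw [e]
    refine Eq.trans ?_ (h₃ β)
    exact congrArg (mfderiv J K Ψ (Φ x)) (h₁ (β.comp (mfderiv J K Ψ (Φ x))))
  · rw [e]
    refine Eq.trans ?_ h₄
    rw [← h₂]
    exact Submodule.map_comp _ _ _

lemma diff_comp {f : N → ℝ} {x : M} (hx : x ∈ Φ.source)
    (hf : MDifferentiableAt J 𝓘(ℝ, ℝ) f (Φ x)) :
    diff I (f ∘ Φ) x = (diff J f (Φ x)).comp (mfderiv I J Φ x) :=
  mfderiv_comp x hf (mdifferentiableAt_of_mem Φ hx)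

lemma IsSystemIso.bracket (h : IsSystemIso Φ πM DM πN DN) {f g : N → ℝ} {x : M}
    (hx : x ∈ Φ.source) (hf : MDifferentiableAt J 𝓘(ℝ, ℝ) f (Φ x))
    (hg : MDifferentiableAt J 𝓘(ℝ, ℝ) g (Φ x)) :
    bracket πN f g (Φ x) = bracket πM (f ∘ Φ) (g ∘ Φ) x := by
  unfold SplitSystem.bracket hamVF
  rw [diff_comp hx hf, diff_comp hx hg, ← (h x hx).1]
  rfl

lemma bracket_congr (π : SharpField I M) {f f' g g' : M → ℝ} {x : M} (hf : f =ᶠ[𝓝 x] f')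
    (hg : g =ᶠ[𝓝 x] g') : SplitSystem.bracket π f g x = SplitSystem.bracket π f' g' x := by
  unfold SplitSystem.bracket hamVF diff
  rw [hf.mfderiv_eq, hg.mfderiv_eq]

lemma mdifferentiableAt_of_contMDiffOn {f : M → N} {V : Set M}
    (hf : ContMDiffOn I J ∞ f V) (hV : IsOpen V) {x : M} (hx : x ∈ V) :
    MDifferentiableAt I J f x :=
  (hf.contMDiffAt (hV.mem_nhds hx)).mdifferentiableAt (by simp)

/-- Brackets on the target pull back to brackets on the source. For Jacobi the inner brackets have
to agree on a neighbourhood, since they are differentiated again. -/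
lemma IsSystemIso.isPoissonOn (h : IsSystemIso Φ πM DM πN DN) (hM : IsPoissonOn πM Φ.source) :
    IsPoissonOn πN Φ.target := by
  have hex : ∀ y ∈ Φ.target, ∃ x ∈ Φ.source, Φ x = y := fun y hy =>
    ⟨Φ.symm y, symm_mem_source Φ hy, apply_symm_apply Φ hy⟩
  have hV' : ∀ V : Set N, IsOpen V → IsOpen (Φ.source ∩ Φ ⁻¹' V) := fun V hV =>
    Φ.contMDiffOn.continuousOn.isOpen_inter_preimage Φ.open_source hV
  have hcomp : ∀ {V : Set N} {f : N → ℝ}, ContMDiffOn J 𝓘(ℝ, ℝ) ∞ f V →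
      ContMDiffOn I 𝓘(ℝ, ℝ) ∞ (f ∘ Φ) (Φ.source ∩ Φ ⁻¹' V) := fun hf =>
    hf.comp (Φ.contMDiffOn.mono inter_subset_left) fun x hx => hx.2
  have hsm : ∀ V : Set N, IsOpen V → V ⊆ Φ.target → ∀ f g : N → ℝ,
      ContMDiffOn J 𝓘(ℝ, ℝ) ∞ f V → ContMDiffOn J 𝓘(ℝ, ℝ) ∞ g V →
      ContMDiffOn J 𝓘(ℝ, ℝ) ∞ (SplitSystem.bracket πN f g) V := fun V hV hVt f g hf hg => by
    have h₁ := hM.smooth _ (hV' V hV) inter_subset_left _ _ (hcomp hf) (hcomp hg)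
    refine (h₁.comp (Φ.symm.contMDiffOn.mono hVt) fun y hy => ⟨symm_mem_source Φ (hVt hy), ?_⟩).congr
      fun y hy => ?_
    · rw [mem_preimage]
      exact (apply_symm_apply Φ (hVt hy)).symm ▸ hy
    · obtain ⟨x, hx, rfl⟩ := hex y (hVt hy)
      rw [h.bracket hx (mdifferentiableAt_of_contMDiffOn hf hV hy)
        (mdifferentiableAt_of_contMDiffOn hg hV hy), Function.comp_apply, symm_apply_apply Φ hx]
  refine ⟨fun y hy α β => ?_, hsm, fun V hV hVt f g k hf hg hk y hy => ?_⟩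
  · obtain ⟨x, hx, rfl⟩ := hex y hy
    rw [← (h x hx).1, ← (h x hx).1]
    exact hM.skew x hx (α.comp (mfderiv I J Φ x)) (β.comp (mfderiv I J Φ x))
  · obtain ⟨x, hx, rfl⟩ := hex y (hVt hy)
    have hb : ∀ f g k : N → ℝ, ContMDiffOn J 𝓘(ℝ, ℝ) ∞ f V → ContMDiffOn J 𝓘(ℝ, ℝ) ∞ g V →
        ContMDiffOn J 𝓘(ℝ, ℝ) ∞ k V →
        SplitSystem.bracket πN f (SplitSystem.bracket πN g k) (Φ x)
        = SplitSystem.bracket πM (f ∘ Φ) (SplitSystem.bracket πM (g ∘ Φ) (k ∘ Φ)) x :=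
      fun f g k hf hg hk => by
        rw [h.bracket hx (mdifferentiableAt_of_contMDiffOn hf hV hy)
          (mdifferentiableAt_of_contMDiffOn (hsm V hV hVt g k hg hk) hV hy)]
        refine bracket_congr πM EventuallyEq.rfl ?_
        filter_upwards [(hV' V hV).mem_nhds ⟨hx, hy⟩] with z hz
        exact h.bracket hz.1 (mdifferentiableAt_of_contMDiffOn hg hV hz.2)
          (mdifferentiableAt_of_contMDiffOn hk hV hz.2)
    rw [hb f g k hf hg hk, hb g k f hg hk hf, hb k f g hk hf hg]
    exact hM.jacobi _ (hV' V hV) inter_subset_left _ _ _ (hcomp hf) (hcomp hg) (hcomp hk) x ⟨hx, hy⟩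

lemma IsSystemIso.charSpace_map (h : IsSystemIso Φ πM DM πN DN) {x : M} (hx : x ∈ Φ.source) :
    (charSpace πM x).map (mfderiv I J Φ x).toLinearMap = charSpace πN (Φ x) := by
  refine SetLike.ext fun u => ?_
  constructor
  · rintro ⟨_, ⟨α, rfl⟩, rfl⟩
    refine ⟨α.comp ((mfderivEquiv Φ hx).symm : TangentSpace J (Φ x) →L[ℝ] TangentSpace I x), ?_⟩
    rw [← (h x hx).1, ContinuousLinearMap.comp_assoc]
    have e : ((mfderivEquiv Φ hx).symm : TangentSpace J (Φ x) →L[ℝ] TangentSpace I x).comp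
        (mfderiv I J Φ x) = ContinuousLinearMap.id ℝ _ := mfderiv_symm_comp_mfderiv Φ hx
    rw [e]
    rfl
  · rintro ⟨β, rfl⟩
    exact ⟨_, ⟨_, rfl⟩, (h x hx).1 β⟩

lemma IsSystemIso.rankAt_eq (h : IsSystemIso Φ πM DM πN DN) {x : M} (hx : x ∈ Φ.source) :
    rankAt πN (Φ x) = rankAt πM x := by
  unfold rankAt
  rw [← h.charSpace_map hx]
  exact (mfderivEquiv Φ hx).toLinearEquiv.finrank_map_eq _

lemma IsSystemIso.mem_distribution_iff (h : IsSystemIso Φ πM DM πN DN) {x : M}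
    (hx : x ∈ Φ.source) (u : TangentSpace I x) : mfderiv I J Φ x u ∈ DN (Φ x) ↔ u ∈ DM x := by
  rw [← (h x hx).2]
  constructor
  · rintro ⟨w, hw, hwu⟩
    rwa [← injective_mfderiv Φ hx hwu]
  · exact fun hu => ⟨u, hu, rfl⟩

lemma IsSystemIso.definesOn (h : IsSystemIso Φ πM DM πN DN) {m : ℕ} {f : Fin m → N → ℝ}
    {V : Set N} (hV : IsOpen V) (hf : DefinesOn f DN V) :
    DefinesOn (fun i => f i ∘ Φ) DM (Φ.source ∩ Φ ⁻¹' V) := by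
  have hd : ∀ i, ∀ x ∈ Φ.source ∩ Φ ⁻¹' V,
      diff I (f i ∘ Φ) x = (diff J (f i) (Φ x)).comp (mfderiv I J Φ x) := fun i x hx =>
    diff_comp hx.1 (mdifferentiableAt_of_contMDiffOn (hf.smooth i) hV hx.2)
  refine ⟨fun i => (hf.smooth i).comp (Φ.contMDiffOn.mono inter_subset_left) fun x hx => hx.2,
    fun x hx => ?_, fun x hx u => ?_⟩
  · simp only [hd _ x hx]
    exact linearIndependent_comp_clm (E := E) (F := F) (hf.independent (Φ x) hx.2)
      (mfderiv I J Φ x) (mfderivEquiv Φ hx.1).surjective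
  · rw [← h.mem_distribution_iff hx.1, hf.tangent _ hx.2]
    simp only [hd _ x hx]
    rfl

end Transport

end SplitSystem

end

open scoped Manifold ContDiff Topology

noncomputable section

namespace SplitSystem

open Set Filter

/-! ### The induced structure on a graph over the Poisson factor -/

section Graph

/-- With σ a right inverse of A, every B near A has B ∘ σ near the identity of the
finite-dimensional F, hence bijective. -/
lemma isOpen_surjective {E F : Type*} [NormedAddCommGroup E] [NormedSpace ℝ E]
    [NormedAddCommGroup F] [NormedSpace ℝ F] [FiniteDimensional ℝ F] :
    IsOpen {A : E →L[ℝ] F | Function.Surjective A} := by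
  refine isOpen_iff_mem_nhds.2 fun A (hA : Function.Surjective A) => ?_
  obtain ⟨s, hs⟩ := A.toLinearMap.exists_rightInverse_of_surjective (LinearMap.range_eq_top.2 hA)
  let σ : F →L[ℝ] E := LinearMap.toContinuousLinearMap s
  have hσ : A.comp σ = ContinuousLinearMap.id ℝ F :=
    ContinuousLinearMap.ext fun u => LinearMap.congr_fun hs u
  have hc : Continuous fun B : E →L[ℝ] F => B.comp σ := by fun_prop
  have ho := ContinuousLinearMap.isOpen_injective (𝕜 := ℝ) (E := F) (F := F)
  filter_upwards [(ho.preimage hc).mem_nhds (show Function.Injective (A.comp σ) by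
    rw [hσ]; exact Function.injective_id)] with B (hB : Function.Injective (B.comp σ)) u
  obtain ⟨w, hw⟩ := (LinearMap.injective_iff_surjective (f := (B.comp σ).toLinearMap)).1 hB u
  exact ⟨σ w, hw⟩

lemma exists_comp_eq_of_ker_le {E F : Type*} [NormedAddCommGroup E] [NormedSpace ℝ E]
    [NormedAddCommGroup F] [NormedSpace ℝ F] [FiniteDimensional ℝ F] (A : E →L[ℝ] F)
    (β : E →L[ℝ] ℝ) (h : ∀ u, A u = 0 → β u = 0) : ∃ l : F →L[ℝ] ℝ, l.comp A = β := by
  have hβ : β.toLinearMap ∈ A.toLinearMap.ker.dualAnnihilator :=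
    (Submodule.mem_dualAnnihilator _).2 fun u hu => h u hu
  rw [← LinearMap.range_dualMap_eq_dualAnnihilator_ker] at hβ
  obtain ⟨l, hl⟩ := hβ
  exact ⟨LinearMap.toContinuousLinearMap l, ContinuousLinearMap.ext fun u => LinearMap.congr_fun hl u⟩

variable {E₁ E₂ W V : Type} [NormedAddCommGroup E₁] [NormedSpace ℝ E₁] [FiniteDimensional ℝ E₁]
  [NormedAddCommGroup E₂] [NormedSpace ℝ E₂] [FiniteDimensional ℝ E₂]
  [NormedAddCommGroup W] [NormedSpace ℝ W] [FiniteDimensional ℝ W]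
  [NormedAddCommGroup V] [NormedSpace ℝ V] [FiniteDimensional ℝ V]
  {P₁ : E₁ → (E₁ →L[ℝ] ℝ) →L[ℝ] E₁} {P₂ : E₂ → (E₂ →L[ℝ] ℝ) →L[ℝ] E₂} {v : E₁} {b : E₂}

/-- The graph of a map into the symplectic factor that is compatible with the foliations carries
an induced bivector, isomorphic to that of the Poisson factor. -/
lemma exists_graph_induced (hP : IsPoissonGerm (blockSharp P₁ P₂) (v, b))
    (hP₁ : Function.Injective (P₁ v)) (hP₂ : P₂ b = 0) {p : E₁ → W} (hp : SmoothNear p v)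
    (hp' : Function.Surjective (fderiv ℝ p v))
    (hdim : Module.finrank ℝ E₁ = 2 * Module.finrank ℝ W)
    (hinv : ∀ᶠ x in 𝓝 v, ∀ l : W →L[ℝ] ℝ, fderiv ℝ p x (P₁ x (l.comp (fderiv ℝ p x))) = 0)
    {k : E₂ → E₁} (hk : SmoothNear k b) (hkb : k b = v) {g : E₂ → V} (hg : SmoothNear g b)
    (hgg : ∀ᶠ y in 𝓝 b, ∀ l : V →L[ℝ] ℝ, fderiv ℝ g y (P₂ y (l.comp (fderiv ℝ g y))) = 0)
    (hkg : ∀ᶠ y in 𝓝 b, ∀ w, fderiv ℝ g y w = 0 → fderiv ℝ p (k y) (fderiv ℝ k y w) = 0) :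
    ∃ ψ : E₂ → E₂, SmoothNear ψ b ∧ ψ b = b ∧ Function.Injective (fderiv ℝ ψ b) ∧
      (∀ᶠ y in 𝓝 b, ∀ u, fderiv ℝ g y u = 0 → fderiv ℝ g (ψ y) (fderiv ℝ ψ y u) = 0) ∧
      ∀ᶠ y in 𝓝 b, ∀ (β c : E₂ →L[ℝ] ℝ) (w : E₂), c.comp (fderiv ℝ ψ y) = β →
        fderiv ℝ ψ y w = P₂ (ψ y) c → ∃ α : E₁ × E₂ →L[ℝ] ℝ,
          α.comp ((fderiv ℝ k y).prod (ContinuousLinearMap.id ℝ E₂)) = β ∧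
          (fderiv ℝ k y w, w) = blockSharp P₁ P₂ (k y, y) α := by
  subst hkb
  have hkc : ContinuousAt k b := hk.contDiffAt.continuousAt
  -- The map h = p ∘ k measures how far the graph is from lying in one fibre of p.
  have hh : SmoothNear (p ∘ k) b := SmoothNear.comp (f := k) (g := p) hp hk
  have hdh : ∀ᶠ y in 𝓝 b, fderiv ℝ (p ∘ k) y = (fderiv ℝ p (k y)).comp (fderiv ℝ k y) := by
    filter_upwards [hkc.eventually hp.differentiableAt, hk.differentiableAt] with y h₁ h₂
    exact fderiv_comp y h₁ h₂
  -- dh vanishes on ker dg, so it factors through dg; involution of g therefore yields involution of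
  -- h with g and with itself.
  have hch : ∀ᶠ y in 𝓝 b, ∀ l : W →L[ℝ] ℝ, ∃ l' : V →L[ℝ] ℝ,
      l.comp (fderiv ℝ (p ∘ k) y) = l'.comp (fderiv ℝ g y) := by
    filter_upwards [hdh, hkg] with y h₁ h₂ l
    obtain ⟨l', hl'⟩ := exists_comp_eq_of_ker_le (fderiv ℝ g y) (l.comp (fderiv ℝ (p ∘ k) y))
      fun u hu => by
        rw [h₁, ContinuousLinearMap.comp_apply, ContinuousLinearMap.comp_apply, h₂ u hu, map_zero]
    exact ⟨l', hl'.symm⟩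
  have hgh : ∀ᶠ y in 𝓝 b, ∀ l : W →L[ℝ] ℝ,
      fderiv ℝ g y (P₂ y (l.comp (fderiv ℝ (p ∘ k) y))) = 0 := by
    filter_upwards [hch, hgg] with y h₁ h₂ l
    obtain ⟨l', hl'⟩ := h₁ l
    rw [hl', h₂]
  have hhh : ∀ᶠ y in 𝓝 b, ∀ l : W →L[ℝ] ℝ,
      fderiv ℝ (p ∘ k) y (P₂ y (l.comp (fderiv ℝ (p ∘ k) y))) = 0 := by
    filter_upwards [hdh, hkg, hgh] with y h₁ h₂ h₃ l
    exact (congrArg (fun A : E₂ →L[ℝ] W => A (P₂ y (l.comp (fderiv ℝ (p ∘ k) y)))) h₁).trans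
      (h₂ _ (h₃ l))
  obtain ⟨Θ, hΘ, hΘ₀, hΘi, hΘP, hΘp, hΘg⟩ :=
    exists_straightening hP hP₁ hp hp' hdim hinv hh hhh hg hgh
  let j : E₂ → E₁ × E₂ := fun y => (k y, y)
  have hj : SmoothNear j b := hk.mono fun y hy => hy.prodMk contDiffAt_id
  have hjt : Tendsto j (𝓝 b) (𝓝 (k b, b)) := hj.contDiffAt.continuousAt
  have hJ : ∀ᶠ y in 𝓝 b, HasFDerivAt j
      ((fderiv ℝ k y).prod (ContinuousLinearMap.id ℝ E₂)) y := by
    filter_upwards [hk.differentiableAt] with y hy using hy.hasFDerivAt.prodMk (hasFDerivAt_id y)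
  -- On the graph p ∘ Θ is the constant h(b), so the image of the graph differs from {v} × E₂ only
  -- within a fibre of p; ψ records its position in E₂.
  let ψ : E₂ → E₂ := fun y => (Θ (j y)).2
  have hψ : SmoothNear ψ b := by
    filter_upwards [SmoothNear.comp (f := j) (g := Θ) hΘ hj] with y hy using contDiffAt_snd.comp y hy
  have hΘd : ∀ᶠ y in 𝓝 b, HasFDerivAt Θ (fderiv ℝ Θ (j y)) (j y) :=
    (hjt.eventually hΘ.differentiableAt).mono fun y hy => hy.hasFDerivAt
  have hψd : ∀ᶠ y in 𝓝 b, ∀ u,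
      fderiv ℝ ψ y u = (fderiv ℝ Θ (j y) (fderiv ℝ k y u, u)).2 := by
    filter_upwards [hJ, hΘd] with y h₁ h₂ u
    have : HasFDerivAt ψ _ y := hasFDerivAt_snd.comp y (h₂.comp y h₁)
    rw [this.fderiv]
    rfl
  have hψb : ψ b = b := congrArg Prod.snd hΘ₀
  have hΘt : Tendsto (fun y => Θ (j y)) (𝓝 b) (𝓝 (k b, b)) := by
    have := (hΘ.contDiffAt.continuousAt.tendsto.comp hjt)
    rwa [hΘ₀] at this
  have hΘ₁ : Tendsto (fun y => (Θ (j y)).1) (𝓝 b) (𝓝 (k b)) :=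
    (continuous_fst.tendsto (k b, b)).comp hΘt
  have hψt : Tendsto ψ (𝓝 b) (𝓝 b) := (continuous_snd.tendsto (k b, b)).comp hΘt
  have hP₁c : ContinuousAt P₁ (k b) := hP.fst.smooth.contDiffAt.continuousAt
  have hP₁i : ∀ᶠ x in 𝓝 (k b), Function.Injective (P₁ x) :=
    hP₁c.eventually ((ContinuousLinearMap.isOpen_injective (𝕜 := ℝ)).mem_nhds hP₁)
  have hpo : ∀ᶠ x in 𝓝 (k b), Function.Surjective (fderiv ℝ p x) :=
    hp.fderiv.contDiffAt.continuousAt.eventually (isOpen_surjective.mem_nhds hp')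
  have hsurj : ∀ x, Function.Injective (P₁ x) → Function.Surjective (P₁ x) := fun x hx =>
    (LinearMap.injective_iff_surjective_of_finrank_eq_finrank (f := (P₁ x).toLinearMap)
      (finrank_dual E₁)).1 hx
  have hΘi' : ∀ᶠ z in 𝓝 (k b, b), Function.Injective (fderiv ℝ Θ z) :=
    hΘ.fderiv.contDiffAt.continuousAt.eventually
      ((ContinuousLinearMap.isOpen_injective (𝕜 := ℝ)).mem_nhds hΘi)
  refine ⟨ψ, hψ, hψb, ?_, ?_, ?_⟩
  -- If dψ u = 0, the image of (dk u, u) under dΘ lies in E₁ × 0 and is the ♯ of a covector. As Θ is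
  -- Poisson, (dk u, u) is itself the ♯ of a covector at the base point, and its E₂-component
  -- vanishes because P₂ b = 0.
  · rw [injective_iff_map_eq_zero]
    intro u hu
    rw [hψd.self_of_nhds] at hu
    have hΘb := hΘP.self_of_nhds
    rw [hΘ₀] at hΘb
    obtain ⟨a, ha⟩ := hsurj _ hP₁ (fderiv ℝ Θ (k b, b) (fderiv ℝ k b u, u)).1
    have h₁ := hΘb (a.comp (ContinuousLinearMap.fst ℝ E₁ E₂))
    rw [blockSharp_comp_fst, ha] at h₁
    have h₂ := hΘi (h₁.trans (Prod.ext rfl hu.symm))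
    rw [blockSharp_apply] at h₂
    have h₃ := congrArg Prod.snd h₂
    simp only [hP₂, zero_apply] at h₃
    exact h₃.symm
  · have hgΘ : ∀ᶠ y in 𝓝 b, (fun y => g (ψ y)) =ᶠ[𝓝 y] g :=
      (hjt.eventually hΘg).eventually_nhds
    filter_upwards [hgΘ, hψ.differentiableAt, hψt.eventually hg.differentiableAt] with y h₁ h₂ h₃ u hu
    have := fderiv_comp y h₃ h₂
    have h₄ : fderiv ℝ (g ∘ ψ) y = fderiv ℝ g y := h₁.fderiv_eq
    rw [← ContinuousLinearMap.comp_apply, ← this, h₄, hu]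
  · have hpΘ : ∀ᶠ y in 𝓝 b, (fun z => p (Θ z).1) =ᶠ[𝓝 (j y)]
        fun z => p z.1 - ((p ∘ k) z.2 - (p ∘ k) b) := hjt.eventually hΘp.eventually_nhds
    filter_upwards [hpΘ, hΘd, hψd, hdh, hk.differentiableAt, hh.differentiableAt,
      hkc.eventually hp.differentiableAt, hΘ₁.eventually hp.differentiableAt,
      hΘ₁.eventually hP₁i, hΘ₁.eventually hpo, hΘ₁.eventually hinv, hjt.eventually hΘi',
      hjt.eventually hΘP] with y e₁ e₂ e₃ e₄ e₅ e₆ e₇ e₈ e₉ e₁₀ e₁₁ e₁₂ e₁₃ β c w hc hw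
    -- Infinitesimal form of the constancy of p along the straightened graph; this is the isotropy
    -- needed in `exists_covector_of_isotropic`.
    have hfJ : ∀ w, fderiv ℝ p (Θ (j y)).1 (fderiv ℝ Θ (j y) (fderiv ℝ k y w, w)).1 = 0 := by
      intro w
      have d₁ : HasFDerivAt (fun z => p (Θ z).1) _ (j y) :=
        e₈.hasFDerivAt.comp (j y) (hasFDerivAt_fst.comp (j y) e₂)
      have d₂ : HasFDerivAt (fun z : E₁ × E₂ => p z.1 - ((p ∘ k) z.2 - (p ∘ k) b)) _ (j y) :=
        (HasFDerivAt.comp (j y) (f := Prod.fst) e₇.hasFDerivAt hasFDerivAt_fst).sub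
          ((HasFDerivAt.comp (j y) (f := Prod.snd) (g := p ∘ k) e₆.hasFDerivAt
            hasFDerivAt_snd).sub_const _)
      have := DFunLike.congr_fun ((d₁.congr_of_eventuallyEq e₁.symm).unique d₂)
        (fderiv ℝ k y w, w)
      have h₅ : fderiv ℝ (p ∘ k) y w = fderiv ℝ p (k y) (fderiv ℝ k y w) := by rw [e₄]; rfl
      refine this.trans ?_
      change fderiv ℝ p (k y) (fderiv ℝ k y w) - fderiv ℝ (p ∘ k) y w = 0
      rw [h₅, sub_self]
    exact exists_covector_of_isotropic (A := fderiv ℝ Θ (j y)) (P := blockSharp P₁ P₂ (j y))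
      (P₁ := P₁ (Θ (j y)).1) (P₂ := P₂ (ψ y))
      (J := (fderiv ℝ k y).prod (ContinuousLinearMap.id ℝ E₂)) e₁₂ e₁₃ (hsurj _ e₉)
      (fun a u h₁ h₂ => apply_eq_zero_of_isotropic e₉ e₁₀ hdim e₁₁ h₁ h₂) hfJ
      (fun u => (congrArg c (e₃ u)).symm.trans (DFunLike.congr_fun hc u))
      ((e₃ w).symm.trans hw)

end Graph

/-! ### Poisson germs from brackets of linear functions -/

section Linear

variable {E : Type*} [NormedAddCommGroup E] [NormedSpace ℝ E] [FiniteDimensional ℝ E]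

lemma contDiffOn_of_dual {X : Type*} [NormedAddCommGroup X] [NormedSpace ℝ X] {f : X → E}
    {U : Set X} (h : ∀ β : E →L[ℝ] ℝ, ContDiffOn ℝ ∞ (fun x => β (f x)) U) :
    ContDiffOn ℝ ∞ f U := by
  let e := Module.finBasis ℝ E
  have hf : f = fun x => ∑ i, LinearMap.toContinuousLinearMap (e.coord i) (f x) • e i := by
    funext x
    exact (e.sum_repr (f x)).symm
  rw [hf]
  exact ContDiffOn.sum fun i _ => (h _).smul contDiffOn_const

/-- Linear functions have constant differentials, so their brackets are the matrix entries of P and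
their Jacobi identity contains only P and its first derivative. -/
lemma isPoissonGerm_of_linear {P : E → (E →L[ℝ] ℝ) →L[ℝ] E} {U : Set E} (hU : IsOpen U) {z₀ : E}
    (hz₀ : z₀ ∈ U) (hskew : ∀ z ∈ U, ∀ α β : E →L[ℝ] ℝ, β (P z α) = -α (P z β))
    (hsmooth : ∀ α β : E →L[ℝ] ℝ, ContDiffOn ℝ ∞ (fun z => β (P z α)) U)
    (hjac : ∀ z ∈ U, ∀ α β γ : E →L[ℝ] ℝ, fderiv ℝ (fun z => γ (P z β)) z (P z α)
      + fderiv ℝ (fun z => α (P z γ)) z (P z β) + fderiv ℝ (fun z => β (P z α)) z (P z γ) = 0) :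
    IsPoissonGerm P z₀ := by
  have hP : ContDiffOn ℝ ∞ P U := contDiffOn_clm_apply.2 fun α =>
    contDiffOn_of_dual fun β => hsmooth α β
  refine ⟨?_, ?_, ?_⟩
  · filter_upwards [hU.mem_nhds hz₀] with z hz using hP.contDiffAt (hU.mem_nhds hz)
  · filter_upwards [hU.mem_nhds hz₀] with z hz using hskew z hz
  · filter_upwards [hU.mem_nhds hz₀] with z hz α β γ
    have hd : DifferentiableAt ℝ P z := (hP.contDiffAt (hU.mem_nhds hz)).differentiableAt (by simp)
    have h : ∀ (α β : E →L[ℝ] ℝ) (u : E),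
        fderiv ℝ (fun z => β (P z α)) z u = β (fderiv ℝ P z u α) := fun α β u => by
      have : HasFDerivAt (fun z => β (P z α)) _ z :=
        β.hasFDerivAt.comp z (hd.hasFDerivAt.clm_apply (hasFDerivAt_const α z))
      rw [this.fderiv]
      simp
    rw [← h, ← h, ← h]
    exact hjac z hz α β γ

end Linear

end SplitSystem

end

open scoped Manifold ContDiff Topology

noncomputable section

namespace SplitSystem

open Set Filter

/-! ### Charts, inverse functions and products -/

section InverseFunction

variable {E : Type*} [NormedAddCommGroup E] [NormedSpace ℝ E]
  {T : Type*} [TopologicalSpace T] [ChartedSpace E T] [IsManifold 𝓘(ℝ, E) ∞ T]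
  {F : Type*} [NormedAddCommGroup F] [NormedSpace ℝ F]

/-- A chart as a partial diffeomorphism. -/
def chartDiffeo (t : T) : PartialDiffeomorph 𝓘(ℝ, E) 𝓘(ℝ, E) T E ∞ where
  toPartialEquiv := (chartAt E t).toPartialEquiv
  open_source := (chartAt E t).open_source
  open_target := (chartAt E t).open_target
  contMDiffOn_toFun := contMDiffOn_chart
  contMDiffOn_invFun := contMDiffOn_chart_symm

lemma mem_chartDiffeo_source (t : T) : t ∈ (chartDiffeo (E := E) t).source := mem_chart_source E t

/-- An open partial homeomorphism of vector spaces, smooth with smooth inverse, as a partial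
diffeomorphism. -/
def diffeoOfContDiffOn (e : OpenPartialHomeomorph E F) (h : ContDiffOn ℝ ∞ e e.source)
    (h' : ContDiffOn ℝ ∞ e.symm e.target) : PartialDiffeomorph 𝓘(ℝ, E) 𝓘(ℝ, F) E F ∞ where
  toPartialEquiv := e.toPartialEquiv
  open_source := e.open_source
  open_target := e.open_target
  contMDiffOn_toFun := h.contMDiffOn
  contMDiffOn_invFun := h'.contMDiffOn

lemma smoothNear_of_contMDiffOn {f : E → F} {U : Set E} (hU : IsOpen U)
    (hf : ContMDiffOn 𝓘(ℝ, E) 𝓘(ℝ, F) ∞ f U) {x : E} (hx : x ∈ U) : SmoothNear f x := by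
  filter_upwards [hU.mem_nhds hx] with y hy
  exact hf.contDiffOn.contDiffAt (hU.mem_nhds hy)

variable [FiniteDimensional ℝ E]

/-- The inverse function theorem for maps from a manifold to a vector space. -/
lemma exists_partialDiffeomorph {f : T → F} {U : Set T} (hU : IsOpen U) {t : T} (ht : t ∈ U)
    (hf : ContMDiffOn 𝓘(ℝ, E) 𝓘(ℝ, F) ∞ f U)
    (hf' : Function.Bijective (mfderiv 𝓘(ℝ, E) 𝓘(ℝ, F) f t)) :
    ∃ Ψ : PartialDiffeomorph 𝓘(ℝ, E) 𝓘(ℝ, F) T F ∞, t ∈ Ψ.source ∧ Ψ.source ⊆ U ∧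
      ∀ x ∈ Ψ.source, Ψ x = f x := by
  let φ := chartDiffeo (E := E) t
  have htφ : t ∈ φ.source := mem_chartDiffeo_source t
  have hs : φ.symm (φ t) = t := symm_apply_apply φ htφ
  have hO : IsOpen (φ.target ∩ φ.symm ⁻¹' U) :=
    φ.symm.contMDiffOn.continuousOn.isOpen_inter_preimage φ.open_target hU
  have htO : φ t ∈ φ.target ∩ φ.symm ⁻¹' U :=
    ⟨apply_mem_target φ htφ, by rw [mem_preimage, hs]; exact ht⟩
  have hc : ContMDiffOn 𝓘(ℝ, E) 𝓘(ℝ, F) ∞ (f ∘ φ.symm) (φ.target ∩ φ.symm ⁻¹' U) :=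
    hf.comp (φ.symm.contMDiffOn.mono inter_subset_left) fun y hy => hy.2
  have hd : fderiv ℝ (f ∘ φ.symm) (φ t)
      = (mfderiv 𝓘(ℝ, E) 𝓘(ℝ, F) f t).comp (mfderiv 𝓘(ℝ, E) 𝓘(ℝ, E) φ.symm (φ t)) := by
    rw [← mfderiv_eq_fderiv]
    have h := mfderiv_comp_of_eq (I := 𝓘(ℝ, E)) (I' := 𝓘(ℝ, E)) (I'' := 𝓘(ℝ, F)) (x := φ t)
      (mdifferentiableAt_of_contMDiffOn hf hU ht)
      (mdifferentiableAt_symm_of_mem φ (apply_mem_target φ htφ)) hs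
    have hm : ∀ x y : T, x = y → (mfderiv 𝓘(ℝ, E) 𝓘(ℝ, F) f x : E →L[ℝ] F)
        = mfderiv 𝓘(ℝ, E) 𝓘(ℝ, F) f y := by
      rintro x _ rfl
      rfl
    exact h.trans (congrArg (fun A : E →L[ℝ] F =>
      A.comp (mfderiv 𝓘(ℝ, E) 𝓘(ℝ, E) φ.symm (φ t) : E →L[ℝ] E)) (hm _ _ hs))
  have hb : Function.Bijective (fderiv ℝ (f ∘ φ.symm) (φ t)) := by
    rw [hd]
    exact hf'.comp (mfderivEquiv φ htφ).symm.bijective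
  obtain ⟨e, he, hef, he₁, he₂⟩ :=
    exists_openPartialHomeomorph (smoothNear_of_contMDiffOn hO hc htO) hb
  refine ⟨restrictOpen (φ.trans (diffeoOfContDiffOn e he₁ he₂)) hU, ⟨⟨htφ, he⟩, ht⟩,
    fun x hx => hx.2, fun x hx => ?_⟩
  change e (φ x) = f x
  rw [hef, Function.comp_apply, symm_apply_apply φ hx.1.1]

end InverseFunction

/-! ### Products of vector spaces: comparison of manifold and vector-space calculus. -/

section ProductModel

variable {E₁ E₂ F : Type*} [NormedAddCommGroup E₁] [NormedSpace ℝ E₁]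
  [NormedAddCommGroup E₂] [NormedSpace ℝ E₂] [NormedAddCommGroup F] [NormedSpace ℝ F]

/-- The product model and product atlas are those of the vector space E₁ × E₂ only after rewriting,
so the two notions of smoothness have to be matched explicitly. -/
lemma contMDiffOn_prodModel_iff {f : E₁ × E₂ → F} {U : Set (E₁ × E₂)} :
    ContMDiffOn (𝓘(ℝ, E₁).prod 𝓘(ℝ, E₂)) 𝓘(ℝ, F) ∞ f U ↔ ContDiffOn ℝ ∞ f U := by
  rw [← contMDiffOn_iff_contDiffOn, modelWithCornersSelf_prod, ← chartedSpaceSelf_prod]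

lemma mfderiv_prodModel (f : E₁ × E₂ → F) (z : E₁ × E₂) :
    (mfderiv (𝓘(ℝ, E₁).prod 𝓘(ℝ, E₂)) 𝓘(ℝ, F) f z : E₁ × E₂ →L[ℝ] F) = fderiv ℝ f z := by
  rw [← mfderiv_eq_fderiv, modelWithCornersSelf_prod, ← chartedSpaceSelf_prod]

variable [FiniteDimensional ℝ E₁] [FiniteDimensional ℝ E₂]

/-- A field of linear maps on a vector space as a function to the continuous linear maps. -/
def sharpCLM (π : SharpField 𝓘(ℝ, E₁) E₁) (x : E₁) : (E₁ →L[ℝ] ℝ) →L[ℝ] E₁ :=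
  LinearMap.toContinuousLinearMap (show (E₁ →L[ℝ] ℝ) →ₗ[ℝ] E₁ from π x)

variable {π₁ : SharpField 𝓘(ℝ, E₁) E₁} {π₂ : SharpField 𝓘(ℝ, E₂) E₂}

lemma prodSharp_eq_blockSharp (z : E₁ × E₂) (α : E₁ × E₂ →L[ℝ] ℝ) :
    (prodSharp π₁ π₂ z α : E₁ × E₂) = blockSharp (sharpCLM π₁) (sharpCLM π₂) z α := by
  refine Prod.ext ?_ ?_
  · exact add_zero _
  · exact zero_add _

lemma bracket_prodSharp (f g : E₁ × E₂ → ℝ) (z : E₁ × E₂) :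
    bracket (prodSharp π₁ π₂) f g z
      = fderiv ℝ g z (blockSharp (sharpCLM π₁) (sharpCLM π₂) z (fderiv ℝ f z)) := by
  rw [← prodSharp_eq_blockSharp, ← mfderiv_prodModel, ← mfderiv_prodModel]
  rfl

lemma isPoissonGerm_of_isPoissonOn {U : Set (E₁ × E₂)} (hU : IsOpen U)
    (h : IsPoissonOn (prodSharp π₁ π₂) U) {z₀ : E₁ × E₂} (hz₀ : z₀ ∈ U) :
    IsPoissonGerm (blockSharp (sharpCLM π₁) (sharpCLM π₂)) z₀ := by
  have hlin : ∀ α : E₁ × E₂ →L[ℝ] ℝ,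
      ContMDiffOn (𝓘(ℝ, E₁).prod 𝓘(ℝ, E₂)) 𝓘(ℝ, ℝ) ∞ α U := fun α =>
    contMDiffOn_prodModel_iff.2 α.contDiff.contDiffOn
  have hb : ∀ α β : E₁ × E₂ →L[ℝ] ℝ, bracket (prodSharp π₁ π₂) α β
      = fun z => β (blockSharp (sharpCLM π₁) (sharpCLM π₂) z α) := fun α β => by
    funext z
    rw [bracket_prodSharp, α.fderiv, β.fderiv]
  refine isPoissonGerm_of_linear hU hz₀ (fun z hz α β => ?_) (fun α β => ?_) fun z hz α β γ => ?_
  · rw [← prodSharp_eq_blockSharp, ← prodSharp_eq_blockSharp]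
    exact h.skew z hz α β
  · rw [← hb]
    exact contMDiffOn_prodModel_iff.1 (h.smooth U hU subset_rfl α β (hlin α) (hlin β))
  · have := h.jacobi U hU subset_rfl α β γ (hlin α) (hlin β) (hlin γ) z hz
    rw [bracket_prodSharp, bracket_prodSharp, bracket_prodSharp, α.fderiv, β.fderiv, γ.fderiv,
      hb, hb, hb] at this
    exact this

end ProductModel

end SplitSystem

end

open scoped Manifold ContDiff Topology

noncomputable section

namespace SplitSystem

open Set Filter

/-! ### Split charts -/

/-- Passage from pairwise involution of scalar functions to the coordinate-free form used for
vector-valued maps: l ∘ dq is a combination of the dq_i. -/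
lemma isotropic_of_brackets {E : Type*} [NormedAddCommGroup E] [NormedSpace ℝ E] {m : ℕ}
    {q : Fin m → E → ℝ} {x : E} (hd : ∀ i, DifferentiableAt ℝ (q i) x)
    {S : (E →L[ℝ] ℝ) →L[ℝ] E} (h : ∀ i j, fderiv ℝ (q j) x (S (fderiv ℝ (q i) x)) = 0)
    (l : (Fin m → ℝ) →L[ℝ] ℝ) :
    fderiv ℝ (fun x i => q i x) x (S (l.comp (fderiv ℝ (fun x i => q i x) x))) = 0 := by
  have hl : l.comp (fderiv ℝ (fun x i => q i x) x)
      = ∑ i, l (Pi.single i 1) • fderiv ℝ (q i) x := by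
    ext u
    rw [fderiv_pi hd, ContinuousLinearMap.comp_apply,
      ← Finset.univ_sum_single (ContinuousLinearMap.pi (fun i => fderiv ℝ (q i) x) u), map_sum,
      sum_apply]
    refine Finset.sum_congr rfl fun i _ => ?_
    rw [smul_apply, ContinuousLinearMap.pi_apply, smul_eq_mul, mul_comm,
      ← smul_eq_mul, ← map_smul, ← Pi.single_smul', smul_eq_mul, mul_one]
  rw [hl, fderiv_pi hd]
  ext j
  simp [map_sum, h]

/-- Independence of the l_i says that the dual of the map they form is injective, hence the map is
surjective; rank-nullity gives the dimension. -/
lemma finrank_of_definesOn {E : Type*} [NormedAddCommGroup E] [NormedSpace ℝ E]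
    [FiniteDimensional ℝ E] {m k : ℕ} {l : Fin m → E →L[ℝ] ℝ} (hl : LinearIndependent ℝ l)
    {D : Submodule ℝ E} (hD : ∀ u, u ∈ D ↔ ∀ i, l i u = 0) (hk : k + m = Module.finrank ℝ E) :
    Function.Surjective (ContinuousLinearMap.pi l) ∧ Module.finrank ℝ D = k := by
  have hs : Function.Surjective (ContinuousLinearMap.pi l) := by
    suffices h : Function.Injective (ContinuousLinearMap.pi l).toLinearMap.dualMap from
      LinearMap.dualMap_injective_iff.1 h
    rw [injective_iff_map_eq_zero]
    intro φ hφ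
    have h₁ : ∑ i, φ (Pi.single i 1) • l i = 0 := by
      ext u
      rw [sum_apply]
      refine Eq.trans ?_ (LinearMap.congr_fun hφ u)
      change _ = φ (fun i => l i u)
      rw [← Finset.univ_sum_single (fun i => l i u), map_sum]
      refine Finset.sum_congr rfl fun i _ => ?_
      rw [smul_apply, smul_eq_mul, mul_comm, ← smul_eq_mul, ← map_smul, ← Pi.single_smul',
        smul_eq_mul, mul_one]
    have h₂ := Fintype.linearIndependent_iff.1 hl _ h₁
    refine LinearMap.pi_ext' fun i => LinearMap.ext_ring ?_
    exact h₂ i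
  refine ⟨hs, ?_⟩
  have hD' : D = (ContinuousLinearMap.pi l).toLinearMap.ker := by
    ext u
    rw [hD, LinearMap.mem_ker]
    exact funext_iff.symm
  have h := (ContinuousLinearMap.pi l).toLinearMap.finrank_range_add_finrank_ker
  rw [LinearMap.range_eq_top.2 hs, finrank_top, Module.finrank_fin_fun, ← hD'] at h
  omega

lemma mem_prodDistribution {E₁ E₂ : Type*} [NormedAddCommGroup E₁] [NormedSpace ℝ E₁]
    [NormedAddCommGroup E₂] [NormedSpace ℝ E₂] {D₁ : Distribution 𝓘(ℝ, E₁) E₁}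
    {D₂ : Distribution 𝓘(ℝ, E₂) E₂} (z : E₁ × E₂) (a : E₁) (c : E₂) :
    ((a, c) : E₁ × E₂) ∈ (prodDistribution D₁ D₂ z : Submodule ℝ (E₁ × E₂))
      ↔ a ∈ (D₁ z.1 : Submodule ℝ E₁) ∧ c ∈ (D₂ z.2 : Submodule ℝ E₂) := by
  constructor
  · intro h
    obtain ⟨_, ⟨a', ha', rfl⟩, _, ⟨c', hc', rfl⟩, h⟩ := Submodule.mem_sup.1
      (show _ ∈ (D₁ z.1).map (inlT (I := 𝓘(ℝ, E₁)) (J := 𝓘(ℝ, E₂)) z).toLinearMap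
        ⊔ (D₂ z.2).map (inrT (I := 𝓘(ℝ, E₁)) (J := 𝓘(ℝ, E₂)) z).toLinearMap from h)
    have h₁ : a' + 0 = a := congrArg Prod.fst h
    have h₂ : 0 + c' = c := congrArg Prod.snd h
    rw [add_zero] at h₁
    rw [zero_add] at h₂
    exact ⟨h₁ ▸ ha', h₂ ▸ hc'⟩
  · rintro ⟨ha, hc⟩
    change _ ∈ (D₁ z.1).map (inlT (I := 𝓘(ℝ, E₁)) (J := 𝓘(ℝ, E₂)) z).toLinearMap
        ⊔ (D₂ z.2).map (inrT (I := 𝓘(ℝ, E₁)) (J := 𝓘(ℝ, E₂)) z).toLinearMap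
    refine Submodule.mem_sup.2 ⟨_, ⟨a, ha, rfl⟩, _, ⟨c, hc, rfl⟩, ?_⟩
    exact Prod.ext (add_zero a) (zero_add c)

/-! ### Split charts and the functions defining the two factor foliations. -/

section SplitChart

variable {EM : Type*} [NormedAddCommGroup EM] [NormedSpace ℝ EM]
  {M : Type*} [TopologicalSpace M] [ChartedSpace EM M]
  {E₁ E₂ : Type} [NormedAddCommGroup E₁] [NormedSpace ℝ E₁] [FiniteDimensional ℝ E₁]
  [NormedAddCommGroup E₂] [NormedSpace ℝ E₂] [FiniteDimensional ℝ E₂]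

/-- `Φ` identifies a neighbourhood of `s` with a product of a symplectic and a Poisson vector
space, in such a way that the Poisson structure of the second factor vanishes at the image of
`s`. -/
structure IsSplitChart (Φ : PartialDiffeomorph 𝓘(ℝ, EM) (𝓘(ℝ, E₁).prod 𝓘(ℝ, E₂)) M (E₁ × E₂) ∞)
    (π : SharpField 𝓘(ℝ, EM) M) (D : Distribution 𝓘(ℝ, EM) M)
    (π₁ : SharpField 𝓘(ℝ, E₁) E₁) (D₁ : Distribution 𝓘(ℝ, E₁) E₁)
    (π₂ : SharpField 𝓘(ℝ, E₂) E₂) (D₂ : Distribution 𝓘(ℝ, E₂) E₂) (U : Set E₂) (k : ℕ)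
    (s : M) : Prop where
  mem : s ∈ Φ.source
  snd_mem : ∀ z ∈ Φ.target, z.2 ∈ U
  iso : IsSystemIso Φ π D (prodSharp π₁ π₂) (prodDistribution D₁ D₂)
  injective : Function.Injective (sharpCLM π₁ (Φ s).1)
  vanish : sharpCLM π₂ (Φ s).2 = 0
  finrank_eq : Module.finrank ℝ E₁ = 2 * k
  finrank_distribution : Module.finrank ℝ (D₁ (Φ s).1 : Submodule ℝ E₁) = k

variable {Φ : PartialDiffeomorph 𝓘(ℝ, EM) (𝓘(ℝ, E₁).prod 𝓘(ℝ, E₂)) M (E₁ × E₂) ∞}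
  {π : SharpField 𝓘(ℝ, EM) M} {D : Distribution 𝓘(ℝ, EM) M}
  {π₁ : SharpField 𝓘(ℝ, E₁) E₁} {D₁ : Distribution 𝓘(ℝ, E₁) E₁}
  {π₂ : SharpField 𝓘(ℝ, E₂) E₂} {D₂ : Distribution 𝓘(ℝ, E₂) E₂} {U : Set E₂} {k r r₂ : ℕ}
  {s : M}

lemma IsSplitChart.surjective (h : IsSplitChart Φ π D π₁ D₁ π₂ D₂ U k s) :
    Function.Surjective (sharpCLM π₁ (Φ s).1) :=
  (LinearMap.injective_iff_surjective_of_finrank_eq_finrank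
    (f := (sharpCLM π₁ (Φ s).1).toLinearMap) (finrank_dual E₁)).1 h.injective

/-- Functions in involution that define the foliation of the symplectic factor at a point. -/
lemma IsSplitChart.exists_fst_functions (h : IsSplitChart Φ π D π₁ D₁ π₂ D₂ U k s)
    (hint : IsIntegrableOn π D univ r) :
    ∃ p : E₁ → (Fin k → ℝ), SmoothNear p (Φ s).1 ∧ Function.Surjective (fderiv ℝ p (Φ s).1) ∧
      (∀ᶠ x in 𝓝 (Φ s).1, ∀ l : (Fin k → ℝ) →L[ℝ] ℝ,
        fderiv ℝ p x (sharpCLM π₁ x (l.comp (fderiv ℝ p x))) = 0) ∧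
      ∀ᶠ x in 𝓝 (Φ s).1, ∀ a ∈ (D₁ x : Submodule ℝ E₁), fderiv ℝ p x a = 0 := by
  obtain ⟨V, hV, hsV, -, m, f, hm, hf, hff⟩ := hint.foliation s (mem_univ s)
  set b := (Φ s).2 with hb
  set v := (Φ s).1 with hv
  let O : Set (E₁ × E₂) := Φ.target ∩ Φ.symm ⁻¹' V
  have hO : IsOpen O := Φ.symm.contMDiffOn.continuousOn.isOpen_inter_preimage Φ.open_target hV
  have hzO : (v, b) ∈ O := by
    refine ⟨apply_mem_target Φ h.mem, ?_⟩
    change Φ.symm (Φ s) ∈ V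
    rwa [symm_apply_apply Φ h.mem]
  let F : Fin m → E₁ × E₂ → ℝ := fun i => f i ∘ Φ.symm
  have hF : DefinesOn F (prodDistribution D₁ D₂) O := h.iso.symm.definesOn hV hf
  have hFc : ∀ i, ContDiffOn ℝ ∞ (F i) O := fun i => contMDiffOn_prodModel_iff.1 (hF.smooth i)
  have hFd : ∀ i, ∀ z ∈ O, HasFDerivAt (F i) (fderiv ℝ (F i) z) z := fun i z hz =>
    (((hFc i).contDiffAt (hO.mem_nhds hz)).differentiableAt (by simp)).hasFDerivAt
  have hFt : ∀ z ∈ O, ∀ u : E₁ × E₂, u ∈ (prodDistribution D₁ D₂ z : Submodule ℝ (E₁ × E₂)) ↔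
      ∀ i, fderiv ℝ (F i) z u = 0 := fun z hz u => by
    refine (hF.tangent z hz u).trans (forall_congr' fun i => ?_)
    rw [← mfderiv_prodModel]
    rfl
  have hFF : ∀ i j, ∀ z ∈ O, bracket (prodSharp π₁ π₂) (F i) (F j) z = 0 := fun i j z hz => by
    have h₁ := h.iso.symm.bracket (f := f i) (g := f j) hz.1
      (mdifferentiableAt_of_contMDiffOn (hf.smooth i) hV hz.2)
      (mdifferentiableAt_of_contMDiffOn (hf.smooth j) hV hz.2)
    rw [← h₁]
    exact hff i j _ hz.2
  -- Restricting the defining functions of the product foliation to E₁ × {b} preserves involution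
  -- because the second bivector vanishes at b. There are more of them than needed, so k
  -- combinations are selected below.
  let q : Fin m → E₁ → ℝ := fun i x => F i (x, b)
  let O₁ : Set E₁ := (fun x => (x, b)) ⁻¹' O
  have hO₁ : IsOpen O₁ := hO.preimage (Continuous.prodMk_left b)
  have hvO₁ : v ∈ O₁ := hzO
  have hqd : ∀ i, ∀ x ∈ O₁, HasFDerivAt (q i)
      ((fderiv ℝ (F i) (x, b)).comp (ContinuousLinearMap.inl ℝ E₁ E₂)) x := fun i x hx =>
    HasFDerivAt.comp (g := F i) (f := fun x => (x, b)) x (hFd i _ hx) (hasFDerivAt_prodMk_left x b)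
  have hqc : ∀ i, SmoothNear (q i) v := fun i => by
    filter_upwards [hO₁.mem_nhds hvO₁] with x hx
    exact ContDiffAt.comp (g := F i) (f := fun x => (x, b)) x ((hFc i).contDiffAt (hO.mem_nhds hx))
      (contDiffAt_id.prodMk contDiffAt_const)
  have hqq : ∀ x ∈ O₁, ∀ i j,
      fderiv ℝ (q j) x (sharpCLM π₁ x (fderiv ℝ (q i) x)) = 0 := fun x hx i j => by
    have h₁ := hFF i j (x, b) hx
    rw [bracket_prodSharp, blockSharp_apply] at h₁
    rw [h.vanish] at h₁
    rw [(hqd i x hx).fderiv, (hqd j x hx).fderiv]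
    exact h₁
  let Q : E₁ → Fin m → ℝ := fun x i => q i x
  have hQd : ∀ x ∈ O₁, fderiv ℝ Q x = ContinuousLinearMap.pi fun i => fderiv ℝ (q i) x :=
    fun x hx => fderiv_pi fun i => (hqd i x hx).differentiableAt
  have hQD : ∀ x ∈ O₁, ∀ a : E₁, a ∈ (D₁ x : Submodule ℝ E₁) → fderiv ℝ Q x a = 0 :=
    fun x hx a ha => by
      rw [hQd x hx]
      ext i
      rw [ContinuousLinearMap.pi_apply, (hqd i x hx).fderiv]
      exact (hFt (x, b) hx (a, 0)).1 ((mem_prodDistribution _ _ _).2 ⟨ha, zero_mem _⟩) i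
  have hQv : (fderiv ℝ Q v).toLinearMap.ker = (D₁ v : Submodule ℝ E₁) := by
    ext a
    refine ⟨fun ha => ?_, fun ha => hQD v hvO₁ a ha⟩
    refine ((mem_prodDistribution (D₂ := D₂) (v, b) a 0).1 ((hFt (v, b) hvO₁ (a, 0)).2
      fun i => ?_)).1
    have h₁ : fderiv ℝ Q v a = 0 := ha
    have h₂ := congrFun h₁ i
    rw [hQd v hvO₁, ContinuousLinearMap.pi_apply, (hqd i v hvO₁).fderiv] at h₂
    exact h₂
  -- The kernel of dQ at v is the foliation of E₁, of dimension k in a space of dimension 2k. A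
  -- linear map c carrying the range isomorphically onto ℝᵏ then gives p = c ∘ Q with surjective
  -- differential at v.
  have hrk : Module.finrank ℝ (fderiv ℝ Q v).toLinearMap.range = k := by
    have h₁ := (fderiv ℝ Q v).toLinearMap.finrank_range_add_finrank_ker
    have h₂ : Module.finrank ℝ (fderiv ℝ Q v).toLinearMap.ker = k := by
      rw [hQv]
      exact h.finrank_distribution
    have h₃ := h.finrank_eq
    omega
  obtain ⟨C, hC⟩ := LinearMap.exists_extend
    (LinearEquiv.ofFinrankEq (fderiv ℝ Q v).toLinearMap.range (Fin k → ℝ)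
      (by rw [hrk, Module.finrank_fin_fun])).toLinearMap
  let c : (Fin m → ℝ) →L[ℝ] (Fin k → ℝ) := LinearMap.toContinuousLinearMap C
  have hQc : SmoothNear Q v := (eventually_all.2 hqc).mono fun x hx => contDiffAt_pi.2 hx
  have hpd : ∀ x ∈ O₁, fderiv ℝ (fun x => c (Q x)) x = c.comp (fderiv ℝ Q x) := fun x hx =>
    (c.hasFDerivAt.comp x (differentiableAt_pi.2
      fun i => (hqd i x hx).differentiableAt).hasFDerivAt).fderiv
  refine ⟨fun x => c (Q x), hQc.mono fun x hx => c.contDiff.contDiffAt.comp x hx, ?_, ?_, ?_⟩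
  · rw [hpd v hvO₁]
    intro w
    obtain ⟨⟨_, a, rfl⟩, ha⟩ := (LinearEquiv.ofFinrankEq (fderiv ℝ Q v).toLinearMap.range
      (Fin k → ℝ) (by rw [hrk, Module.finrank_fin_fun])).surjective w
    refine ⟨a, Eq.trans ?_ ha⟩
    exact LinearMap.congr_fun hC ⟨fderiv ℝ Q v a, a, rfl⟩
  · filter_upwards [hO₁.mem_nhds hvO₁] with x hx l
    rw [hpd x hx, ← ContinuousLinearMap.comp_assoc, ContinuousLinearMap.comp_apply,
      isotropic_of_brackets (fun i => (hqd i x hx).differentiableAt) (hqq x hx), map_zero]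
  · filter_upwards [hO₁.mem_nhds hvO₁] with x hx a ha
    rw [hpd x hx]
    exact (congrArg c (hQD x hx a ha)).trans (map_zero c)

/-- Functions in involution that define the foliation of an integrable system on a vector
space. -/
lemma exists_functions (h : IsIntegrableOn π₂ D₂ U r₂) {b : E₂} (hb : b ∈ U) :
    ∃ (m : ℕ) (g : E₂ → (Fin m → ℝ)), SmoothNear g b ∧
      (∀ᶠ y in 𝓝 b, ∀ l : (Fin m → ℝ) →L[ℝ] ℝ,
        fderiv ℝ g y (sharpCLM π₂ y (l.comp (fderiv ℝ g y))) = 0) ∧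
      (∀ᶠ y in 𝓝 b, ∀ w : E₂, w ∈ (D₂ y : Submodule ℝ E₂) ↔ fderiv ℝ g y w = 0) ∧
      ∀ᶠ y in 𝓝 b, Module.finrank ℝ (D₂ y : Submodule ℝ E₂) = r₂ := by
  obtain ⟨V, hV, hbV, -, m, g, hm, hg, hgg⟩ := h.foliation b hb
  have hd : ∀ i y, (diff 𝓘(ℝ, E₂) (g i) y : E₂ →L[ℝ] ℝ) = fderiv ℝ (g i) y :=
    fun i y => mfderiv_eq_fderiv
  have hgc : ∀ i, ∀ y ∈ V, ContDiffAt ℝ ∞ (g i) y := fun i y hy =>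
    (hg.smooth i).contDiffOn.contDiffAt (hV.mem_nhds hy)
  have hgd : ∀ y ∈ V, ∀ i, DifferentiableAt ℝ (g i) y := fun y hy i =>
    (hgc i y hy).differentiableAt (by simp)
  have hgt : ∀ y ∈ V, ∀ w : E₂, w ∈ (D₂ y : Submodule ℝ E₂) ↔ ∀ i, fderiv ℝ (g i) y w = 0 :=
    fun y hy w => by
      refine (hg.tangent y hy w).trans (forall_congr' fun i => ?_)
      rw [← hd]
      rfl
  refine ⟨m, fun y i => g i y, ?_, ?_, ?_, ?_⟩
  · filter_upwards [hV.mem_nhds hbV] with y hy using contDiffAt_pi.2 fun i => hgc i y hy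
  · filter_upwards [hV.mem_nhds hbV] with y hy l
    refine isotropic_of_brackets (hgd y hy) (fun i j => ?_) l
    rw [← hd, ← hd]
    exact hgg i j y hy
  · filter_upwards [hV.mem_nhds hbV] with y hy w
    rw [hgt y hy, fderiv_pi (hgd y hy)]
    exact funext_iff.symm
  · filter_upwards [hV.mem_nhds hbV] with y hy
    refine (finrank_of_definesOn (l := fun i => fderiv ℝ (g i) y) ?_ (hgt y hy) hm).2
    have := hg.independent y hy
    rwa [funext fun i => hd i y] at this

end SplitChart

end SplitSystem

end

open scoped Manifold ContDiff Topology

noncomputable section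

namespace SplitSystem

open Set Filter

/-! ### The structure induced on a transversal -/

section Transversal

variable {EM : Type*} [NormedAddCommGroup EM] [NormedSpace ℝ EM]
  {M : Type*} [TopologicalSpace M] [ChartedSpace EM M]
  {E₁ E₂ : Type} [NormedAddCommGroup E₁] [NormedSpace ℝ E₁] [FiniteDimensional ℝ E₁]
  [NormedAddCommGroup E₂] [NormedSpace ℝ E₂] [FiniteDimensional ℝ E₂]
  {Φ : PartialDiffeomorph 𝓘(ℝ, EM) (𝓘(ℝ, E₁).prod 𝓘(ℝ, E₂)) M (E₁ × E₂) ∞}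
  {π : SharpField 𝓘(ℝ, EM) M} {D : Distribution 𝓘(ℝ, EM) M}
  {π₁ : SharpField 𝓘(ℝ, E₁) E₁} {D₁ : Distribution 𝓘(ℝ, E₁) E₁}
  {π₂ : SharpField 𝓘(ℝ, E₂) E₂} {D₂ : Distribution 𝓘(ℝ, E₂) E₂} {U : Set E₂} {k r r₂ : ℕ}
  {s : M}
  {ET : Type*} [NormedAddCommGroup ET] [NormedSpace ℝ ET] [FiniteDimensional ℝ ET]
  {T : Type*} [TopologicalSpace T] [ChartedSpace ET T] [IsManifold 𝓘(ℝ, ET) ∞ T]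

lemma map_eq_of_finrank_eq {E F : Type*} [NormedAddCommGroup E] [NormedSpace ℝ E]
    [NormedAddCommGroup F] [NormedSpace ℝ F] [FiniteDimensional ℝ F] {A : E →L[ℝ] F}
    (hA : Function.Injective A) {D : Submodule ℝ E} {D' : Submodule ℝ F} (h : ∀ u ∈ D, A u ∈ D')
    (hr : Module.finrank ℝ D = Module.finrank ℝ D') : D.map A.toLinearMap = D' := by
  refine Submodule.eq_of_le_of_finrank_eq ?_ ?_
  · rintro _ ⟨u, hu, rfl⟩
    exact h u hu
  · rw [← hr]
    exact (LinearEquiv.finrank_eq (Submodule.equivMapOfInjective A.toLinearMap hA D)).symm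

/-- The structure that a split system induces on a compatible transversal is isomorphic to the
Poisson factor. -/
lemma IsSplitChart.exists_induced_iso (h : IsSplitChart Φ π D π₁ D₁ π₂ D₂ U k s)
    (hint : IsIntegrableOn π D univ r) (hU : IsOpen U) (h₂ : IsIntegrableOn π₂ D₂ U r₂)
    {i : T → M} {t : T}
    (hit : i t = s) {W : Set T} (hW : IsOpen W) (htW : t ∈ W)
    (hi : ContMDiffOn 𝓘(ℝ, ET) 𝓘(ℝ, EM) ∞ i W)
    (htr : ∀ u : ET, (mfderiv 𝓘(ℝ, ET) 𝓘(ℝ, EM) i t u : EM) ∈ (charSpace π (i t) : Submodule ℝ EM)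
      → u = 0)
    (hdim : Module.finrank ℝ ET = Module.finrank ℝ E₂)
    (hfin : ∀ x ∈ W,
      Module.finrank ℝ (inducedDistribution 𝓘(ℝ, ET) D i x : Submodule ℝ ET) = r₂) :
    ∃ Ψ : PartialDiffeomorph 𝓘(ℝ, ET) 𝓘(ℝ, E₂) T E₂ ∞, t ∈ Ψ.source ∧ Ψ.source ⊆ W ∧
      Ψ.target ⊆ U ∧ Ψ t = (Φ s).2 ∧ ∀ x ∈ Ψ.source,
        (inducedDistribution 𝓘(ℝ, ET) D i x).map (mfderiv 𝓘(ℝ, ET) 𝓘(ℝ, E₂) Ψ x).toLinearMap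
          = D₂ (Ψ x) ∧
        ∀ (β : TangentSpace 𝓘(ℝ, ET) x →L[ℝ] ℝ) (c : TangentSpace 𝓘(ℝ, E₂) (Ψ x) →L[ℝ] ℝ)
          (u : TangentSpace 𝓘(ℝ, ET) x), c.comp (mfderiv 𝓘(ℝ, ET) 𝓘(ℝ, E₂) Ψ x) = β →
          mfderiv 𝓘(ℝ, ET) 𝓘(ℝ, E₂) Ψ x u = π₂ (Ψ x) c →
          ∃ α : TangentSpace 𝓘(ℝ, EM) (i x) →L[ℝ] ℝ,
            α.comp (mfderiv 𝓘(ℝ, ET) 𝓘(ℝ, EM) i x) = β ∧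
            mfderiv 𝓘(ℝ, ET) 𝓘(ℝ, EM) i x u = π (i x) α := by
  subst hit
  let W' : Set T := W ∩ i ⁻¹' Φ.source
  have hW' : IsOpen W' := hi.continuousOn.isOpen_inter_preimage hW Φ.open_source
  have htW' : t ∈ W' := ⟨htW, h.mem⟩
  have hj : ContMDiffOn 𝓘(ℝ, ET) (𝓘(ℝ, E₁).prod 𝓘(ℝ, E₂)) ∞ (Φ ∘ i) W' :=
    Φ.contMDiffOn.comp (hi.mono inter_subset_left) fun x hx => hx.2
  let j₁ : T → E₁ := fun x => (Φ (i x)).1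
  let j₂ : T → E₂ := fun x => (Φ (i x)).2
  have hj₁ : ContMDiffOn 𝓘(ℝ, ET) 𝓘(ℝ, E₁) ∞ j₁ W' := contMDiff_fst.comp_contMDiffOn hj
  have hj₂ : ContMDiffOn 𝓘(ℝ, ET) 𝓘(ℝ, E₂) ∞ j₂ W' := contMDiff_snd.comp_contMDiffOn hj
  let dI : T → (ET →L[ℝ] EM) := fun x => mfderiv 𝓘(ℝ, ET) 𝓘(ℝ, EM) i x
  let dΦ : M → (EM →L[ℝ] E₁ × E₂) := fun x => mfderiv 𝓘(ℝ, EM) (𝓘(ℝ, E₁).prod 𝓘(ℝ, E₂)) Φ x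
  have hdj : ∀ x ∈ W', (mfderiv 𝓘(ℝ, ET) (𝓘(ℝ, E₁).prod 𝓘(ℝ, E₂)) (Φ ∘ i) x : ET →L[ℝ] E₁ × E₂)
      = (dΦ (i x)).comp (dI x) := fun x hx =>
    mfderiv_comp x (mdifferentiableAt_of_mem Φ hx.2) (mdifferentiableAt_of_contMDiffOn hi hW hx.1)
  have hdj₁ : ∀ x ∈ W', (mfderiv 𝓘(ℝ, ET) 𝓘(ℝ, E₁) j₁ x : ET →L[ℝ] E₁)
      = (ContinuousLinearMap.fst ℝ E₁ E₂).comp ((dΦ (i x)).comp (dI x)) := fun x hx => by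
    have h₁ := mfderiv_comp x (mdifferentiableAt_fst (I := 𝓘(ℝ, E₁)) (I' := 𝓘(ℝ, E₂)))
      (mdifferentiableAt_of_contMDiffOn hj hW' hx)
    rw [mfderiv_fst] at h₁
    rw [← hdj x hx]
    exact h₁
  have hdj₂ : ∀ x ∈ W', (mfderiv 𝓘(ℝ, ET) 𝓘(ℝ, E₂) j₂ x : ET →L[ℝ] E₂)
      = (ContinuousLinearMap.snd ℝ E₁ E₂).comp ((dΦ (i x)).comp (dI x)) := fun x hx => by
    have h₁ := mfderiv_comp x (mdifferentiableAt_snd (I := 𝓘(ℝ, E₁)) (I' := 𝓘(ℝ, E₂)))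
      (mdifferentiableAt_of_contMDiffOn hj hW' hx)
    rw [mfderiv_snd] at h₁
    rw [← hdj x hx]
    exact h₁
  have hiso : ∀ x ∈ Φ.source, ∀ α : E₁ × E₂ →L[ℝ] ℝ, ∃ β : EM →L[ℝ] ℝ, β = α.comp (dΦ x) ∧
      dΦ x (π x β) = blockSharp (sharpCLM π₁) (sharpCLM π₂) (Φ x) α := fun x hx α =>
    ⟨_, rfl, ((h.iso x hx).1 α).trans (prodSharp_eq_blockSharp _ _)⟩
  -- A tangent vector of T whose E₂-component vanishes lies in E₁ × 0, which consists of ♯ images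
  -- because the first factor is symplectic; transversality excludes it unless it is zero.
  have hbij : Function.Bijective (mfderiv 𝓘(ℝ, ET) 𝓘(ℝ, E₂) j₂ t : ET →L[ℝ] E₂) := by
    have hinj : Function.Injective
        ((ContinuousLinearMap.snd ℝ E₁ E₂).comp ((dΦ (i t)).comp (dI t))) := by
      rw [injective_iff_map_eq_zero]
      intro u hu
      obtain ⟨a, ha⟩ := h.surjective (dΦ (i t) (dI t u)).1
      obtain ⟨β, -, hβ⟩ := hiso (i t) h.mem (a.comp (ContinuousLinearMap.fst ℝ E₁ E₂))
      rw [blockSharp_comp_fst, ha] at hβ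
      have : π (i t) β = dI t u :=
        injective_mfderiv Φ h.mem (hβ.trans (Prod.ext rfl (Eq.symm hu)))
      exact htr u ⟨β, this⟩
    have hbij' : Function.Bijective
        ((ContinuousLinearMap.snd ℝ E₁ E₂).comp ((dΦ (i t)).comp (dI t))) :=
      ⟨hinj, (LinearMap.injective_iff_surjective_of_finrank_eq_finrank (f :=
        ((ContinuousLinearMap.snd ℝ E₁ E₂).comp ((dΦ (i t)).comp (dI t))).toLinearMap) hdim).1 hinj⟩
    rw [← hdj₂ t htW'] at hbij'
    exact hbij'
  obtain ⟨χ, htχ, hχW, hχ⟩ := exists_partialDiffeomorph hW' htW' hj₂ hbij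
  let dχ : T → (ET →L[ℝ] E₂) := fun x => mfderiv 𝓘(ℝ, ET) 𝓘(ℝ, E₂) χ x
  have hdχ : ∀ x ∈ χ.source, ∀ u : ET, dχ x u = (dΦ (i x) (dI x u)).2 := fun x hx u => by
    have h₁ : (χ : T → E₂) =ᶠ[𝓝 x] j₂ := by
      filter_upwards [χ.open_source.mem_nhds hx] with y hy using hχ y hy
    have h₂ : dχ x = mfderiv 𝓘(ℝ, ET) 𝓘(ℝ, E₂) j₂ x := h₁.mfderiv_eq
    rw [h₂, hdj₂ x (hχW hx)]
    rfl
  have hdχb : ∀ x ∈ χ.source, Function.Bijective (dχ x) := fun x hx => (mfderivEquiv χ hx).bijective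
  have hχt : χ t = (Φ (i t)).2 := hχ t htχ
  set b : E₂ := (Φ (i t)).2 with hb
  have hbχ : b ∈ χ.target := hχt ▸ apply_mem_target χ htχ
  have hsb : χ.symm b = t := by rw [← hχt]; exact symm_apply_apply χ htχ
  have hex : ∀ y ∈ χ.target, ∃ x ∈ χ.source, χ x = y := fun y hy =>
    ⟨χ.symm y, symm_mem_source χ hy, apply_symm_apply χ hy⟩
  -- In the coordinate χ, the E₂-component, the transversal is the graph of κ.
  let κ : E₂ → E₁ := j₁ ∘ χ.symm
  have hκχ : ∀ x ∈ χ.source, κ (χ x) = j₁ x := fun x hx => by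
    exact congrArg j₁ (symm_apply_apply χ hx)
  have hκc : ContMDiffOn 𝓘(ℝ, E₂) 𝓘(ℝ, E₁) ∞ κ χ.target :=
    hj₁.comp χ.symm.contMDiffOn fun y hy => hχW (symm_mem_source χ hy)
  have hκ : SmoothNear κ b := smoothNear_of_contMDiffOn χ.open_target hκc hbχ
  have hκb : κ b = (Φ (i t)).1 := congrArg j₁ hsb
  have hdκ : ∀ x ∈ χ.source, ∀ u : ET, fderiv ℝ κ (χ x) (dχ x u) = (dΦ (i x) (dI x u)).1 :=
    fun x hx u => by
    have h₁ : (κ ∘ χ : T → E₁) =ᶠ[𝓝 x] j₁ := by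
      filter_upwards [χ.open_source.mem_nhds hx] with y hy using hκχ y hy
    have h₂ := mfderiv_comp x (mdifferentiableAt_of_contMDiffOn hκc χ.open_target
      (apply_mem_target χ hx)) (mdifferentiableAt_of_mem χ hx)
    rw [h₁.mfderiv_eq, mfderiv_eq_fderiv] at h₂
    exact (DFunLike.congr_fun (h₂.symm.trans (hdj₁ x (hχW hx))) u)
  have hDj : ∀ x ∈ χ.source, ∀ u : ET,
      u ∈ (inducedDistribution 𝓘(ℝ, ET) D i x : Submodule ℝ ET) ↔
        fderiv ℝ κ (χ x) (dχ x u) ∈ (D₁ (κ (χ x)) : Submodule ℝ E₁) ∧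
          dχ x u ∈ (D₂ (χ x) : Submodule ℝ E₂) := fun x hx u => by
    have h₁ := h.iso.mem_distribution_iff (hχW hx).2 (dI x u)
    have h₂ := mem_prodDistribution (D₁ := D₁) (D₂ := D₂) (Φ (i x)) (dΦ (i x) (dI x u)).1
      (dΦ (i x) (dI x u)).2
    rw [hdκ x hx, hdχ x hx, hκχ x hx, hχ x hx]
    exact h₁.symm.trans h₂
  obtain ⟨p, hp, hp', hpinv, hpD⟩ := h.exists_fst_functions hint
  have hbU : b ∈ U := h.snd_mem _ (apply_mem_target Φ h.mem)
  obtain ⟨m, g, hg, hgg, hgD, hgfin⟩ := exists_functions h₂ hbU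
  -- The induced foliation injects into the foliation of E₂, and both have dimension r₂, so every
  -- vector of the latter is attained.
  have hDχ : ∀ x ∈ χ.source, Module.finrank ℝ (D₂ (χ x) : Submodule ℝ E₂) = r₂ →
      ∀ w ∈ (D₂ (χ x) : Submodule ℝ E₂),
        ∃ u ∈ (inducedDistribution 𝓘(ℝ, ET) D i x : Submodule ℝ ET), dχ x u = w :=
    fun x hx hr w hw => by
    have h₁ := map_eq_of_finrank_eq (hdχb x hx).1
      (D := (inducedDistribution 𝓘(ℝ, ET) D i x : Submodule ℝ ET))
      (D' := (D₂ (χ x) : Submodule ℝ E₂)) (fun u hu => ((hDj x hx u).1 hu).2)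
      ((hfin x (hχW hx).1).trans hr.symm)
    rw [← h₁] at hw
    exact hw
  -- A vector tangent to the foliation of E₂ lifts to the induced foliation, whose E₁-component lies
  -- in D₁ and is killed by dp. This is the hypothesis of `exists_graph_induced`.
  have hκg : ∀ᶠ y in 𝓝 b, ∀ w, fderiv ℝ g y w = 0 → fderiv ℝ p (κ y) (fderiv ℝ κ y w) = 0 := by
    have hκt : Tendsto κ (𝓝 b) (𝓝 (Φ (i t)).1) := by
      rw [← hκb]
      exact hκ.contDiffAt.continuousAt
    filter_upwards [χ.open_target.mem_nhds hbχ, hκt.eventually hpD, hgD, hgfin]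
      with y hy e₁ e₂ e₃ w hw
    obtain ⟨x, hx, rfl⟩ := hex y hy
    obtain ⟨u, hu, rfl⟩ := hDχ x hx e₃ w ((e₂ w).2 hw)
    exact e₁ _ ((hDj x hx u).1 hu).1
  have hP := isPoissonGerm_of_isPoissonOn Φ.open_target (h.iso.isPoissonOn
    ⟨fun x _ => hint.poisson.skew x (mem_univ x),
      fun V hV _ => hint.poisson.smooth V hV (subset_univ V),
      fun V hV _ => hint.poisson.jacobi V hV (subset_univ V)⟩) (apply_mem_target Φ h.mem)
  obtain ⟨ψ, hψ, hψb, hψi, hψg, hψP⟩ := exists_graph_induced (v := (Φ (i t)).1) (b := b) hP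
    h.injective h.vanish hp hp' (by rw [h.finrank_eq, Module.finrank_fin_fun]) hpinv hκ hκb hg hgg
    hκg
  obtain ⟨e, hbe, heψ, he, he'⟩ := exists_openPartialHomeomorph hψ
    ⟨hψi, (LinearMap.injective_iff_surjective (f := (fderiv ℝ ψ b).toLinearMap)).1 hψi⟩
  have hψt : Tendsto ψ (𝓝 b) (𝓝 b) := by
    have := hψ.contDiffAt.continuousAt.tendsto
    rwa [hψb] at this
  obtain ⟨O, hOP, hO, hbO⟩ := eventually_nhds_iff.1 (hψg.and (hψP.and
    (hgD.and ((hψt.eventually hgD).and (hgfin.and ((hψt.eventually hgfin).and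
      (hψt.eventually (hU.mem_nhds hbU))))))))
  subst heψ
  let ε := diffeoOfContDiffOn e he he'
  have hN : IsOpen (χ.source ∩ χ ⁻¹' O) :=
    χ.contMDiffOn.continuousOn.isOpen_inter_preimage χ.open_source hO
  -- The required diffeomorphism is the graph coordinate χ followed by the straightening ψ, on a
  -- neighbourhood where all the germ conditions hold.
  let Ψ := restrictOpen (χ.trans ε) hN
  have hΨ : ∀ x, Ψ x = e (χ x) := fun x => rfl
  have hdΨ : ∀ x ∈ Ψ.source, (mfderiv 𝓘(ℝ, ET) 𝓘(ℝ, E₂) Ψ x : ET →L[ℝ] E₂)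
      = (fderiv ℝ e (χ x)).comp (dχ x) := fun x hx => by
    have h₁ := mfderiv_comp x (mdifferentiableAt_of_mem ε hx.1.2)
      (mdifferentiableAt_of_mem χ hx.1.1)
    have h₂ : (mfderiv 𝓘(ℝ, E₂) 𝓘(ℝ, E₂) ε (χ x) : E₂ →L[ℝ] E₂) = fderiv ℝ e (χ x) :=
      mfderiv_eq_fderiv
    rw [← h₂]
    exact h₁
  have hei : ∀ y ∈ e.source, Function.Injective (fderiv ℝ e y) := fun y hy => by
    have h₂ : (mfderiv 𝓘(ℝ, E₂) 𝓘(ℝ, E₂) ε y : E₂ →L[ℝ] E₂) = fderiv ℝ e y := mfderiv_eq_fderiv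
    rw [← h₂]
    exact injective_mfderiv ε hy
  refine ⟨Ψ, ⟨⟨htχ, ?_⟩, htχ, ?_⟩, fun x hx => (hχW hx.1.1).1, fun y hy => ?_, ?_, fun x hx => ?_⟩
  · change χ t ∈ e.source
    rwa [hχt]
  · change χ t ∈ O
    rwa [hχt]
  · have hx := symm_mem_source Ψ hy
    rw [← apply_symm_apply Ψ hy, hΨ]
    exact (hOP _ hx.2.2).2.2.2.2.2.2
  · rw [hΨ, hχt, hψb]
  obtain ⟨o₁, o₂, o₄, o₅, o₆, o₇, -⟩ := hOP _ hx.2.2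
  constructor
  · have hm := map_eq_of_finrank_eq (A := (fderiv ℝ e (χ x)).comp (dχ x))
      ((hei _ hx.1.2).comp (hdχb x hx.1.1).1)
      (D := (inducedDistribution 𝓘(ℝ, ET) D i x : Submodule ℝ ET))
      (D' := (D₂ (e (χ x)) : Submodule ℝ E₂))
      (fun u hu => (o₅ _).2 (o₁ _ ((o₄ _).1 ((hDj x hx.1.1 u).1 hu).2)))
      ((hfin x (hχW hx.1.1).1).trans o₇.symm)
    rw [← hdΨ x hx] at hm
    exact hm
  · intro β c u hc hu
    have hd := hdΨ x hx
    let β' : E₂ →L[ℝ] ℝ := ContinuousLinearMap.comp (c : E₂ →L[ℝ] ℝ) (fderiv ℝ e (χ x))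
    have hβ' : β'.comp (dχ x) = β := by
      rw [← hc]
      exact (ContinuousLinearMap.comp_assoc _ _ _).trans
        (congrArg (ContinuousLinearMap.comp (c : E₂ →L[ℝ] ℝ)) hd.symm)
    obtain ⟨α, hα, hα'⟩ := o₂ β' c (dχ x u) rfl ((DFunLike.congr_fun hd u).symm.trans hu)
    have hz : ((κ (χ x), χ x) : E₁ × E₂) = Φ (i x) := by
      rw [hκχ x hx.1.1, hχ x hx.1.1]
    have hJ : ∀ u : ET, ((fderiv ℝ κ (χ x) (dχ x u), dχ x u) : E₁ × E₂) = dΦ (i x) (dI x u) :=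
      fun u => by rw [hdκ x hx.1.1, hdχ x hx.1.1]
    rw [hz] at hα'
    obtain ⟨γ, hγ, hγ'⟩ := hiso (i x) (hχW hx.1.1).2 α
    refine ⟨γ, ?_, injective_mfderiv Φ (hχW hx.1.1).2 ((hJ u).symm.trans (hα'.trans hγ'.symm))⟩
    rw [hγ, ← hβ', ← hα]
    refine ContinuousLinearMap.ext fun (u : ET) => ?_
    exact congrArg α (hJ u).symm

end Transversal

end SplitSystem

end

open scoped Manifold ContDiff Topology

noncomputable section

namespace SplitSystem

open Set Filter

/-! ### Split charts from transverse systems -/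

section Push

variable {E : Type*} [NormedAddCommGroup E] [NormedSpace ℝ E]
  {H : Type*} [TopologicalSpace H] {I : ModelWithCorners ℝ E H}
  {S : Type*} [TopologicalSpace S] [ChartedSpace H S]
  {E' : Type*} [NormedAddCommGroup E'] [NormedSpace ℝ E']
  {H' : Type*} [TopologicalSpace H'] {I' : ModelWithCorners ℝ E' H'}
  {S' : Type*} [TopologicalSpace S'] [ChartedSpace H' S']
  {F : Type*} [NormedAddCommGroup F] [NormedSpace ℝ F]
  {G : Type*} [TopologicalSpace G] {J : ModelWithCorners ℝ F G}
  {N : Type*} [TopologicalSpace N] [ChartedSpace G N]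

variable (J N) in
/-- The product of a partial diffeomorphism with the identity. -/
def prodId (φ : PartialDiffeomorph I I' S S' ∞) :
    PartialDiffeomorph (I.prod J) (I'.prod J) (S × N) (S' × N) ∞ where
  toPartialEquiv := φ.toPartialEquiv.prod (PartialEquiv.refl N)
  open_source := φ.open_source.prod isOpen_univ
  open_target := φ.open_target.prod isOpen_univ
  contMDiffOn_toFun := φ.contMDiffOn_toFun.prodMap contMDiffOn_id
  contMDiffOn_invFun := φ.contMDiffOn_invFun.prodMap contMDiffOn_id

/-- The push-forward of a bivector field by a partial diffeomorphism. -/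
def pushSharp (φ : PartialDiffeomorph I I' S S' ∞) (π : SharpField I S) : SharpField I' S' :=
  fun x =>
    ((mfderiv I I' φ (φ.symm x) : E →L[ℝ] E').toLinearMap ∘ₗ
      (show (E →L[ℝ] ℝ) →ₗ[ℝ] E from π (φ.symm x))) ∘ₗ
    { toFun := fun β : E' →L[ℝ] ℝ => β.comp (mfderiv I I' φ (φ.symm x) : E →L[ℝ] E')
      map_add' := fun _ _ => ContinuousLinearMap.add_comp _ _ _
      map_smul' := fun _ _ => ContinuousLinearMap.smul_comp _ _ _ }

lemma pushSharp_apply (φ : PartialDiffeomorph I I' S S' ∞) (π : SharpField I S) {a : S}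
    (ha : a ∈ φ.source) (β : E' →L[ℝ] ℝ) :
    (pushSharp φ π (φ a) β : E') = (mfderiv I I' φ a : E →L[ℝ] E')
      (π a (β.comp (mfderiv I I' φ a : E →L[ℝ] E'))) := by
  have h : ∀ x, x = a → ((mfderiv I I' φ x : E →L[ℝ] E')
      (π x (β.comp (mfderiv I I' φ x : E →L[ℝ] E'))) : E') = (mfderiv I I' φ a : E →L[ℝ] E')
      (π a (β.comp (mfderiv I I' φ a : E →L[ℝ] E'))) := by
    rintro x rfl
    rfl
  exact h _ (symm_apply_apply φ ha)

/-- The push-forward of a field of tangent subspaces by a partial diffeomorphism. -/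
def pushDistribution (φ : PartialDiffeomorph I I' S S' ∞) (D : Distribution I S) :
    Distribution I' S' :=
  fun x => Submodule.map (mfderiv I I' φ (φ.symm x) : E →L[ℝ] E').toLinearMap (D (φ.symm x))

lemma pushDistribution_apply (φ : PartialDiffeomorph I I' S S' ∞) (D : Distribution I S) {a : S}
    (ha : a ∈ φ.source) : (pushDistribution φ D (φ a) : Submodule ℝ E')
      = Submodule.map (mfderiv I I' φ a : E →L[ℝ] E').toLinearMap (D a) := by
  have h : ∀ x, x = a → (Submodule.map (mfderiv I I' φ x : E →L[ℝ] E').toLinearMap (D x) :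
      Submodule ℝ E') = Submodule.map (mfderiv I I' φ a : E →L[ℝ] E').toLinearMap (D a) := by
    rintro x rfl
    rfl
  exact h _ (symm_apply_apply φ ha)

lemma mfderiv_prodId (φ : PartialDiffeomorph I I' S S' ∞) {z : S × N} (hz : z.1 ∈ φ.source) :
    (mfderiv (I.prod J) (I'.prod J) (prodId J N φ) z : E × F →L[ℝ] E' × F)
      = (mfderiv I I' φ z.1 : E →L[ℝ] E').prodMap (ContinuousLinearMap.id ℝ F) := by
  have h := mfderiv_prodMap (mdifferentiableAt_of_mem φ hz) (mdifferentiableAt_id (I := J) (x := z.2))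
  rw [mfderiv_id] at h
  exact h

lemma isSystemIso_prodId (φ : PartialDiffeomorph I I' S S' ∞) (π : SharpField I S)
    (D : Distribution I S) (πN : SharpField J N) (DN : Distribution J N) :
    IsSystemIso (prodId J N φ) (prodSharp π πN) (prodDistribution D DN)
      (prodSharp (pushSharp φ π) πN) (prodDistribution (pushDistribution φ D) DN) := by
  rintro ⟨a, y⟩ ⟨ha, -⟩
  have ha : a ∈ φ.source := ha
  have hd := mfderiv_prodId (J := J) (N := N) φ (z := (a, y)) ha
  let A : E →L[ℝ] E' := mfderiv I I' φ a
  constructor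
  · intro β
    refine (DFunLike.congr_fun hd _).trans ?_
    rw [show (mfderiv (I.prod J) (I'.prod J) (prodId J N φ) (a, y)) = _ from hd]
    let β' : E' × F →L[ℝ] ℝ := β
    have e₁ : (β'.comp (A.prodMap (ContinuousLinearMap.id ℝ F))).comp
        (ContinuousLinearMap.inl ℝ E F) = (β'.comp (ContinuousLinearMap.inl ℝ E' F)).comp A := by
      ext u
      simp
    have e₂ : (β'.comp (A.prodMap (ContinuousLinearMap.id ℝ F))).comp
        (ContinuousLinearMap.inr ℝ E F) = β'.comp (ContinuousLinearMap.inr ℝ E' F) := by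
      ext u
      simp
    refine Prod.ext ?_ ?_
    · change A ((_ : E) + 0) = (_ : E') + 0
      rw [add_zero, add_zero]
      exact (congrArg (fun δ : E →L[ℝ] ℝ => A (π a δ)) e₁).trans
        (pushSharp_apply φ π ha (β'.comp (ContinuousLinearMap.inl ℝ E' F))).symm
    · change (0 : F) + _ = 0 + _
      rw [zero_add, zero_add]
      exact congrArg (fun δ : F →L[ℝ] ℝ => (πN y δ : F)) e₂
  · rw [show (mfderiv (I.prod J) (I'.prod J) (prodId J N φ) (a, y)) = _ from hd]
    have h := pushDistribution_apply φ D ha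
    have key : ∀ (K : Submodule ℝ E) (L : Submodule ℝ F),
        Submodule.map (A.prodMap (ContinuousLinearMap.id ℝ F)).toLinearMap
          (Submodule.map (LinearMap.inl ℝ E F) K ⊔ Submodule.map (LinearMap.inr ℝ E F) L)
        = Submodule.map (LinearMap.inl ℝ E' F) (Submodule.map A.toLinearMap K)
          ⊔ Submodule.map (LinearMap.inr ℝ E' F) L := fun K L => by
      rw [Submodule.map_sup, ← Submodule.map_comp, ← Submodule.map_comp, ← Submodule.map_comp]
      congr 2
      · ext u <;> simp
    refine (key (D a) (DN y)).trans ?_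
    exact congrArg (fun K : Submodule ℝ E' => Submodule.map (LinearMap.inl ℝ E' F) K
      ⊔ Submodule.map (LinearMap.inr ℝ E' F) (DN y)) h.symm

/-- Since the first bivector is nondegenerate at z.1, the characteristic space contains the whole
first factor; the rank hypothesis leaves room for nothing else. -/
lemma snd_eq_zero_of_mem_charSpace [FiniteDimensional ℝ E] [FiniteDimensional ℝ F]
    {π : SharpField I S} {πN : SharpField J N} {z : S × N}
    (hs : Function.Surjective (π z.1)) (hr : rankAt (prodSharp π πN) z = Module.finrank ℝ E)
    {u : E × F} (hu : u ∈ (charSpace (prodSharp π πN) z : Submodule ℝ (E × F))) : u.2 = 0 := by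
  have h : LinearMap.range (LinearMap.inl ℝ E F)
      = (charSpace (prodSharp π πN) z : Submodule ℝ (E × F)) := by
    have key : ∀ Q : Submodule ℝ (E × F), LinearMap.range (LinearMap.inl ℝ E F) ≤ Q →
        Module.finrank ℝ Q = Module.finrank ℝ E → LinearMap.range (LinearMap.inl ℝ E F) = Q :=
      fun Q h₁ h₂ => Submodule.eq_of_le_of_finrank_eq h₁
        ((LinearMap.finrank_range_of_inj LinearMap.inl_injective).trans h₂.symm)
    refine key _ ?_ hr
    rintro _ ⟨w, rfl⟩
    obtain ⟨α, rfl⟩ := hs w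
    refine ⟨ContinuousLinearMap.comp (α : E →L[ℝ] ℝ) (ContinuousLinearMap.fst ℝ E F), ?_⟩
    refine Prod.ext ?_ ?_
    · change (_ : E) + 0 = _
      rw [add_zero]
      rfl
    · let P : (F →L[ℝ] ℝ) →ₗ[ℝ] F := πN z.2
      let α' : E →L[ℝ] ℝ := α
      have h₀ : (α'.comp (ContinuousLinearMap.fst ℝ E F)).comp (ContinuousLinearMap.inr ℝ E F)
          = 0 := by
        ext u
        simp
      change (0 : F) + P ((α'.comp (ContinuousLinearMap.fst ℝ E F)).comp
        (ContinuousLinearMap.inr ℝ E F)) = 0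
      rw [zero_add, h₀, map_zero]
  rw [← h] at hu
  obtain ⟨w, rfl⟩ := hu
  rfl

end Push

/-! ### Linear algebra along a symplectic leaf. -/

section Leaf

variable {E : Type*} [NormedAddCommGroup E] [NormedSpace ℝ E]
  {H : Type*} [TopologicalSpace H] {I : ModelWithCorners ℝ E H}
  {M : Type*} [TopologicalSpace M] [ChartedSpace H M]
  {F : Type*} [NormedAddCommGroup F] [NormedSpace ℝ F]
  {G : Type*} [TopologicalSpace G] {J : ModelWithCorners ℝ F G}
  {S : Type*} [TopologicalSpace S] [ChartedSpace G S]
  {π : SharpField I M} {ι : S → M}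

lemma IsSymplecticLeaf.rankAt_eq (h : IsSymplecticLeaf J π ι) (a : S) :
    rankAt π (ι a) = Module.finrank ℝ F := by
  unfold rankAt
  rw [← h.tangent a]
  exact LinearMap.finrank_range_of_inj (h.submanifold.immersion a)

/-- If β♯ = 0, its extension α has α♯ = 0, so by skewness α vanishes on the characteristic space.
That space is the tangent space of the leaf, whence β = 0; injectivity gives surjectivity by
dimension. -/
lemma IsSymplecticLeaf.surjective_sharp [FiniteDimensional ℝ F]
    (h : IsSymplecticLeaf J π ι) {πS : SharpField J S}
    {V : Set S} (hS : IsInducedOn π ι πS V) {a : S} (ha : a ∈ V)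
    (hskew : ∀ α β : TangentSpace I (ι a) →L[ℝ] ℝ, β (π (ι a) α) = -α (π (ι a) β)) :
    Function.Surjective (πS a) := by
  let A : (F →L[ℝ] ℝ) →ₗ[ℝ] F := πS a
  have hi : Function.Injective A := by
    rw [injective_iff_map_eq_zero]
    intro β hβ
    obtain ⟨α, hα, hα'⟩ := hS a ha β
    have h₀ : π (ι a) α = 0 := by
      rw [← hα']
      exact (congrArg (mfderiv J I ι a) hβ).trans (map_zero _)
    rw [← hα]
    refine ContinuousLinearMap.ext fun (u : F) => ?_
    have hu : mfderiv J I ι a u ∈ charSpace π (ι a) := h.tangent a ▸ ⟨u, rfl⟩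
    obtain ⟨γ, hγ⟩ := hu
    change α (mfderiv J I ι a u) = 0
    rw [← hγ, hskew, h₀, map_zero, neg_zero]
  exact (LinearMap.injective_iff_surjective_of_finrank_eq_finrank (finrank_dual F)).1 hi

lemma finrank_inducedDistribution {D : Distribution I M} {k : ℕ} (h : IsRegularLeaf J D ι k) {a : S}
    (ha : Function.Injective (mfderiv J I ι a)) :
    Module.finrank ℝ (inducedDistribution J D ι a) = k := by
  rw [← h a, inf_comm, ← Submodule.map_comap_eq]
  exact (Submodule.equivMapOfInjective _ ha _).finrank_eq

end Leaf

/-! ### Split charts at a leaf point and persistence of transverse systems along the leaf. -/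

section Transverse

variable {n r r' : ℕ}
  {M : Type*} [TopologicalSpace M] [ChartedSpace (EuclideanSpace ℝ (Fin n)) M]
  {π : SharpField (𝓡 n) M} {D : Distribution (𝓡 n) M}
  {S : Type*} [TopologicalSpace S] [ChartedSpace (EuclideanSpace ℝ (Fin (2 * r'))) S]
  [IsManifold (𝓡 (2 * r')) ∞ S] {ι : S → M} {σ : S} {B : BallSystem (n - 2 * r')}

/-- The leaf factor is replaced by a vector space through a chart. Nondegeneracy of the leaf
bivector together with the rank 2r' of π at the leaf forces the bivector of the ball to vanish at
the base point. -/
lemma IsTransverseSystem.exists_splitChart (h : IsTransverseSystem π D r r' ι σ B)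
    (hint : IsIntegrableOn π D univ r) (hleaf : IsSymplecticLeaf (𝓡 (2 * r')) π ι)
    (hreg : IsRegularLeaf (𝓡 (2 * r')) D ι r') :
    ∃ (Φ : PartialDiffeomorph (𝓡 n) ((𝓡 (2 * r')).prod (𝓡 (n - 2 * r'))) M
        (EuclideanSpace ℝ (Fin (2 * r')) × EuclideanSpace ℝ (Fin (n - 2 * r'))) ∞)
      (π₁ : SharpField (𝓡 (2 * r')) (EuclideanSpace ℝ (Fin (2 * r'))))
      (D₁ : Distribution (𝓡 (2 * r')) (EuclideanSpace ℝ (Fin (2 * r')))),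
      IsSplitChart Φ π D π₁ D₁ B.sharp B.distribution B.ball r' (ι σ) ∧ (Φ (ι σ)).2 = B.base := by
  obtain ⟨-, V, πS, Φ, hV, hσ, hVΦ, hπS, hΦt, hσΦ, hb, hΦ⟩ := h
  -- Nothing says that Φ sends ι σ to (σ, base). The chart is taken at the actual first component a;
  -- the leaf and regularity hypotheses hold at every point, hence at a.
  set a := (Φ (ι σ)).1 with ha
  let φ := chartDiffeo (E := EuclideanSpace ℝ (Fin (2 * r'))) a
  have haφ : a ∈ φ.source := mem_chartDiffeo_source a
  have haV : a ∈ V := by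
    have := apply_mem_target Φ hσΦ
    rw [hΦt] at this
    exact this.1
  have hskew : ∀ x, ∀ α β : TangentSpace (𝓡 n) x →L[ℝ] ℝ, β (π x α) = -α (π x β) :=
    fun x => hint.poisson.skew x (mem_univ x)
  have hsurj : Function.Surjective (πS a) := hleaf.surjective_sharp hπS haV (hskew _)
  have hrank : rankAt (prodSharp πS B.sharp) (Φ (ι σ))
      = Module.finrank ℝ (EuclideanSpace ℝ (Fin (2 * r'))) := by
    rw [hΦ.rankAt_eq hσΦ, hleaf.rankAt_eq]
  refine ⟨Φ.trans (prodId (𝓡 (n - 2 * r')) _ φ), pushSharp φ πS,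
    pushDistribution φ (inducedDistribution (𝓡 (2 * r')) D ι), ⟨⟨hσΦ, haφ, mem_univ _⟩, ?_,
      hΦ.trans (isSystemIso_prodId φ _ _ _ _), ?_, ?_, ?_, ?_⟩, hb⟩
  · intro z hz
    have hw := symm_mem_source (Φ.trans (prodId (𝓡 (n - 2 * r')) _ φ)) hz
    rw [← apply_symm_apply (Φ.trans (prodId (𝓡 (n - 2 * r')) _ φ)) hz]
    have := apply_mem_target Φ hw.1
    rw [hΦt] at this
    exact this.2
  · change Function.Injective (sharpCLM (pushSharp φ πS) (φ a))
    refine (LinearMap.injective_iff_surjective_of_finrank_eq_finrank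
      (f := (sharpCLM (pushSharp φ πS) (φ a)).toLinearMap) (finrank_dual _)).2 fun u => ?_
    obtain ⟨w, hw⟩ := (mfderivEquiv φ haφ).surjective u
    obtain ⟨γ, rfl⟩ := hsurj w
    refine ⟨ContinuousLinearMap.comp (γ : EuclideanSpace ℝ (Fin (2 * r')) →L[ℝ] ℝ)
      (mfderiv (𝓡 (2 * r')) (𝓡 (2 * r')) φ.symm (φ a)), ?_⟩
    refine (pushSharp_apply φ πS haφ _).trans ?_
    refine Eq.trans ?_ hw
    have e : ContinuousLinearMap.comp (ContinuousLinearMap.comp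
        (γ : EuclideanSpace ℝ (Fin (2 * r')) →L[ℝ] ℝ)
        (mfderiv (𝓡 (2 * r')) (𝓡 (2 * r')) φ.symm (φ a)))
        (mfderiv (𝓡 (2 * r')) (𝓡 (2 * r')) φ a) = γ :=
      (ContinuousLinearMap.comp_assoc _ _ _).trans
        ((congrArg (ContinuousLinearMap.comp γ) (mfderiv_symm_comp_mfderiv φ haφ)).trans
          (ContinuousLinearMap.comp_id _))
    exact congrArg (fun δ : EuclideanSpace ℝ (Fin (2 * r')) →L[ℝ] ℝ =>
      mfderiv (𝓡 (2 * r')) (𝓡 (2 * r')) φ a (πS a δ)) e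
  · ext1 β
    have := snd_eq_zero_of_mem_charSpace hsurj hrank
      (u := prodSharp πS B.sharp (Φ (ι σ)) (ContinuousLinearMap.comp β
        (ContinuousLinearMap.snd ℝ (EuclideanSpace ℝ (Fin (2 * r'))) _))) ⟨_, rfl⟩
    refine Eq.trans ?_ this
    change _ = (0 : EuclideanSpace ℝ (Fin (n - 2 * r'))) + _
    rw [zero_add]
    rfl
  · rw [finrank_euclideanSpace, Fintype.card_fin]
  · change Module.finrank ℝ (pushDistribution φ (inducedDistribution (𝓡 (2 * r')) D ι) (φ a) :
      Submodule ℝ (EuclideanSpace ℝ (Fin (2 * r')))) = r'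
    rw [pushDistribution_apply φ _ haφ]
    exact (Submodule.equivMapOfInjective _ (injective_mfderiv φ haφ) _).finrank_eq.symm.trans
      (finrank_inducedDistribution hreg (hleaf.submanifold.immersion a))

/-- A transverse system at a point of the leaf is one at all points of the leaf nearby. -/
lemma IsTransverseSystem.eventually (h : IsTransverseSystem π D r r' ι σ B)
    (hint : IsIntegrableOn π D univ r) (hleaf : IsSymplecticLeaf (𝓡 (2 * r')) π ι) :
    ∀ᶠ τ in 𝓝 σ, IsTransverseSystem π D r r' ι τ B := by
  obtain ⟨hB, V, πS, Φ, hV, hσ, hVΦ, hπS, hΦt, hσΦ, hb, hΦ⟩ := h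
  let f : S → EuclideanSpace ℝ (Fin (n - 2 * r')) := fun τ => (Φ (ι τ)).2
  -- The same Φ, V and B serve at every τ in V; only the base-point condition depends on τ.
  suffices hf : ∀ᶠ τ in 𝓝 σ, f τ = f σ by
    filter_upwards [hf, hV.mem_nhds hσ] with τ h₁ h₂
    exact ⟨hB, V, πS, Φ, hV, h₂, hVΦ, hπS, hΦt, hVΦ h₂, h₁.trans hb, hΦ⟩
  have hΦι : ContMDiffOn (𝓡 (2 * r')) ((𝓡 (2 * r')).prod (𝓡 (n - 2 * r'))) ∞ (Φ ∘ ι) V :=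
    Φ.contMDiffOn.comp hleaf.submanifold.smooth.contMDiffOn hVΦ
  have hfc : ContMDiffOn (𝓡 (2 * r')) (𝓡 (n - 2 * r')) ∞ f V := contMDiff_snd.comp_contMDiffOn hΦι
  -- Vectors tangent to the leaf are characteristic, and at points of the leaf the characteristic
  -- space of the product is the first factor alone. So the ball component has zero derivative, and
  -- is constant on a ball in a chart.
  have hfd : ∀ τ ∈ V, mfderiv (𝓡 (2 * r')) (𝓡 (n - 2 * r')) f τ = 0 := fun τ hτ => by
    have h₁ := mfderiv_comp τ (mdifferentiableAt_snd (I := 𝓡 (2 * r')) (I' := 𝓡 (n - 2 * r')))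
      (mdifferentiableAt_of_contMDiffOn hΦι hV hτ)
    have h₂ := mfderiv_comp τ (mdifferentiableAt_of_mem Φ (hVΦ hτ))
      (hleaf.submanifold.smooth.mdifferentiableAt (by simp))
    rw [mfderiv_snd, h₂] at h₁
    refine h₁.trans (ContinuousLinearMap.ext fun u => ?_)
    have hV' : (Φ (ι τ)).1 ∈ V := by
      have := apply_mem_target Φ (hVΦ hτ)
      rw [hΦt] at this
      exact this.1
    have hsurj : Function.Surjective (πS (Φ (ι τ)).1) :=
      hleaf.surjective_sharp hπS hV' (hint.poisson.skew _ (mem_univ _))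
    have hrank : rankAt (prodSharp πS B.sharp) (Φ (ι τ))
        = Module.finrank ℝ (EuclideanSpace ℝ (Fin (2 * r'))) := by
      rw [hΦ.rankAt_eq (hVΦ hτ), hleaf.rankAt_eq]
    have hu : mfderiv (𝓡 (2 * r')) (𝓡 n) ι τ u ∈ charSpace π (ι τ) := hleaf.tangent τ ▸ ⟨u, rfl⟩
    refine snd_eq_zero_of_mem_charSpace hsurj hrank ?_
    rw [← hΦ.charSpace_map (hVΦ hτ)]
    exact ⟨_, hu, rfl⟩
  let φ := chartDiffeo (E := EuclideanSpace ℝ (Fin (2 * r'))) σ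
  have hσφ : σ ∈ φ.source := mem_chartDiffeo_source σ
  have hO : IsOpen (φ.target ∩ φ.symm ⁻¹' V) :=
    φ.symm.contMDiffOn.continuousOn.isOpen_inter_preimage φ.open_target hV
  have hσO : φ σ ∈ φ.target ∩ φ.symm ⁻¹' V :=
    ⟨apply_mem_target φ hσφ, by rw [mem_preimage, symm_apply_apply φ hσφ]; exact hσ⟩
  obtain ⟨ε, hε, hεO⟩ := Metric.isOpen_iff.1 hO _ hσO
  have hgd : ∀ y ∈ φ.target ∩ φ.symm ⁻¹' V, HasFDerivAt (f ∘ φ.symm)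
      (0 : EuclideanSpace ℝ (Fin (2 * r')) →L[ℝ] EuclideanSpace ℝ (Fin (n - 2 * r'))) y :=
    fun y hy => by
    have h₀ := mdifferentiableAt_of_contMDiffOn hfc hV hy.2
    have h₁ := mfderiv_comp y h₀ (mdifferentiableAt_symm_of_mem φ hy.1)
    rw [hfd _ hy.2, mfderiv_eq_fderiv] at h₁
    have h₂ : DifferentiableAt ℝ (f ∘ φ.symm) y :=
      mdifferentiableAt_iff_differentiableAt.1 (h₀.comp y (mdifferentiableAt_symm_of_mem φ hy.1))
    have h₃ := h₂.hasFDerivAt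
    rw [show fderiv ℝ (f ∘ φ.symm) y = 0 from h₁.trans (ContinuousLinearMap.zero_comp _)] at h₃
    exact h₃
  have hc : ContinuousAt φ σ := φ.contMDiffOn.continuousOn.continuousAt (φ.open_source.mem_nhds hσφ)
  filter_upwards [φ.open_source.mem_nhds hσφ, hc.eventually (Metric.ball_mem_nhds _ hε)] with τ h₁ h₂
  have := (convex_ball (φ σ) ε).is_const_of_fderivWithin_eq_zero (𝕜 := ℝ) (f := f ∘ φ.symm)
    (fun y hy => (hgd y (hεO hy)).differentiableAt.differentiableWithinAt)
    (fun y hy => (hgd y (hεO hy)).hasFDerivWithinAt.fderivWithin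
      (Metric.isOpen_ball.uniqueDiffWithinAt hy)) h₂ (Metric.mem_ball_self hε)
  rwa [Function.comp_apply, Function.comp_apply, symm_apply_apply φ h₁,
    symm_apply_apply φ hσφ] at this

end Transverse

end SplitSystem

end

open scoped Manifold ContDiff Topology

noncomputable section

namespace SplitSystem

open Set Filter

/-! ### Induced structures and local isomorphisms -/

section Induced

variable {E : Type*} [NormedAddCommGroup E] [NormedSpace ℝ E]
  {H : Type*} [TopologicalSpace H] {I : ModelWithCorners ℝ E H}
  {M : Type*} [TopologicalSpace M] [ChartedSpace H M]
  {F : Type*} [NormedAddCommGroup F] [NormedSpace ℝ F]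
  {G : Type*} [TopologicalSpace G] {J : ModelWithCorners ℝ F G}
  {N : Type*} [TopologicalSpace N] [ChartedSpace G N]
  {π : SharpField I M} {i : N → M} {πN : SharpField J N} {W : Set N}

/-- The value of an induced bivector field is determined by any extension with tangent image. -/
lemma IsInducedOn.eq_of_extension (h : IsInducedOn π i πN W) {x : N} (hx : x ∈ W)
    (hskew : ∀ α β : TangentSpace I (i x) →L[ℝ] ℝ, β (π (i x) α) = -α (π (i x) β))
    {β : TangentSpace J x →L[ℝ] ℝ} {u : TangentSpace J x} {α : TangentSpace I (i x) →L[ℝ] ℝ}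
    (hα : α.comp (mfderiv J I i x) = β) (hu : mfderiv J I i x u = π (i x) α) :
    πN x β = u := by
  obtain ⟨α', hα', hu'⟩ := h x hx β
  -- Extend δ to γ with tangent ♯. Skewness turns both pairings into values of α and α' on γ♯, where
  -- the two extensions of β agree.
  have key : ∀ δ : F →L[ℝ] ℝ, δ (πN x β : F) = δ u := fun δ => by
    obtain ⟨γ, hγ, hγ'⟩ := h x hx δ
    have h₁ : ∀ w : TangentSpace J x, δ w = γ (mfderiv J I i x w) := fun w =>
      (DFunLike.congr_fun hγ w).symm
    have h₂ : α (mfderiv J I i x (πN x δ)) = α' (mfderiv J I i x (πN x δ)) :=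
      DFunLike.congr_fun (hα.trans hα'.symm) (πN x δ)
    refine (h₁ _).trans (Eq.trans ?_ (h₁ u).symm)
    rw [hu', hu, hskew, hskew α, ← hγ', h₂]
  exact (SeparatingDual.eq_iff_forall_dual_eq (R := ℝ) (V := F)).2 key

lemma IsPoissonOn.mono {U V : Set M} (h : IsPoissonOn π U) (hVU : V ⊆ U) : IsPoissonOn π V :=
  ⟨fun x hx => h.skew x (hVU hx), fun V' hV' hV'V => h.smooth V' hV' (hV'V.trans hVU),
    fun V' hV' hV'V => h.jacobi V' hV' (hV'V.trans hVU)⟩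

/-- Integrable systems are transported by isomorphisms, the existence of points of maximal rank
being required separately. -/
lemma IsSystemIso.isIntegrableOn {DM : Distribution I M} {DN : Distribution J N}
    {Φ : PartialDiffeomorph I J M N ∞} (h : IsSystemIso Φ π DM πN DN) {U : Set N} {k : ℕ}
    (hN : IsIntegrableOn πN DN U k) (hU : Φ.target ⊆ U)
    (hdim : Module.finrank ℝ E = Module.finrank ℝ F) (hr : ∃ y ∈ Φ.target, rankAt πN y = 2 * k) :
    IsIntegrableOn π DM Φ.source k := by
  refine ⟨h.symm.isPoissonOn (hN.poisson.mono hU), ⟨fun x hx => ?_, ?_⟩, fun x hx => ?_⟩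
  · rw [← h.rankAt_eq hx]
    exact hN.rank.1 _ (hU (apply_mem_target Φ hx))
  · obtain ⟨y, hy, hyk⟩ := hr
    exact ⟨Φ.symm y, symm_mem_source Φ hy, (h.symm.rankAt_eq hy).trans hyk⟩
  · obtain ⟨V, hV, hxV, -, m, f, hm, hf, hff⟩ := hN.foliation (Φ x) (hU (apply_mem_target Φ hx))
    refine ⟨Φ.source ∩ Φ ⁻¹' V, Φ.contMDiffOn.continuousOn.isOpen_inter_preimage Φ.open_source hV,
      ⟨hx, hxV⟩, inter_subset_left, m, fun j => f j ∘ Φ, hm.trans hdim.symm, h.definesOn hV hf,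
      fun j l y hy => ?_⟩
    rw [← h.bracket hy.1 (mdifferentiableAt_of_contMDiffOn (hf.smooth j) hV hy.2)
      (mdifferentiableAt_of_contMDiffOn (hf.smooth l) hV hy.2)]
    exact hff j l _ hy.2

lemma LocallyIsomorphic.trans {E' : Type*} [NormedAddCommGroup E'] [NormedSpace ℝ E']
    {H' : Type*} [TopologicalSpace H'] {K : ModelWithCorners ℝ E' H'}
    {L : Type*} [TopologicalSpace L] [ChartedSpace H' L] {πL : SharpField K L}
    {DM : Distribution I M} {DN : Distribution J N} {DL : Distribution K L}
    {U : Set M} {U' : Set L} {x : M} {y : N} {z : L}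
    (h : LocallyIsomorphic π DM U x πN DN W y) (h' : LocallyIsomorphic πN DN W y πL DL U' z) :
    LocallyIsomorphic π DM U x πL DL U' z := by
  obtain ⟨Φ, hx, hU, -, rfl, hΦ⟩ := h
  obtain ⟨Ψ, hy, -, hU', rfl, hΨ⟩ := h'
  refine ⟨Φ.trans Ψ, ⟨hx, hy⟩, fun w hw => hU hw.1, fun w hw => hU' ?_, rfl, hΦ.trans hΨ⟩
  have hw' := symm_mem_source (Φ.trans Ψ) hw
  rw [← apply_symm_apply (Φ.trans Ψ) hw]
  exact apply_mem_target Ψ hw'.2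

/-- A diffeomorphism that matches the foliations and realizes the bivector field of its target by
extensions with tangent image is an isomorphism from any induced system. -/
lemma IsInducedOn.isSystemIso {E' : Type*} [NormedAddCommGroup E'] [NormedSpace ℝ E']
    {H' : Type*} [TopologicalSpace H'] {K : ModelWithCorners ℝ E' H'}
    {L : Type*} [TopologicalSpace L] [ChartedSpace H' L] {πL : SharpField K L}
    {DN : Distribution J N} {DL : Distribution K L} {Ψ : PartialDiffeomorph J K N L ∞}
    (h : IsInducedOn π i πN W) (hW : Ψ.source ⊆ W)
    (hskew : ∀ x, ∀ α β : TangentSpace I x →L[ℝ] ℝ, β (π x α) = -α (π x β))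
    (hΨ : ∀ x ∈ Ψ.source, (DN x).map (mfderiv J K Ψ x).toLinearMap = DL (Ψ x) ∧
      ∀ (β : TangentSpace J x →L[ℝ] ℝ) (c : TangentSpace K (Ψ x) →L[ℝ] ℝ) (u : TangentSpace J x),
        c.comp (mfderiv J K Ψ x) = β → mfderiv J K Ψ x u = πL (Ψ x) c →
        ∃ α : TangentSpace I (i x) →L[ℝ] ℝ, α.comp (mfderiv J I i x) = β ∧
          mfderiv J I i x u = π (i x) α) :
    IsSystemIso Ψ πN DN πL DL := by
  intro x hx
  refine ⟨fun c => ?_, (hΨ x hx).1⟩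
  obtain ⟨u, hu⟩ := (mfderivEquiv Ψ hx).surjective (πL (Ψ x) c)
  obtain ⟨α, hα, hα'⟩ := (hΨ x hx).2 _ c u rfl hu
  rw [h.eq_of_extension (hW hx) (hskew _) hα hα']
  exact hu

end Induced

/-! ### Rank of a product. -/

section Rank

variable {E₁ E₂ : Type*} [NormedAddCommGroup E₁] [NormedSpace ℝ E₁] [FiniteDimensional ℝ E₁]
  [NormedAddCommGroup E₂] [NormedSpace ℝ E₂] [FiniteDimensional ℝ E₂]

/-- The characteristic space of the product embeds in E₁ times that of the second factor. The bound
serves to transfer points of maximal rank from M to the ball. -/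
lemma rankAt_prodSharp_le (π₁ : SharpField 𝓘(ℝ, E₁) E₁) (π₂ : SharpField 𝓘(ℝ, E₂) E₂)
    (z : E₁ × E₂) : rankAt (prodSharp π₁ π₂) z ≤ Module.finrank ℝ E₁ + rankAt π₂ z.2 := by
  have key : ∀ (Q : Submodule ℝ (E₁ × E₂)) (R : Submodule ℝ E₂), (∀ u ∈ Q, u.2 ∈ R) →
      Module.finrank ℝ Q ≤ Module.finrank ℝ E₁ + Module.finrank ℝ R := fun Q R h => by
    let f : Q →ₗ[ℝ] E₁ × R := (LinearMap.fst ℝ E₁ E₂ ∘ₗ Q.subtype).prod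
      ((LinearMap.snd ℝ E₁ E₂ ∘ₗ Q.subtype).codRestrict R fun u => h u u.2)
    have hf : Function.Injective f := fun u w huw => by
      have h₁ : f u = f w := huw
      have h₂ : (u : E₁ × E₂).1 = (w : E₁ × E₂).1 := congrArg (fun q : E₁ × R => q.1) h₁
      have h₃ : (u : E₁ × E₂).2 = (w : E₁ × E₂).2 := congrArg (fun q : E₁ × R => (q.2 : E₂)) h₁
      exact Subtype.ext (Prod.ext h₂ h₃)
    exact (LinearMap.finrank_le_finrank_of_injective hf).trans_eq Module.finrank_prod
  refine key _ (charSpace π₂ z.2) ?_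
  rintro _ ⟨α, rfl⟩
  let α' : E₁ × E₂ →L[ℝ] ℝ := α
  exact ⟨α'.comp (ContinuousLinearMap.inr ℝ E₁ E₂),
    congrArg Prod.snd (prodSharp_eq_blockSharp (π₁ := π₁) (π₂ := π₂) z α').symm⟩

end Rank

section Finrank

variable {E : Type*} [NormedAddCommGroup E] [NormedSpace ℝ E] [FiniteDimensional ℝ E]
  {H : Type*} [TopologicalSpace H] {I : ModelWithCorners ℝ E H}
  {M : Type*} [TopologicalSpace M] [ChartedSpace H M]

lemma DefinesOn.finrank_eq {D : Distribution I M} {m k : ℕ} {f : Fin m → M → ℝ} {V : Set M}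
    (hf : DefinesOn f D V) (hk : k + m = Module.finrank ℝ E) {x : M} (hx : x ∈ V) :
    Module.finrank ℝ (D x) = k :=
  (finrank_of_definesOn (E := E) (hf.independent x hx) (hf.tangent x hx) hk).2

end Finrank

/-! ### Slices of split charts and comparison of two split charts. -/

section Slice

variable {EM : Type*} [NormedAddCommGroup EM] [NormedSpace ℝ EM]
  {M : Type*} [TopologicalSpace M] [ChartedSpace EM M]
  {E₁ E₂ : Type} [NormedAddCommGroup E₁] [NormedSpace ℝ E₁] [FiniteDimensional ℝ E₁]
  [NormedAddCommGroup E₂] [NormedSpace ℝ E₂] [FiniteDimensional ℝ E₂]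
  {Φ : PartialDiffeomorph 𝓘(ℝ, EM) (𝓘(ℝ, E₁).prod 𝓘(ℝ, E₂)) M (E₁ × E₂) ∞}
  {π : SharpField 𝓘(ℝ, EM) M} {D : Distribution 𝓘(ℝ, EM) M}
  {π₁ : SharpField 𝓘(ℝ, E₁) E₁} {D₁ : Distribution 𝓘(ℝ, E₁) E₁}
  {π₂ : SharpField 𝓘(ℝ, E₂) E₂} {D₂ : Distribution 𝓘(ℝ, E₂) E₂} {U : Set E₂} {k : ℕ} {s : M}

/-- The Poisson factor of a split chart embeds as a transversal that carries its structure as the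
induced one. -/
lemma IsSplitChart.exists_slice (h : IsSplitChart Φ π D π₁ D₁ π₂ D₂ U k s) :
    ∃ (i : E₂ → M) (W : Set E₂), IsOpen W ∧ (Φ s).2 ∈ W ∧ W ⊆ U ∧ i (Φ s).2 = s ∧
      ContMDiffOn 𝓘(ℝ, E₂) 𝓘(ℝ, EM) ∞ i W ∧
      (∀ y ∈ W, inducedDistribution 𝓘(ℝ, E₂) D i y = D₂ y) ∧ IsInducedOn π i π₂ W ∧
      ∀ u : E₂, (mfderiv 𝓘(ℝ, E₂) 𝓘(ℝ, EM) i (Φ s).2 u : EM)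
        ∈ (charSpace π (i (Φ s).2) : Submodule ℝ EM) → u = 0 := by
  set b := (Φ s).2 with hb
  set v := (Φ s).1 with hv
  -- On the slice through v, a covector c of E₂ extends as c ∘ snd, whose ♯ is again tangent to the
  -- slice; hence the induced bivector is that of the second factor.
  let j : E₂ → E₁ × E₂ := fun y => (v, y)
  let W : Set E₂ := j ⁻¹' Φ.target
  have hW : IsOpen W := Φ.open_target.preimage (Continuous.prodMk_right v)
  have hbW : b ∈ W := apply_mem_target Φ h.mem
  let i : E₂ → M := Φ.symm ∘ j
  have hib : i b = s := symm_apply_apply Φ h.mem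
  have hjc : ContMDiff 𝓘(ℝ, E₂) (𝓘(ℝ, E₁).prod 𝓘(ℝ, E₂)) ∞ j := contMDiff_const.prodMk contMDiff_id
  have hi : ContMDiffOn 𝓘(ℝ, E₂) 𝓘(ℝ, EM) ∞ i W :=
    Φ.symm.contMDiffOn.comp hjc.contMDiffOn fun y hy => hy
  have hΦi : ∀ y ∈ W, Φ (i y) = (v, y) := fun y hy => apply_symm_apply Φ hy
  have his : ∀ y ∈ W, i y ∈ Φ.source := fun y hy => symm_mem_source Φ hy
  let dI : E₂ → (E₂ →L[ℝ] EM) := fun y => mfderiv 𝓘(ℝ, E₂) 𝓘(ℝ, EM) i y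
  let dΦ : M → (EM →L[ℝ] E₁ × E₂) := fun x => mfderiv 𝓘(ℝ, EM) (𝓘(ℝ, E₁).prod 𝓘(ℝ, E₂)) Φ x
  have hdi : ∀ y ∈ W, ∀ u : E₂, dΦ (i y) (dI y u) = (0, u) := fun y hy u => by
    have e₁ := mfderiv_comp y (mdifferentiableAt_of_mem Φ (his y hy))
      (mdifferentiableAt_of_contMDiffOn hi hW hy)
    have e₂ : (Φ ∘ i) =ᶠ[𝓝 y] j := by
      filter_upwards [hW.mem_nhds hy] with z hz using hΦi z hz
    have e₃ := mfderiv_prodMk (x := y)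
      (mdifferentiableAt_const (I := 𝓘(ℝ, E₂)) (I' := 𝓘(ℝ, E₁)) (c := v))
      (mdifferentiableAt_id (I := 𝓘(ℝ, E₂)))
    rw [mfderiv_const, mfderiv_id] at e₃
    exact DFunLike.congr_fun (e₁.symm.trans (e₂.mfderiv_eq.trans e₃)) u
  refine ⟨i, W, hW, hbW, fun y hy => h.snd_mem _ hy, hib, hi, fun y hy => ?_, fun y hy c => ?_,
    fun u hu => ?_⟩
  · refine SetLike.ext fun (u : E₂) => ?_
    have e₁ := h.iso.mem_distribution_iff (his y hy) (dI y u)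
    have e₂ : ∀ z w : E₁ × E₂, z = (v, y) → w = (0, u) →
        (w ∈ (prodDistribution D₁ D₂ z : Submodule ℝ (E₁ × E₂))
          ↔ u ∈ (D₂ y : Submodule ℝ E₂)) := by
      rintro _ _ rfl rfl
      exact (mem_prodDistribution (v, y) 0 u).trans (and_iff_right (zero_mem _))
    exact e₁.symm.trans (e₂ _ _ (hΦi y hy) (hdi y hy u))
  · let c' : E₂ →L[ℝ] ℝ := c
    let γ : E₁ × E₂ →L[ℝ] ℝ := c'.comp (ContinuousLinearMap.snd ℝ E₁ E₂)
    refine ⟨γ.comp (dΦ (i y)), ?_, injective_mfderiv Φ (his y hy) ?_⟩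
    · refine ContinuousLinearMap.ext fun (u : E₂) => ?_
      exact congrArg γ (hdi y hy u)
    · have e : ∀ z : E₁ × E₂, z = (v, y) →
          blockSharp (sharpCLM π₁) (sharpCLM π₂) z γ = (0, sharpCLM π₂ y c') := by
        rintro _ rfl
        have g₁ : γ.comp (ContinuousLinearMap.inl ℝ E₁ E₂) = 0 := by
          ext u
          simp [γ]
        have g₂ : γ.comp (ContinuousLinearMap.inr ℝ E₁ E₂) = c' := by
          ext u
          simp [γ]
        rw [blockSharp_apply, g₁, g₂, map_zero]
      exact (hdi y hy (sharpCLM π₂ y c')).trans (((h.iso _ (his y hy)).1 γ).trans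
        ((prodSharp_eq_blockSharp _ γ).trans (e _ (hΦi y hy)))).symm
  -- At the base point the second bivector vanishes, so a characteristic vector has no E₂-component,
  -- whereas the slice direction (0, u) has nothing else.
  · have e₁ : dΦ (i b) (dI b u) ∈ (charSpace (prodSharp π₁ π₂) (Φ (i b)) :
        Submodule ℝ (E₁ × E₂)) := by
      rw [← h.iso.charSpace_map (his b hbW)]
      exact ⟨_, hu, rfl⟩
    rw [hdi b hbW] at e₁
    obtain ⟨γ, hγ⟩ := e₁
    have e₂ := congrArg Prod.snd ((prodSharp_eq_blockSharp (Φ (i b)) γ).symm.trans hγ)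
    have e₃ : ∀ (z : E₁ × E₂) (γ : E₁ × E₂ →L[ℝ] ℝ), z = Φ s →
        (blockSharp (sharpCLM π₁) (sharpCLM π₂) z γ).2 = 0 := by
      rintro _ γ rfl
      rw [blockSharp_apply, h.vanish]
      rfl
    exact e₂.symm.trans (e₃ _ γ (congrArg Φ hib))

variable {Φ' : PartialDiffeomorph 𝓘(ℝ, EM) (𝓘(ℝ, E₁).prod 𝓘(ℝ, E₂)) M (E₁ × E₂) ∞}
  {π₁' : SharpField 𝓘(ℝ, E₁) E₁} {D₁' : Distribution 𝓘(ℝ, E₁) E₁}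
  {π₂' : SharpField 𝓘(ℝ, E₂) E₂} {D₂' : Distribution 𝓘(ℝ, E₂) E₂} {U' : Set E₂} {r r₂ : ℕ}

/-- A slice of the first chart is a compatible transversal carrying the first Poisson factor; the
second chart identifies the structure induced on any such transversal with its own factor. -/
lemma IsSplitChart.locallyIsomorphic (h : IsSplitChart Φ π D π₁ D₁ π₂ D₂ U k s)
    (h' : IsSplitChart Φ' π D π₁' D₁' π₂' D₂' U' k s) (hint : IsIntegrableOn π D univ r)
    (h₂ : IsIntegrableOn π₂ D₂ U r₂) (hU' : IsOpen U') (h₂' : IsIntegrableOn π₂' D₂' U' r₂) :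
    LocallyIsomorphic π₂ D₂ U (Φ s).2 π₂' D₂' U' (Φ' s).2 := by
  obtain ⟨i, W, hW, hbW, hWU, hib, hi, hD, hind, htr⟩ := h.exists_slice
  obtain ⟨Ψ, hb, hΨW, hΨU, hΨb, hΨ⟩ := h'.exists_induced_iso hint hU' h₂' hib hW hbW hi htr rfl
    fun y hy => by
      rw [hD y hy]
      obtain ⟨_, _, -, -, -, hr⟩ := exists_functions h₂ (hWU hy)
      exact hr.self_of_nhds
  refine ⟨Ψ, hb, hΨW.trans hWU, hΨU, hΨb, ?_⟩
  refine hind.isSystemIso hΨW (fun x => hint.poisson.skew x (mem_univ x)) fun y hy => ?_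
  rw [← hD y (hΨW hy)]
  exact hΨ y hy

end Slice

/-! ### Comparison of transversals and transverse systems, at one point and along the leaf. -/

section Main

variable {n r r' : ℕ}
  {M : Type*} [TopologicalSpace M] [ChartedSpace (EuclideanSpace ℝ (Fin n)) M]
  {π : SharpField (𝓡 n) M} {D : Distribution (𝓡 n) M}
  {S : Type*} [TopologicalSpace S] [ChartedSpace (EuclideanSpace ℝ (Fin (2 * r'))) S]
  [IsManifold (𝓡 (2 * r')) ∞ S] {ι : S → M} {σ : S} {B : BallSystem (n - 2 * r')}
  {T : Type*} [TopologicalSpace T] [ChartedSpace (EuclideanSpace ℝ (Fin (n - 2 * r'))) T]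
  [IsManifold (𝓡 (n - 2 * r')) ∞ T] {i : T → M} {t : T}

/-- Near a point of a compatible transversal, a transverse system is realized by the transversal. -/
lemma IsTransverseSystem.exists_diffeo (hB : IsTransverseSystem π D r r' ι σ B)
    (hint : IsIntegrableOn π D univ r) (hleaf : IsSymplecticLeaf (𝓡 (2 * r')) π ι)
    (hreg : IsRegularLeaf (𝓡 (2 * r')) D ι r') (hit : i t = ι σ)
    (hT : IsCompatibleTransversal (𝓡 (n - 2 * r')) π D i t (r - r')) :
    ∃ Ψ : PartialDiffeomorph (𝓡 (n - 2 * r')) (𝓡 (n - 2 * r')) T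
        (EuclideanSpace ℝ (Fin (n - 2 * r'))) ∞, t ∈ Ψ.source ∧ Ψ.target ⊆ B.ball ∧
      Ψ t = B.base ∧ ∀ x ∈ Ψ.source,
        (inducedDistribution (𝓡 (n - 2 * r')) D i x).map
          (mfderiv (𝓡 (n - 2 * r')) (𝓡 (n - 2 * r')) Ψ x).toLinearMap = B.distribution (Ψ x) ∧
        ∀ (β : TangentSpace (𝓡 (n - 2 * r')) x →L[ℝ] ℝ)
          (c : TangentSpace (𝓡 (n - 2 * r')) (Ψ x) →L[ℝ] ℝ)
          (u : TangentSpace (𝓡 (n - 2 * r')) x),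
          c.comp (mfderiv (𝓡 (n - 2 * r')) (𝓡 (n - 2 * r')) Ψ x) = β →
          mfderiv (𝓡 (n - 2 * r')) (𝓡 (n - 2 * r')) Ψ x u = B.sharp (Ψ x) c →
          ∃ α : TangentSpace (𝓡 n) (i x) →L[ℝ] ℝ,
            α.comp (mfderiv (𝓡 (n - 2 * r')) (𝓡 n) i x) = β ∧
            mfderiv (𝓡 (n - 2 * r')) (𝓡 n) i x u = π (i x) α := by
  obtain ⟨Φ, π₁, D₁, hΦ, hb⟩ := hB.exists_splitChart hint hleaf hreg
  obtain ⟨W, hW, htW, hF⟩ := hT.compatible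
  obtain ⟨V, hV, htV, -, m, f, hm, hf⟩ := hF t htW
  have htr : ∀ u : EuclideanSpace ℝ (Fin (n - 2 * r')),
      (mfderiv (𝓡 (n - 2 * r')) (𝓡 n) i t u : EuclideanSpace ℝ (Fin n))
        ∈ (charSpace π (i t) : Submodule ℝ (EuclideanSpace ℝ (Fin n))) → u = 0 := fun u hu => by
    have h₀ := (Submodule.disjoint_def.1 hT.transversal.transverse.disjoint)
      (mfderiv (𝓡 (n - 2 * r')) (𝓡 n) i t u) ⟨u, rfl⟩ hu
    exact hT.transversal.submanifold.immersion t (h₀.trans (map_zero _).symm)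
  obtain ⟨Ψ, h₁, -, h₂, h₃, h₄⟩ := hΦ.exists_induced_iso hint Metric.isOpen_ball hB.1 hit hV htV
    hT.transversal.submanifold.smooth.contMDiffOn htr rfl fun x hx => hf.finrank_eq hm hx
  exact ⟨Ψ, h₁, h₂, h₃.trans hb, h₄⟩

/-- Any system induced on a compatible transversal is locally isomorphic to any transverse
system. -/
lemma IsTransverseSystem.locallyIsomorphic_induced (hB : IsTransverseSystem π D r r' ι σ B)
    (hint : IsIntegrableOn π D univ r) (hleaf : IsSymplecticLeaf (𝓡 (2 * r')) π ι)
    (hreg : IsRegularLeaf (𝓡 (2 * r')) D ι r') (hit : i t = ι σ)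
    (hT : IsCompatibleTransversal (𝓡 (n - 2 * r')) π D i t (r - r')) {W : Set T}
    {πT : SharpField (𝓡 (n - 2 * r')) T} (hW : IsOpen W) (htW : t ∈ W)
    (hπT : IsInducedOn π i πT W) :
    LocallyIsomorphic πT (inducedDistribution (𝓡 (n - 2 * r')) D i) W t
      B.sharp B.distribution B.ball B.base := by
  obtain ⟨Ψ, h₁, h₂, h₃, h₄⟩ := hB.exists_diffeo hint hleaf hreg hit hT
  refine ⟨restrictOpen Ψ hW, ⟨h₁, htW⟩, fun x hx => hx.2,
    (restrictOpen_target_subset Ψ hW).trans h₂, h₃, ?_⟩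
  exact hπT.isSystemIso (fun x hx => hx.2) (fun x => hint.poisson.skew x (mem_univ x))
    fun x hx => h₄ x hx.1

/-- A compatible transversal of a split system carries an induced integrable system. -/
lemma IsTransverseSystem.exists_induced (hB : IsTransverseSystem π D r r' ι σ B)
    (hint : IsIntegrableOn π D univ r) (hleaf : IsSymplecticLeaf (𝓡 (2 * r')) π ι)
    (hreg : IsRegularLeaf (𝓡 (2 * r')) D ι r')
    (hgen : ι σ ∈ closure {x | rankAt π x = 2 * r}) (hit : i t = ι σ)
    (hT : IsCompatibleTransversal (𝓡 (n - 2 * r')) π D i t (r - r')) :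
    ∃ (W : Set T) (πT : SharpField (𝓡 (n - 2 * r')) T), IsOpen W ∧ t ∈ W ∧
      IsInducedOn π i πT W ∧
      IsIntegrableOn πT (inducedDistribution (𝓡 (n - 2 * r')) D i) W (r - r') := by
  obtain ⟨Ψ, h₁, h₂, h₃, h₄⟩ := hB.exists_diffeo hint hleaf hreg hit hT
  -- The candidate is the bivector of the ball pulled back through Ψ; the covector property of Ψ is
  -- precisely the Poisson-Dirac condition for it.
  have hind : IsInducedOn π i (pushSharp Ψ.symm B.sharp) Ψ.source := fun x hx β => by
    let β' : EuclideanSpace ℝ (Fin (n - 2 * r')) →L[ℝ] ℝ := β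
    let A : EuclideanSpace ℝ (Fin (n - 2 * r')) →L[ℝ] EuclideanSpace ℝ (Fin (n - 2 * r')) :=
      mfderiv (𝓡 (n - 2 * r')) (𝓡 (n - 2 * r')) Ψ.symm (Ψ x)
    refine (h₄ x hx).2 β (β'.comp A) _ ?_ ?_
    · exact (ContinuousLinearMap.comp_assoc _ _ _).trans
        ((congrArg (ContinuousLinearMap.comp β') (mfderiv_symm_comp_mfderiv Ψ hx)).trans
          (ContinuousLinearMap.comp_id _))
    · exact DFunLike.congr_fun (mfderiv_comp_mfderiv_symm Ψ hx) (B.sharp (Ψ x) (β'.comp A))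
  have hiso := hind.isSystemIso (Ψ := Ψ) subset_rfl
    (fun x => hint.poisson.skew x (mem_univ x)) h₄
  refine ⟨Ψ.source, _, Ψ.open_source, h₁, hind, hiso.isIntegrableOn hB.1 h₂ rfl ?_⟩
  obtain ⟨Φ, π₁, D₁, hΦ, hb⟩ := hB.exists_splitChart hint hleaf hreg
  have hO : IsOpen (Φ.source ∩ Φ ⁻¹' (Prod.snd ⁻¹' Ψ.target)) :=
    Φ.contMDiffOn.continuousOn.isOpen_inter_preimage Φ.open_source
      (Ψ.open_target.preimage continuous_snd)
  have hsO : ι σ ∈ Φ.source ∩ Φ ⁻¹' (Prod.snd ⁻¹' Ψ.target) := by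
    refine ⟨hΦ.mem, ?_⟩
    change (Φ (ι σ)).2 ∈ Ψ.target
    rw [hb, ← h₃]
    exact apply_mem_target Ψ h₁
  -- The only missing point is that the rank 2(r - r') is attained near t. A point of rank 2r of M
  -- close to ι σ has a ball component of rank at least 2r - 2r', and the rank on the ball is at
  -- most 2(r - r').
  obtain ⟨x, hx, hxr⟩ := mem_closure_iff.1 hgen _ hO hsO
  refine ⟨(Φ x).2, hx.2, ?_⟩
  have h₅ := hB.1.rank.1 _ (h₂ hx.2)
  have h₆ := rankAt_prodSharp_le π₁ B.sharp (Φ x)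
  have h₇ : rankAt π x = 2 * r := hxr
  rw [hΦ.iso.rankAt_eq hx.1, h₇, hΦ.finrank_eq] at h₆
  omega

/-- Two transverse systems at a point are locally isomorphic. -/
lemma IsTransverseSystem.locallyIsomorphic {B' : BallSystem (n - 2 * r')}
    (hB : IsTransverseSystem π D r r' ι σ B) (hB' : IsTransverseSystem π D r r' ι σ B')
    (hint : IsIntegrableOn π D univ r) (hleaf : IsSymplecticLeaf (𝓡 (2 * r')) π ι)
    (hreg : IsRegularLeaf (𝓡 (2 * r')) D ι r') :
    LocallyIsomorphic B.sharp B.distribution B.ball B.base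
      B'.sharp B'.distribution B'.ball B'.base := by
  obtain ⟨Φ, π₁, D₁, hΦ, hb⟩ := hB.exists_splitChart hint hleaf hreg
  obtain ⟨Φ', π₁', D₁', hΦ', hb'⟩ := hB'.exists_splitChart hint hleaf hreg
  rw [← hb, ← hb']
  exact hΦ.locallyIsomorphic hΦ' hint hB.1 Metric.isOpen_ball hB'.1

/-- Transverse systems at two points of the leaf of a split system are locally isomorphic. -/
lemma locallyIsomorphic_of_isSplitAt (hsplit : ∀ τ, IsSplitAt π D r r' ι τ)
    (hint : IsIntegrableOn π D univ r) (hleaf : IsSymplecticLeaf (𝓡 (2 * r')) π ι)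
    (hreg : IsRegularLeaf (𝓡 (2 * r')) D ι r') {σ' : S} {B' : BallSystem (n - 2 * r')}
    (hB : IsTransverseSystem π D r r' ι σ B) (hB' : IsTransverseSystem π D r r' ι σ' B') :
    LocallyIsomorphic B.sharp B.distribution B.ball B.base
      B'.sharp B'.distribution B'.ball B'.base := by
  -- A consists of the points having some transverse system locally isomorphic to B. Openness of A
  -- and of its complement follow because a transverse system persists nearby; for the complement,
  -- two such systems at a common point are compared.
  let A : Set S := {τ | ∃ C : BallSystem (n - 2 * r'), IsTransverseSystem π D r r' ι τ C ∧
    LocallyIsomorphic B.sharp B.distribution B.ball B.base C.sharp C.distribution C.ball C.base}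
  have hA : IsClopen A := by
    refine ⟨isOpen_compl_iff.1 (isOpen_iff_mem_nhds.2 fun τ hτ => ?_),
      isOpen_iff_mem_nhds.2 fun τ ⟨C, hC, hBC⟩ => ?_⟩
    · obtain ⟨C, hC⟩ := hsplit τ
      filter_upwards [hC.eventually hint hleaf] with τ' hC' ⟨C', hC'', hBC'⟩
      exact hτ ⟨C, hC, hBC'.trans (hC''.locallyIsomorphic hC' hint hleaf hreg)⟩
    · filter_upwards [hC.eventually hint hleaf] with τ' hC' using ⟨C, hC', hBC⟩
  have := hleaf.connected
  obtain ⟨C, hC, hBC⟩ : σ' ∈ A := by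
    rw [hA.eq_univ ⟨σ, B, hB, hB.locallyIsomorphic hB hint hleaf hreg⟩]
    trivial
  exact hBC.trans (hC.locallyIsomorphic hB' hint hleaf hreg)

end Main

end SplitSystem

end

theorem mainTheorem5 (n r r' : ℕ)
    {M : Type*} [TopologicalSpace M] [T2Space M] [ChartedSpace (EuclideanSpace ℝ (Fin n)) M]
    [IsManifold (𝓡 n) ∞ M]
    (π : SplitSystem.SharpField (𝓡 n) M) (D : SplitSystem.Distribution (𝓡 n) M)
    (hint : SplitSystem.IsIntegrableOn π D Set.univ r)
    {S : Type*} [TopologicalSpace S] [ChartedSpace (EuclideanSpace ℝ (Fin (2 * r'))) S]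
    [IsManifold (𝓡 (2 * r')) ∞ S]
    (ι : S → M) (hleaf : SplitSystem.IsSymplecticLeaf (𝓡 (2 * r')) π ι)
    (hreg : SplitSystem.IsRegularLeaf (𝓡 (2 * r')) D ι r')
    (hgen : ∀ σ : S, ι σ ∈ closure {x | SplitSystem.rankAt π x = 2 * r}) :
    -- the system is split at one point of the leaf
    (∀ σ : S, SplitSystem.IsSplitAt π D r r' ι σ →
      (∀ (T : Type*) [TopologicalSpace T]
        [ChartedSpace (EuclideanSpace ℝ (Fin (n - 2 * r'))) T]
        [IsManifold (𝓡 (n - 2 * r')) ∞ T] (i : T → M) (t : T), i t = ι σ →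
        SplitSystem.IsCompatibleTransversal (𝓡 (n - 2 * r')) π D i t (r - r') →
        (∃ (W : Set T) (πT : SplitSystem.SharpField (𝓡 (n - 2 * r')) T),
          IsOpen W ∧ t ∈ W ∧ SplitSystem.IsInducedOn π i πT W ∧
          SplitSystem.IsIntegrableOn πT
            (SplitSystem.inducedDistribution (𝓡 (n - 2 * r')) D i) W (r - r')) ∧
        ∀ (W : Set T) (πT : SplitSystem.SharpField (𝓡 (n - 2 * r')) T),
          IsOpen W → t ∈ W → SplitSystem.IsInducedOn π i πT W →
          ∀ B : SplitSystem.BallSystem (n - 2 * r'),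
            SplitSystem.IsTransverseSystem π D r r' ι σ B →
            SplitSystem.LocallyIsomorphic πT
              (SplitSystem.inducedDistribution (𝓡 (n - 2 * r')) D i) W t
              B.sharp B.distribution B.ball B.base) ∧
      ∀ B B' : SplitSystem.BallSystem (n - 2 * r'),
        SplitSystem.IsTransverseSystem π D r r' ι σ B →
        SplitSystem.IsTransverseSystem π D r r' ι σ B' →
        SplitSystem.LocallyIsomorphic B.sharp B.distribution B.ball B.base
          B'.sharp B'.distribution B'.ball B'.base) ∧
    -- the system is split at every point of the leaf
    ((∀ σ : S, SplitSystem.IsSplitAt π D r r' ι σ) → ∀ σ σ' : S,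
      (∀ (T : Type*) [TopologicalSpace T]
        [ChartedSpace (EuclideanSpace ℝ (Fin (n - 2 * r'))) T]
        [IsManifold (𝓡 (n - 2 * r')) ∞ T] (i : T → M) (t : T), i t = ι σ →
        SplitSystem.IsCompatibleTransversal (𝓡 (n - 2 * r')) π D i t (r - r') →
        ∀ (W : Set T) (πT : SplitSystem.SharpField (𝓡 (n - 2 * r')) T),
          IsOpen W → t ∈ W → SplitSystem.IsInducedOn π i πT W →
          ∀ B : SplitSystem.BallSystem (n - 2 * r'),
            SplitSystem.IsTransverseSystem π D r r' ι σ' B →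
            SplitSystem.LocallyIsomorphic πT
              (SplitSystem.inducedDistribution (𝓡 (n - 2 * r')) D i) W t
              B.sharp B.distribution B.ball B.base) ∧
      ∀ B B' : SplitSystem.BallSystem (n - 2 * r'),
        SplitSystem.IsTransverseSystem π D r r' ι σ B →
        SplitSystem.IsTransverseSystem π D r r' ι σ' B' →
        SplitSystem.LocallyIsomorphic B.sharp B.distribution B.ball B.base
          B'.sharp B'.distribution B'.ball B'.base) := by
  refine ⟨fun σ ⟨B, hB⟩ => ⟨fun T _ _ _ i t hit hT => ⟨?_, fun W πT hW htW hπT B' hB' => ?_⟩,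
    fun B B' hB hB' => ?_⟩, fun hsplit σ σ' => ⟨fun T _ _ _ i t hit hT W πT hW htW hπT B hB => ?_,
    fun B B' hB hB' => ?_⟩⟩
  · exact hB.exists_induced hint hleaf hreg (hgen σ) hit hT
  · exact hB'.locallyIsomorphic_induced hint hleaf hreg hit hT hW htW hπT
  · exact hB.locallyIsomorphic hB' hint hleaf hreg
  -- The induced system is compared with a transverse system C at its own point σ, and C is then
  -- carried along the leaf to σ'.
  · obtain ⟨C, hC⟩ := hsplit σ
    exact (hC.locallyIsomorphic_induced hint hleaf hreg hit hT hW htW hπT).trans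
      (SplitSystem.locallyIsomorphic_of_isSplitAt hsplit hint hleaf hreg hC hB)
  · exact SplitSystem.locallyIsomorphic_of_isSplitAt hsplit hint hleaf hreg hB hB'
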